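/- **Conventions.** A *prederivator* is a (pseudo-)$2$-functor $\mathscr D\colon \mathrm{Cat}^{\mathrm{op}}\to\mathrm{CAT}$ from small categories to categories; $u\colon A\to B$ induces the restriction $u^*\colon\mathscr D(B)\to\mathscr D(A)$, and for $b\in B$ (a functor $b\colon *\to B$ from the terminal category) and $X\in\mathscr D(B)$ we write $X_b=b^*X\in\mathscr D(*)$. A morphism of prederivators is a pseudonatural transformation, a transformation of morphisms is a modification, and equivalences are understood in this $2$-category. A *derivator* is a prederivator such that (Der1) for every small family of small categories $(B_i)_{i\in I}$ the canonical functor $\mathscr D(\coprod_i B_i)\to\prod_i\mathscr D(B_i)$ is an equivalence; (Der2) a morphism $f$ in $\mathscr D(B)$ is an isomorphism if and only if $f_b$ is an isomorphism for all $b\in B$; (Der3) every $u^*$ has a left adjoint $u_!$ and a right adjoint $u_*$; (Der4) for $u\colon A\to B$ and $b\in B$ the canonical mates $\mathrm{colim}_{(u/b)}p^*\to b^*u_!$ and $b^*u_*\to\lim_{(b/u)}q^*$ are isomorphisms, where $p\colon (u/b)\to A$ and $q\colon (b/u)\to A$ are the projections. Let $\square=[1]\times[1]$. An object of $\mathscr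 D(\square)$ is *cocartesian* (*cartesian*) if it lies in the essential image of the left (right) Kan extension along the inclusion of $\square$ without its final (initial) vertex, and *bicartesian* if it is both. A derivator is *stable* if $\mathscr D(*)$ has a zero object and an object of $\mathscr D(\square)$ is cocartesian if and only if it is cartesian. A morphism of derivators is *exact* if it preserves initial objects and pushouts, and terminal objects and pullbacks (i.e. the canonical comparison transformations are isomorphisms). For a small category $A$ let $\mathscr D^A$ be the prederivator $\mathscr D^A(B)=\mathscr D(A\times B)$. For $n\ge 0$ let $\vec A_n=(1<\dots<n)$, and let $M_n$ be the poset with elements $(k,l)$, $k\in\mathbb Z$, $0\le l\le n+1$, whose order is generated by $(k,l)<(k,l+1)$ and $(k,l)<(k+1,l-1)$. (It is the category obtained from the quiver with these arrows by making all squares commute.) For a stable derivator $\mathscr D$ let $\mathscr D^{M_n,\mathrm{ex}}\subseteq\mathscr D^{M_n}$ be the full subprederivator such that $X\in\mathscr D(M_n\times B)$ belongs to $\mathscr D^{M_n,\mathrm{ex}}(B)$ if and only if for every $b\in B$ 1. $X_{((k,0),b)}$ and $X_{((k,n+1),b)}$ are zero objects for all $k\in\mathbb Z$, and 2. for all $k\in\mathbb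 Z$ and $1\le l\le n$ the square with vertices $((k,l),b)$, $((k,l+1),b)$, $((k+1,l-1),b)$, $((k+1,l),b)$ obtained from $X$ by restriction is bicartesian. Let $i\colon\vec A_n\to M_n$ be the functor $l\mapsto(0,l)$. **Theorem.** Let $n\ge 0$. * For every stable derivator $\mathscr D$, the prederivators $\mathscr D^{M_n}$, $\mathscr D^{\vec A_n}$ and $\mathscr D^{M_n,\mathrm{ex}}$ are derivators, the restriction along $i$ is an equivalence of derivators $$i^*\colon\mathscr D^{M_n,\mathrm{ex}}\xrightarrow{\ \sim\ }\mathscr D^{\vec A_n},$$ and the inclusion $\mathscr D^{M_n,\mathrm{ex}}\to\mathscr D^{M_n}$ is exact. * The equivalence is pseudo-natural with respect to exact morphisms: for every exact morphism $F\colon\mathscr D\to\mathscr E$ of stable derivators the induced morphism $F^{M_n}\colon\mathscr D^{M_n}\to\mathscr E^{M_n}$ restricts to a morphism $\mathscr D^{M_n,\mathrm{ex}}\to\mathscr E^{M_n,\mathrm{ex}}$. Hence $\mathscr D\mapsto\mathscr D^{M_n,\mathrm{ex}}$ and $\mathscr D\mapsto\mathscr D^{\vec A_n}$ are pseudofunctors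 from the $2$-category of stable derivators, exact morphisms and all transformations to the $2$-category of prederivators. The restrictions $i^*$, with the coherence isomorphisms given by the structure isomorphisms $i^*F\cong Fi^*$ of the morphisms $F$, form a pseudonatural transformation between these pseudofunctors, and this transformation is an equivalence (so that the inverse equivalences are pseudo-natural as well). -/

import Mathlib

open CategoryTheory Bicategory Opposite
open scoped CategoryTheory.Pseudofunctor.StrongTrans

universe w v u w₁ w₂ v₁ v₂ u₁ u₂ w₃ v₃ u₃

noncomputable section

/-! ### Precomposition with a pseudofunctor -/

namespace Precomp

variable {B : Type u₁} [Bicategory.{w₁, v₁} B] {B' : Type u₂} [Bicategory.{w₂, v₂} B']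
  {C : Type u₃} [Bicategory.{w₃, v₃} C] (P : B ⥤ᵖ B')

theorem aux_id {F G : B' ⥤ᵖ C} (η : F ⟶ G) (a : B) :
    (η.naturality (P.map (𝟙 a))).hom ≫
      η.app (P.obj a) ◁ (G.map₂ (P.mapId a).hom ≫ (G.mapId (P.obj a)).hom) =
    (F.map₂ (P.mapId a).hom ≫ (F.mapId (P.obj a)).hom) ▷ η.app (P.obj a) ≫
      (λ_ (η.app (P.obj a))).hom ≫ (ρ_ (η.app (P.obj a))).inv := by
  rw [Bicategory.whiskerLeft_comp, Bicategory.comp_whiskerRight,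
    ← reassoc_of% η.naturality_naturality (P.mapId a).hom, η.naturality_id, Category.assoc]

theorem aux_comp {F G : B' ⥤ᵖ C} (η : F ⟶ G) {a b c : B} (f : a ⟶ b) (g : b ⟶ c) :
    (η.naturality (P.map (f ≫ g))).hom ≫
      η.app (P.obj a) ◁ (G.map₂ (P.mapComp f g).hom ≫ (G.mapComp (P.map f) (P.map g)).hom) =
    (F.map₂ (P.mapComp f g).hom ≫ (F.mapComp (P.map f) (P.map g)).hom) ▷ η.app (P.obj c) ≫
      (α_ _ _ _).hom ≫ F.map (P.map f) ◁ (η.naturality (P.map g)).hom ≫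
        (α_ _ _ _).inv ≫ (η.naturality (P.map f)).hom ▷ G.map (P.map g) ≫ (α_ _ _ _).hom := by
  rw [Bicategory.whiskerLeft_comp, Bicategory.comp_whiskerRight,
    ← reassoc_of% η.naturality_naturality (P.mapComp f g).hom, η.naturality_comp, Category.assoc]

/-- Whiskering a strong transformation with a pseudofunctor. -/
def transf {F G : B' ⥤ᵖ C} (η : F ⟶ G) : P.comp F ⟶ P.comp G where
  app a := η.app (P.obj a)
  naturality f := η.naturality (P.map f)
  naturality_naturality α := η.naturality_naturality (P.map₂ α)
  naturality_id a := aux_id P η a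
  naturality_comp f g := aux_comp P η f g

/-- Whiskering a modification with a pseudofunctor. -/
def modif {F G : B' ⥤ᵖ C} {η θ : F ⟶ G} (Γ : η ⟶ θ) : transf P η ⟶ transf P θ where
  as :=
    { app a := Γ.as.app (P.obj a)
      naturality f := Γ.as.naturality (P.map f) }

/-- Precomposition with `P`, as a pseudofunctor between bicategories of pseudofunctors. -/
def functor : (B' ⥤ᵖ C) ⥤ᵖ (B ⥤ᵖ C) where
  obj F := P.comp F
  map η := transf P η
  map₂ Γ := modif P Γ
  map₂_id _ := rfl
  map₂_comp _ _ := rfl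
  mapId F := Pseudofunctor.StrongTrans.isoMk (fun a => Iso.refl (𝟙 (F.obj (P.obj a))))
    (fun {a b} f => by
      change F.map (P.map f) ◁ 𝟙 _ ≫ ((ρ_ (F.map (P.map f))).hom ≫ (λ_ (F.map (P.map f))).inv) =
        ((ρ_ (F.map (P.map f))).hom ≫ (λ_ (F.map (P.map f))).inv) ≫ 𝟙 _ ▷ F.map (P.map f)
      simp)
  mapComp {F G H} η θ := Pseudofunctor.StrongTrans.isoMk
    (fun a => Iso.refl (η.app (P.obj a) ≫ θ.app (P.obj a)))
    (fun {a b} f => by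
      change F.map (P.map f) ◁ 𝟙 _ ≫ ((η ≫ θ).naturality (P.map f)).hom =
        ((η ≫ θ).naturality (P.map f)).hom ≫ 𝟙 _ ▷ H.map (P.map f)
      rw [Bicategory.whiskerLeft_id, Bicategory.id_whiskerRight]
      exact (Category.id_comp _).trans (Category.comp_id _).symm)
  map₂_whisker_left η _ _ Γ := by
    ext a
    change η.app (P.obj a) ◁ Γ.as.app (P.obj a) =
      𝟙 _ ≫ η.app (P.obj a) ◁ Γ.as.app (P.obj a) ≫ 𝟙 _
    simp
  map₂_whisker_right Γ η := by
    ext a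
    change Γ.as.app (P.obj a) ▷ η.app (P.obj a) =
      𝟙 _ ≫ Γ.as.app (P.obj a) ▷ η.app (P.obj a) ≫ 𝟙 _
    simp
  map₂_associator η θ ι := by
    ext a
    change (α_ (η.app (P.obj a)) (θ.app (P.obj a)) (ι.app (P.obj a))).hom =
      𝟙 _ ≫ 𝟙 _ ▷ ι.app (P.obj a) ≫
        (α_ (η.app (P.obj a)) (θ.app (P.obj a)) (ι.app (P.obj a))).hom ≫
          η.app (P.obj a) ◁ 𝟙 _ ≫ 𝟙 _
    simp
  map₂_left_unitor η := by
    ext a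
    change (λ_ (η.app (P.obj a))).hom =
      𝟙 _ ≫ 𝟙 _ ▷ η.app (P.obj a) ≫ (λ_ (η.app (P.obj a))).hom
    simp
  map₂_right_unitor η := by
    ext a
    change (ρ_ (η.app (P.obj a))).hom =
      𝟙 _ ≫ η.app (P.obj a) ◁ 𝟙 _ ≫ (ρ_ (η.app (P.obj a))).hom
    simp

end Precomp

namespace Precomp

variable {B : Type u₁} [Bicategory.{w₁, v₁} B] {B' : Type u₂} [Bicategory.{w₂, v₂} B']
  {C : Type u₃} [Bicategory.{w₃, v₃} C] {P Q : B ⥤ᵖ B'} (η : P ⟶ Q)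

theorem post_naturality (F : B' ⥤ᵖ C) {a b : B} {f g : a ⟶ b} (α : f ⟶ g) :
    F.map₂ (P.map₂ α) ▷ F.map (η.app b) ≫ (F.mapComp (P.map g) (η.app b)).inv ≫
      F.map₂ (η.naturality g).hom ≫ (F.mapComp (η.app a) (Q.map g)).hom =
    ((F.mapComp (P.map f) (η.app b)).inv ≫
      F.map₂ (η.naturality f).hom ≫ (F.mapComp (η.app a) (Q.map f)).hom) ≫
        F.map (η.app a) ◁ F.map₂ (Q.map₂ α) := by
  have h := congr(F.map₂ $(η.naturality_naturality α))
  simp only [F.map₂_comp, F.map₂_whisker_left, F.map₂_whisker_right, Category.assoc] at h ⊢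
  rw [← cancel_epi (F.mapComp (P.map f) (η.app b)).hom, reassoc_of% h]
  simp

theorem post_id (F : B' ⥤ᵖ C) (a : B) :
    ((F.mapComp (P.map (𝟙 a)) (η.app a)).inv ≫ F.map₂ (η.naturality (𝟙 a)).hom ≫
      (F.mapComp (η.app a) (Q.map (𝟙 a))).hom) ≫
      F.map (η.app a) ◁ (F.map₂ (Q.mapId a).hom ≫ (F.mapId (Q.obj a)).hom) =
    (F.map₂ (P.mapId a).hom ≫ (F.mapId (P.obj a)).hom) ▷ F.map (η.app a) ≫
      (λ_ (F.map (η.app a))).hom ≫ (ρ_ (F.map (η.app a))).inv := by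
  have h := congr(F.map₂ ($(η.naturality_id a) ≫ (ρ_ (η.app a)).hom))
  simp only [F.map₂_comp, F.map₂_whisker_left, F.map₂_whisker_right, F.map₂_right_unitor,
    F.map₂_left_unitor, Category.assoc, Iso.inv_hom_id, Iso.inv_hom_id_assoc,
    Category.comp_id] at h
  rw [← cancel_mono (ρ_ (F.map (η.app a))).hom,
    ← cancel_epi (F.mapComp (P.map (𝟙 a)) (η.app a)).hom]
  simp only [Bicategory.whiskerLeft_comp, Bicategory.comp_whiskerRight, Category.assoc,
    Iso.hom_inv_id_assoc, Iso.inv_hom_id, Category.comp_id]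
  exact h

theorem map₂_assoc_inv (F : B' ⥤ᵖ C) {a b c d : B'} (f : a ⟶ b) (g : b ⟶ c) (h : c ⟶ d) :
    F.map₂ (α_ f g h).inv = (F.mapComp f (g ≫ h)).hom ≫ F.map f ◁ (F.mapComp g h).hom ≫
      (α_ _ _ _).inv ≫ (F.mapComp f g).inv ▷ F.map h ≫ (F.mapComp (f ≫ g) h).inv := by
  rw [← cancel_epi (F.map₂ (α_ f g h).hom), ← F.map₂_comp, Iso.hom_inv_id, F.map₂_id,
    F.map₂_associator]
  simp

theorem post_comp (F : B' ⥤ᵖ C) {a b c : B} (f : a ⟶ b) (g : b ⟶ c) :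
    ((F.mapComp (P.map (f ≫ g)) (η.app c)).inv ≫ F.map₂ (η.naturality (f ≫ g)).hom ≫
      (F.mapComp (η.app a) (Q.map (f ≫ g))).hom) ≫
      F.map (η.app a) ◁ (F.map₂ (Q.mapComp f g).hom ≫ (F.mapComp (Q.map f) (Q.map g)).hom) =
    (F.map₂ (P.mapComp f g).hom ≫ (F.mapComp (P.map f) (P.map g)).hom) ▷ F.map (η.app c) ≫
      (α_ _ _ _).hom ≫ F.map (P.map f) ◁ ((F.mapComp (P.map g) (η.app c)).inv ≫
        F.map₂ (η.naturality g).hom ≫ (F.mapComp (η.app b) (Q.map g)).hom) ≫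
      (α_ _ _ _).inv ≫ ((F.mapComp (P.map f) (η.app b)).inv ≫
        F.map₂ (η.naturality f).hom ≫ (F.mapComp (η.app a) (Q.map f)).hom) ▷ F.map (Q.map g) ≫
      (α_ _ _ _).hom := by
  have h := congr(F.map₂ $(η.naturality_comp f g))
  simp only [F.map₂_comp, F.map₂_whisker_left, F.map₂_whisker_right, F.map₂_associator,
    map₂_assoc_inv, Category.assoc, Iso.inv_hom_id_assoc] at h
  rw [← cancel_epi (F.mapComp (P.map (f ≫ g)) (η.app c)).hom,
    ← cancel_mono (F.map (η.app a) ◁ (F.mapComp (Q.map f) (Q.map g)).inv),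
    ← cancel_mono (F.mapComp (η.app a) (Q.map f ≫ Q.map g)).inv]
  simp only [Bicategory.whiskerLeft_comp, Bicategory.comp_whiskerRight, Category.assoc,
    Iso.hom_inv_id_assoc, Bicategory.whiskerLeft_hom_inv_assoc] at h ⊢
  exact h

/-- Whiskering a strong transformation with a pseudofunctor on the other side. -/
def post (F : B' ⥤ᵖ C) : P.comp F ⟶ Q.comp F where
  app a := F.map (η.app a)
  naturality {a b} f := (F.mapComp (P.map f) (η.app b)).symm ≪≫ F.map₂Iso (η.naturality f) ≪≫
    F.mapComp (η.app a) (Q.map f)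
  naturality_naturality α := post_naturality η F α
  naturality_id a := post_id η F a
  naturality_comp f g := post_comp η F f g

theorem postTransf_naturality {F G : B' ⥤ᵖ C} (θ : F ⟶ G) {a b : B} (f : a ⟶ b) :
    F.map (P.map f) ◁ (θ.naturality (η.app b)).inv ≫
    ((α_ _ _ _).inv ≫ ((F.mapComp (P.map f) (η.app b)).inv ≫ F.map₂ (η.naturality f).hom ≫
      (F.mapComp (η.app a) (Q.map f)).hom) ▷ θ.app (Q.obj b) ≫ (α_ _ _ _).hom ≫
      F.map (η.app a) ◁ (θ.naturality (Q.map f)).hom ≫ (α_ _ _ _).inv) =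
    ((α_ _ _ _).inv ≫ (θ.naturality (P.map f)).hom ▷ G.map (η.app b) ≫ (α_ _ _ _).hom ≫
      θ.app (P.obj a) ◁ ((G.mapComp (P.map f) (η.app b)).inv ≫ G.map₂ (η.naturality f).hom ≫
      (G.mapComp (η.app a) (Q.map f)).hom) ≫ (α_ _ _ _).inv) ≫
      (θ.naturality (η.app a)).inv ▷ G.map (Q.map f) := by
  have h := θ.naturality_naturality (η.naturality f).hom
  have h1 : F.map (P.map f) ◁ (θ.naturality (η.app b)).hom ≫ (α_ _ _ _).inv ≫
      (θ.naturality (P.map f)).hom ▷ G.map (η.app b) ≫ (α_ _ _ _).hom =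
      (α_ _ _ _).inv ≫ (F.mapComp (P.map f) (η.app b)).inv ▷ θ.app (Q.obj b) ≫
        (θ.naturality (P.map f ≫ η.app b)).hom ≫
          θ.app (P.obj a) ◁ (G.mapComp (P.map f) (η.app b)).hom := by
    rw [θ.naturality_comp]
    simp
  have h2 : (F.mapComp (η.app a) (Q.map f)).hom ▷ θ.app (Q.obj b) ≫ (α_ _ _ _).hom ≫
      F.map (η.app a) ◁ (θ.naturality (Q.map f)).hom ≫ (α_ _ _ _).inv ≫
        (θ.naturality (η.app a)).hom ▷ G.map (Q.map f) =
      (θ.naturality (η.app a ≫ Q.map f)).hom ≫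
        θ.app (P.obj a) ◁ (G.mapComp (η.app a) (Q.map f)).hom ≫ (α_ _ _ _).inv := by
    rw [← cancel_mono (α_ _ _ _).hom]
    simp only [Category.assoc, Iso.inv_hom_id, Category.comp_id]
    rw [θ.naturality_comp]
  rw [← cancel_mono ((θ.naturality (η.app a)).hom ▷ G.map (Q.map f)),
    ← cancel_epi (F.map (P.map f) ◁ (θ.naturality (η.app b)).hom)]
  simp only [Category.assoc, Bicategory.whiskerLeft_hom_inv_assoc, Bicategory.whiskerLeft_comp,
    Bicategory.comp_whiskerRight, Bicategory.inv_hom_whiskerRight, Category.comp_id]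
  rw [reassoc_of% h1, h2, reassoc_of% h]
  simp

/-- Whiskering on both sides commutes up to isomorphism. -/
def postNat {F G : B' ⥤ᵖ C} (θ : F ⟶ G) : transf P θ ≫ post η G ≅ post η F ≫ transf Q θ :=
  Pseudofunctor.StrongTrans.isoMk (fun a => (θ.naturality (η.app a)).symm)
    (fun f => postTransf_naturality η θ f)

/-- Whiskering with `η` as a strong transformation between precomposition pseudofunctors. -/
def postTransf : functor (C := C) P ⟶ functor Q where
  app F := post η F
  naturality θ := postNat η θ
  naturality_naturality {F G θ θ'} Γ := by
    ext a
    change Γ.as.app (P.obj a) ▷ G.map (η.app a) ≫ (θ'.naturality (η.app a)).inv =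
      (θ.naturality (η.app a)).inv ≫ F.map (η.app a) ◁ Γ.as.app (Q.obj a)
    rw [Iso.comp_inv_eq, Category.assoc, Γ.as.naturality, Iso.inv_hom_id_assoc]
  naturality_id F := by
    ext a
    change ((λ_ (F.map (η.app a))).hom ≫ (ρ_ (F.map (η.app a))).inv) ≫ F.map (η.app a) ◁ 𝟙 _ =
      𝟙 _ ▷ F.map (η.app a) ≫ (λ_ (F.map (η.app a))).hom ≫ (ρ_ (F.map (η.app a))).inv
    simp
  naturality_comp {F G H} θ θ' := by
    ext a
    have e : ((θ ≫ θ').naturality (η.app a)).inv =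
      (α_ _ _ _).hom ≫ θ.app (P.obj a) ◁ (θ'.naturality (η.app a)).inv ≫ (α_ _ _ _).inv ≫
        (θ.naturality (η.app a)).inv ▷ θ'.app (Q.obj a) ≫ (α_ _ _ _).hom := by
      refine (Pseudofunctor.StrongTrans.categoryStruct_comp_naturality_inv
        θ θ' (η.app a)).trans ?_
      refine (Category.assoc (_ : _ ⟶ _) _ _).trans ?_
      refine (Category.assoc (_ : _ ⟶ _) _ _).trans ?_
      exact Category.assoc (_ : _ ⟶ _) _ _
    change ((θ ≫ θ').naturality (η.app a)).inv ≫ F.map (η.app a) ◁ 𝟙 _ =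
      𝟙 _ ▷ H.map (η.app a) ≫ (α_ _ _ _).hom ≫
        θ.app (P.obj a) ◁ (θ'.naturality (η.app a)).inv ≫ (α_ _ _ _).inv ≫
        (θ.naturality (η.app a)).inv ▷ θ'.app (Q.obj a) ≫ (α_ _ _ _).hom
    rw [e]
    simp

end Precomp

/-! ### Prederivators -/

set_option linter.checkUnivs false in
/-- A prederivator: a `2`-functor from small categories (with `1`-cells reversed)
to categories. -/
abbrev Prederivator := Cat.{w, w}ᵒᵖ ⥤ᵖ Cat.{v, u}

namespace Prederivator

/-- The terminal category. -/
abbrev pt : Cat.{w, w} := Cat.of (Discrete PUnit.{w + 1})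

/-- The functor to the terminal category. -/
abbrev toPt (A : Cat.{w, w}) : A ⟶ pt := (Functor.star.{w} A).toCatHom

/-- The functor from the terminal category which picks out an object. -/
abbrev point {A : Cat.{w, w}} (a : A) : pt ⟶ A := (Functor.fromPUnit.{w} a).toCatHom

section

variable (D : Prederivator.{w, v, u})

/-- The category of coherent diagrams of shape `A`. -/
abbrev dia (A : Cat.{w, w}) : Cat.{v, u} := D.obj (op A)

/-- Restriction along `u`. -/
abbrev restr {A B : Cat.{w, w}} (u : A ⟶ B) : D.dia B ⥤ D.dia A :=
  (D.map u.op).toFunctor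

/-- The natural transformation `p^* u^* ⟶ q^* v^*` induced by `u p ⟶ v q`. -/
def square {A B B' C : Cat.{w, w}} {p : A ⟶ B} {u : B ⟶ C} {q : A ⟶ B'} {v : B' ⟶ C}
    (α : p ≫ u ⟶ q ≫ v) : D.restr u ⋙ D.restr p ⟶ D.restr v ⋙ D.restr q :=
  ((D.mapComp u.op p.op).inv ≫ D.map₂ (Bicategory.Opposite.op2 α) ≫
    (D.mapComp v.op q.op).hom).toNatTrans

/-- For left adjoints `L₁ = u_!` and `L₂ = colim_{(u/b)}`, the canonical transformation
`colim_{(u/b)} p^* ⟶ b^* u_!`. -/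
def leftMate {A B : Cat.{w, w}} (u : A ⟶ B) (b : B)
    {L₁ : D.dia A ⥤ D.dia B} (adj₁ : L₁ ⊣ D.restr u)
    {L₂ : D.dia (Cat.of (Comma u.toFunctor (Functor.fromPUnit.{w} b))) ⥤ D.dia pt}
    (adj₂ : L₂ ⊣ D.restr (Comma.snd u.toFunctor (Functor.fromPUnit.{w} b)).toCatHom) :
    D.restr (Comma.fst u.toFunctor (Functor.fromPUnit.{w} b)).toCatHom ⋙ L₂ ⟶
      L₁ ⋙ D.restr (point b) :=
  (mateEquiv adj₁ adj₂).symm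
    (D.square (NatTrans.toCatHom₂ (Comma.natTrans u.toFunctor (Functor.fromPUnit.{w} b))))

/-- For right adjoints `R₁ = u_*` and `R₂ = lim_{(b/u)}`, the canonical transformation
`b^* u_* ⟶ lim_{(b/u)} q^*`. -/
def rightMate {A B : Cat.{w, w}} (u : A ⟶ B) (b : B)
    {R₁ : D.dia A ⥤ D.dia B} (adj₁ : D.restr u ⊣ R₁)
    {R₂ : D.dia (Cat.of (Comma (Functor.fromPUnit.{w} b) u.toFunctor)) ⥤ D.dia pt}
    (adj₂ : D.restr (Comma.fst (Functor.fromPUnit.{w} b) u.toFunctor).toCatHom ⊣ R₂) :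
    R₁ ⋙ D.restr (point b) ⟶
      D.restr (Comma.snd (Functor.fromPUnit.{w} b) u.toFunctor).toCatHom ⋙ R₂ :=
  mateEquiv adj₁ adj₂
    (D.square (NatTrans.toCatHom₂ (Comma.natTrans (Functor.fromPUnit.{w} b) u.toFunctor)))

/-- The axioms (Der1)-(Der4) of a derivator. -/
structure IsDerivator : Prop where
  der1 : ∀ (I : Type w) (B : I → Cat.{w, w}),
    (Functor.pi' fun i : I => D.restr (A := B i) (B := Cat.of (Σ i, B i))
      (Sigma.incl (C := fun i => (B i : Type w)) i).toCatHom).IsEquivalence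
  der2 : ∀ (B : Cat.{w, w}) {X Y : D.dia B} (f : X ⟶ Y),
    IsIso f ↔ ∀ b : B, IsIso ((D.restr (point b)).map f)
  der3_left : ∀ {A B : Cat.{w, w}} (u : A ⟶ B), (D.restr u).IsRightAdjoint
  der3_right : ∀ {A B : Cat.{w, w}} (u : A ⟶ B), (D.restr u).IsLeftAdjoint
  der4_left : ∀ {A B : Cat.{w, w}} (u : A ⟶ B) (b : B)
    {L₁ : D.dia A ⥤ D.dia B} (adj₁ : L₁ ⊣ D.restr u)
    {L₂ : D.dia (Cat.of (Comma u.toFunctor (Functor.fromPUnit.{w} b))) ⥤ D.dia pt}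
    (adj₂ : L₂ ⊣ D.restr (Comma.snd u.toFunctor (Functor.fromPUnit.{w} b)).toCatHom),
    IsIso (D.leftMate u b adj₁ adj₂)
  der4_right : ∀ {A B : Cat.{w, w}} (u : A ⟶ B) (b : B)
    {R₁ : D.dia A ⥤ D.dia B} (adj₁ : D.restr u ⊣ R₁)
    {R₂ : D.dia (Cat.of (Comma (Functor.fromPUnit.{w} b) u.toFunctor)) ⥤ D.dia pt}
    (adj₂ : D.restr (Comma.fst (Functor.fromPUnit.{w} b) u.toFunctor).toCatHom ⊣ R₂),
    IsIso (D.rightMate u b adj₁ adj₂)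

end

/-! ### Posets as shapes -/

/-- A copy of `α` in the universe of small categories. -/
structure Shape (α : Type) : Type w where
  val : α

instance (α : Type) [Preorder α] : Preorder (Shape.{w} α) := Preorder.lift Shape.val

/-- A preordered set as a small category. -/
abbrev shape (α : Type) [Preorder α] : Cat.{w, w} := Cat.of (Shape.{w} α)

/-- A monotone map as a functor. -/
def shapeMap {α β : Type} [Preorder α] [Preorder β] (f : α → β) (hf : Monotone f) :
    shape.{w} α ⟶ shape.{w} β :=
  (Monotone.functor (f := fun x : Shape.{w} α => (⟨f x.val⟩ : Shape.{w} β))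
    (fun _ _ h => hf h)).toCatHom

/-- The square `[1] × [1]`; the second coordinate is the horizontal one. -/
abbrev Sq : Type := Fin 2 × Fin 2

/-- The square without its final vertex. -/
abbrev Span : Type := {x : Sq // x ≠ (1, 1)}

/-- The square without its initial vertex. -/
abbrev Cospan : Type := {x : Sq // x ≠ (0, 0)}

def spanIncl : shape.{w} Span ⟶ shape.{w} Sq := shapeMap Subtype.val (fun _ _ h => h)

def cospanIncl : shape.{w} Cospan ⟶ shape.{w} Sq := shapeMap Subtype.val (fun _ _ h => h)

section

variable (D : Prederivator.{w, v, u})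

/-- A square is cocartesian if it lies in the essential image of left Kan extension along
the inclusion of the span. -/
def IsCocartesian (X : D.dia (shape Sq)) : Prop :=
  ∃ (L : D.dia (shape Span) ⥤ D.dia (shape Sq)) (_ : L ⊣ D.restr spanIncl), L.essImage X

/-- A square is cartesian if it lies in the essential image of right Kan extension along
the inclusion of the cospan. -/
def IsCartesian (X : D.dia (shape Sq)) : Prop :=
  ∃ (R : D.dia (shape Cospan) ⥤ D.dia (shape Sq)) (_ : D.restr cospanIncl ⊣ R), R.essImage X

def IsBicartesian (X : D.dia (shape Sq)) : Prop := D.IsCocartesian X ∧ D.IsCartesian X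

/-- A stable derivator is a pointed derivator in which a square is cocartesian if and only if
it is cartesian. -/
structure IsStable : Prop where
  isDerivator : D.IsDerivator
  pointed : Limits.HasZeroObject (D.dia pt)
  cocartesian_iff : ∀ X : D.dia (shape Sq), D.IsCocartesian X ↔ D.IsCartesian X

end

/-! ### Exact morphisms -/

section

variable {D E : Prederivator.{w, v, u}} (F : D ⟶ E)

/-- For left adjoints `L₁`, `L₂` of the diagonal functors (colimits of shape `A` in `D`, `E`),
the canonical transformation `colim_A F ⟶ F colim_A`. -/
def colimMate (A : Cat.{w, w}) {L₁ : D.dia A ⥤ D.dia pt} (adj₁ : L₁ ⊣ D.restr (toPt A))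
    {L₂ : E.dia A ⥤ E.dia pt} (adj₂ : L₂ ⊣ E.restr (toPt A)) :
    (F.app (op A)).toFunctor ⋙ L₂ ⟶ L₁ ⋙ (F.app (op pt)).toFunctor :=
  (mateEquiv adj₁ adj₂).symm (F.naturality (toPt A).op).hom.toNatTrans

/-- For right adjoints `R₁`, `R₂` of the diagonal functors (limits of shape `A` in `D`, `E`),
the canonical transformation `F lim_A ⟶ lim_A F`. -/
def limMate (A : Cat.{w, w}) {R₁ : D.dia A ⥤ D.dia pt} (adj₁ : D.restr (toPt A) ⊣ R₁)
    {R₂ : E.dia A ⥤ E.dia pt} (adj₂ : E.restr (toPt A) ⊣ R₂) :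
    R₁ ⋙ (F.app (op pt)).toFunctor ⟶ (F.app (op A)).toFunctor ⋙ R₂ :=
  mateEquiv adj₁ adj₂ (F.naturality (toPt A).op).inv.toNatTrans

def PreservesColim (A : Cat.{w, w}) : Prop :=
  ∀ {L₁ : D.dia A ⥤ D.dia pt} (adj₁ : L₁ ⊣ D.restr (toPt A))
    {L₂ : E.dia A ⥤ E.dia pt} (adj₂ : L₂ ⊣ E.restr (toPt A)), IsIso (colimMate F A adj₁ adj₂)

def PreservesLim (A : Cat.{w, w}) : Prop :=
  ∀ {R₁ : D.dia A ⥤ D.dia pt} (adj₁ : D.restr (toPt A) ⊣ R₁)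
    {R₂ : E.dia A ⥤ E.dia pt} (adj₂ : E.restr (toPt A) ⊣ R₂), IsIso (limMate F A adj₁ adj₂)

/-- A morphism is right exact if it preserves initial objects and pushouts. -/
structure IsRightExact : Prop where
  initial : ∀ X : D.dia pt, Nonempty (Limits.IsInitial X) →
    Nonempty (Limits.IsInitial ((F.app (op pt)).toFunctor.obj X))
  pushouts : PreservesColim F (shape Span)

/-- A morphism is left exact if it preserves terminal objects and pullbacks. -/
structure IsLeftExact : Prop where
  terminal : ∀ X : D.dia pt, Nonempty (Limits.IsTerminal X) →
    Nonempty (Limits.IsTerminal ((F.app (op pt)).toFunctor.obj X))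
  pullbacks : PreservesLim F (shape Cospan)

structure IsExact : Prop where
  right : IsRightExact F
  left : IsLeftExact F

end

/-! ### Identities and composites of exact morphisms are exact -/

section mates

variable {C₁ : Type u₁} {C₂ : Type u₂} {C₃ : Type u₃} [Category.{v₁} C₁] [Category.{v₂} C₂]
  [Category.{v₃} C₃] {D₁ : Type u₁} {D₂ : Type u₂} {D₃ : Type u₃} [Category.{v₁} D₁]
  [Category.{v₂} D₂] [Category.{v₃} D₃]

theorem isIso_mate_id {R L₁ L₂ : _} (adj₁ : (L₁ : C₁ ⥤ D₁) ⊣ (R : D₁ ⥤ C₁)) (adj₂ : L₂ ⊣ R)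
    (α : TwoSquare R (𝟭 D₁) (𝟭 C₁) R) (hα : ∀ X, α.app X = 𝟙 _) :
    IsIso ((mateEquiv adj₁ adj₂).symm α).natTrans := by
  have : ∀ X, ((mateEquiv adj₁ adj₂).symm α).natTrans.app X =
      (adj₂.leftAdjointUniq adj₁).hom.app X := by
    intro X
    apply (adj₂.homEquiv _ _).injective
    rw [Adjunction.homEquiv_leftAdjointUniq_hom_app]
    have h := unit_mateEquiv_symm adj₁ adj₂ α X
    rw [hα] at h
    simpa [Adjunction.homEquiv_unit] using h.symm
  have : ∀ X, IsIso (((mateEquiv adj₁ adj₂).symm α).natTrans.app X) := fun X => by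
    rw [this X]; infer_instance
  exact NatIso.isIso_of_isIso_app _

theorem isIso_mate_id' {L R₁ R₂ : _} (adj₁ : (L : C₁ ⥤ D₁) ⊣ (R₁ : D₁ ⥤ C₁)) (adj₂ : L ⊣ R₂)
    (α : TwoSquare (𝟭 C₁) L L (𝟭 D₁)) (hα : ∀ X, α.app X = 𝟙 _) :
    IsIso (mateEquiv adj₁ adj₂ α).natTrans := by
  have : ∀ X, (mateEquiv adj₁ adj₂ α).natTrans.app X =
      (adj₁.rightAdjointUniq adj₂).hom.app X := by
    intro X
    apply (adj₂.homEquiv _ _).symm.injective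
    rw [Adjunction.homEquiv_symm_rightAdjointUniq_hom_app]
    have h := mateEquiv_counit adj₁ adj₂ α X
    rw [hα] at h
    simpa [Adjunction.homEquiv_counit] using h
  have : ∀ X, IsIso ((mateEquiv adj₁ adj₂ α).natTrans.app X) := fun X => by
    rw [this X]; infer_instance
  exact NatIso.isIso_of_isIso_app _

variable {L₁ : C₁ ⥤ D₁} {R₁ : D₁ ⥤ C₁} {L₂ : C₂ ⥤ D₂} {R₂ : D₂ ⥤ C₂} {L₃ : C₃ ⥤ D₃}
  {R₃ : D₃ ⥤ C₃} (adj₁ : L₁ ⊣ R₁) (adj₂ : L₂ ⊣ R₂) (adj₃ : L₃ ⊣ R₃)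
  {G : C₁ ⥤ C₂} {G' : C₂ ⥤ C₃} {H : D₁ ⥤ D₂} {H' : D₂ ⥤ D₃}

theorem isIso_mate_comp (α : TwoSquare R₁ H G R₂) (β : TwoSquare R₂ H' G' R₃)
    (γ : TwoSquare R₁ (H ⋙ H') (G ⋙ G') R₃)
    (hγ : ∀ Y, γ.app Y = G'.map (α.app Y) ≫ β.app (H.obj Y))
    [IsIso ((mateEquiv adj₁ adj₂).symm α).natTrans]
    [IsIso ((mateEquiv adj₂ adj₃).symm β).natTrans] :
    IsIso ((mateEquiv adj₁ adj₃).symm γ).natTrans := by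
  have : ∀ X, ((mateEquiv adj₁ adj₃).symm γ).natTrans.app X =
      ((mateEquiv adj₂ adj₃).symm β).natTrans.app (G.obj X) ≫
        H'.map (((mateEquiv adj₁ adj₂).symm α).natTrans.app X) := by
    intro X
    apply (adj₃.homEquiv _ _).injective
    rw [Adjunction.homEquiv_unit, Adjunction.homEquiv_unit]
    have h1 := unit_mateEquiv_symm adj₁ adj₂ α X
    have h2 := unit_mateEquiv_symm adj₂ adj₃ β (G.obj X)
    have h3 := unit_mateEquiv_symm adj₁ adj₃ γ X
    have h4 := β.natTrans.naturality (((mateEquiv adj₁ adj₂).symm α).natTrans.app X)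
    rw [hγ] at h3
    dsimp at h1 h2 h3 h4 ⊢
    rw [← h3, ← Functor.map_comp_assoc, h1, Functor.map_comp, Category.assoc, h4,
      reassoc_of% h2, ← Functor.map_comp]
  have : ∀ X, IsIso (((mateEquiv adj₁ adj₃).symm γ).natTrans.app X) := fun X => by
    rw [this X]; infer_instance
  exact NatIso.isIso_of_isIso_app _

theorem isIso_mate_comp' (α : TwoSquare G L₁ L₂ H) (β : TwoSquare G' L₂ L₃ H')
    (γ : TwoSquare (G ⋙ G') L₁ L₃ (H ⋙ H'))
    (hγ : ∀ Y, γ.app Y = β.app (G.obj Y) ≫ H'.map (α.app Y))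
    [IsIso (mateEquiv adj₁ adj₂ α).natTrans] [IsIso (mateEquiv adj₂ adj₃ β).natTrans] :
    IsIso (mateEquiv adj₁ adj₃ γ).natTrans := by
  have : ∀ X, (mateEquiv adj₁ adj₃ γ).natTrans.app X =
      G'.map ((mateEquiv adj₁ adj₂ α).natTrans.app X) ≫
        (mateEquiv adj₂ adj₃ β).natTrans.app (H.obj X) := by
    intro X
    apply (adj₃.homEquiv _ _).symm.injective
    rw [Adjunction.homEquiv_counit, Adjunction.homEquiv_counit]
    have h1 : L₂.map ((mateEquiv adj₁ adj₂ α).natTrans.app X) ≫ adj₂.counit.app (H.obj X) =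
      α.natTrans.app (R₁.obj X) ≫ H.map (adj₁.counit.app X) := mateEquiv_counit adj₁ adj₂ α X
    have h2 : L₃.map ((mateEquiv adj₂ adj₃ β).natTrans.app (H.obj X)) ≫
        adj₃.counit.app (H'.obj (H.obj X)) =
      β.natTrans.app (R₂.obj (H.obj X)) ≫ H'.map (adj₂.counit.app (H.obj X)) :=
      mateEquiv_counit adj₂ adj₃ β (H.obj X)
    have h3 : L₃.map ((mateEquiv adj₁ adj₃ γ).natTrans.app X) ≫
        adj₃.counit.app (H'.obj (H.obj X)) =
      γ.natTrans.app (R₁.obj X) ≫ H'.map (H.map (adj₁.counit.app X)) :=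
      mateEquiv_counit adj₁ adj₃ γ X
    have h4 : L₃.map (G'.map ((mateEquiv adj₁ adj₂ α).natTrans.app X)) ≫
        β.natTrans.app (R₂.obj (H.obj X)) =
      β.natTrans.app (G.obj (R₁.obj X)) ≫
        H'.map (L₂.map ((mateEquiv adj₁ adj₂ α).natTrans.app X)) :=
      β.natTrans.naturality ((mateEquiv adj₁ adj₂ α).natTrans.app X)
    have h5 : γ.natTrans.app (R₁.obj X) =
      β.natTrans.app (G.obj (R₁.obj X)) ≫ H'.map (α.natTrans.app (R₁.obj X)) := hγ _
    refine h3.trans ?_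
    rw [h5, Functor.map_comp, Category.assoc, Category.assoc]
    refine Eq.trans ?_ (congrArg (fun t => L₃.map (G'.map _) ≫ t) h2.symm)
    have h6 := reassoc_of% h4
    refine Eq.trans ?_ (h6 _).symm
    rw [← Functor.map_comp, ← Functor.map_comp, h1]
  have : ∀ X, IsIso ((mateEquiv adj₁ adj₃ γ).natTrans.app X) := fun X => by
    rw [this X]; infer_instance
  exact NatIso.isIso_of_isIso_app _

end mates

theorem comp_naturality_hom_app {D E G : Prederivator.{w, v, u}} (F : D ⟶ E) (F' : E ⟶ G)
    {A B : Cat.{w, w}ᵒᵖ} (f : A ⟶ B) (X : D.obj A) :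
    ((F ≫ F').naturality f).hom.toNatTrans.app X =
      (F'.app B).toFunctor.map ((F.naturality f).hom.toNatTrans.app X) ≫
        (F'.naturality f).hom.toNatTrans.app ((F.app A).toFunctor.obj X) := by
  change 𝟙 _ ≫ (F'.app B).toFunctor.map ((F.naturality f).hom.toNatTrans.app X) ≫ 𝟙 _ ≫
    (F'.naturality f).hom.toNatTrans.app ((F.app A).toFunctor.obj X) ≫ 𝟙 _ = _
  simp

theorem comp_naturality_inv_app {D E G : Prederivator.{w, v, u}} (F : D ⟶ E) (F' : E ⟶ G)
    {A B : Cat.{w, w}ᵒᵖ} (f : A ⟶ B) (X : D.obj A) :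
    ((F ≫ F').naturality f).inv.toNatTrans.app X =
      (F'.naturality f).inv.toNatTrans.app ((F.app A).toFunctor.obj X) ≫
        (F'.app B).toFunctor.map ((F.naturality f).inv.toNatTrans.app X) := by
  change (((((𝟙 _ ≫ (F'.naturality f).inv.toNatTrans.app ((F.app A).toFunctor.obj X)) ≫ 𝟙 _) ≫
    (F'.app B).toFunctor.map ((F.naturality f).inv.toNatTrans.app X)) ≫ 𝟙 _)) = _
  simp

theorem isExact_id (D : Prederivator.{w, v, u}) : IsExact (𝟙 D) where
  right :=
    { initial _ h := h
      pushouts adj₁ _ adj₂ := isIso_mate_id adj₁ adj₂ _ (fun X => by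
        change 𝟙 _ ≫ 𝟙 _ = _
        exact Category.id_comp _) }
  left :=
    { terminal _ h := h
      pullbacks adj₁ _ adj₂ := isIso_mate_id' adj₁ adj₂ _ (fun X => by
        change 𝟙 _ ≫ 𝟙 _ = _
        exact Category.id_comp _) }

theorem isExact_comp {D E G : Prederivator.{w, v, u}} (hE : E.IsDerivator)
    {F : D ⟶ E} {F' : E ⟶ G} (hF : IsExact F) (hF' : IsExact F') : IsExact (F ≫ F') where
  right :=
    { initial X h := hF'.right.initial _ (hF.right.initial X h)
      pushouts adj₁ _ adj₃ := by
        have := hE.der3_left (toPt (shape.{w} Span))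
        have adj₂ := Adjunction.ofIsRightAdjoint (E.restr (toPt (shape.{w} Span)))
        have h1 := hF.right.pushouts adj₁ adj₂
        have h2 := hF'.right.pushouts adj₂ adj₃
        exact @isIso_mate_comp _ _ _ _ _ _ _ _ _ _ _ _ _ _ _ _ _ _ adj₁ adj₂ adj₃ _ _ _ _
          _ _ _ (comp_naturality_hom_app F F' _) h1 h2 }
  left :=
    { terminal X h := hF'.left.terminal _ (hF.left.terminal X h)
      pullbacks adj₁ _ adj₃ := by
        have := hE.der3_right (toPt (shape.{w} Cospan))
        have adj₂ := Adjunction.ofIsLeftAdjoint (E.restr (toPt (shape.{w} Cospan)))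
        have h1 := hF.left.pullbacks adj₁ adj₂
        have h2 := hF'.left.pullbacks adj₂ adj₃
        exact @isIso_mate_comp' _ _ _ _ _ _ _ _ _ _ _ _ _ _ _ _ _ _ adj₁ adj₂ adj₃ _ _ _ _
          _ _ _ (comp_naturality_inv_app F F' _) h1 h2 }

end Prederivator

namespace Prederivator

/-! ### Exponentials -/

/-- The product `A × B`. -/
abbrev prod (A B : Cat.{w, w}) : Cat.{w, w} := Cat.of (A × B)

/-- The functor `u × v`. -/
abbrev prodMap {A A' B B' : Cat.{w, w}} (u : A ⟶ A') (v : B ⟶ B') : prod A B ⟶ prod A' B' :=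
  (u.toFunctor.prod v.toFunctor).toCatHom

theorem op2_ext {a b : Cat.{w, w}ᵒᵖ} {f g : a ⟶ b} {α β : f ⟶ g}
    (h : ∀ x, α.unop2.toNatTrans.app x = β.unop2.toNatTrans.app x) : α = β := by
  obtain ⟨α⟩ := α
  obtain ⟨β⟩ := β
  exact congrArg Bicategory.Opposite.Hom2.op2' (Cat.Hom₂.ext (NatTrans.ext (funext h)))

/-- The `2`-functor `A × -`. -/
def prodLeft (A : Cat.{w, w}) : Cat.{w, w}ᵒᵖ ⥤ᵖ Cat.{w, w}ᵒᵖ where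
  obj B := op (prod A B.unop)
  map v := (prodMap (𝟙 A) v.unop).op
  map₂ α := Bicategory.Opposite.op2
    (NatTrans.toCatHom₂ (NatTrans.prod (𝟙 (𝟭 A)) α.unop2.toNatTrans))
  map₂_id _ := rfl
  map₂_comp _ _ := op2_ext fun x => Prod.ext (Category.id_comp _).symm rfl
  mapId B := (Iso.refl (𝟙 (prod A B.unop))).op2
  mapComp u v := (Cat.Hom.isoMk (Iso.refl _)).op2
  map₂_whisker_left f g h η := op2_ext fun x => Prod.ext
    (by simp : (𝟙 x.1 : x.1 ⟶ x.1) = 𝟙 _ ≫ 𝟙 _ ≫ 𝟙 _)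
    (by simp : f.unop.toFunctor.map (η.unop2.toNatTrans.app x.2) =
      𝟙 _ ≫ f.unop.toFunctor.map (η.unop2.toNatTrans.app x.2) ≫ 𝟙 _)
  map₂_whisker_right η h := op2_ext fun x => Prod.ext
    (by simp : (𝟙 x.1 : x.1 ⟶ x.1) = 𝟙 _ ≫ 𝟙 _ ≫ 𝟙 _)
    (by simp : η.unop2.toNatTrans.app (h.unop.toFunctor.obj x.2) =
      𝟙 _ ≫ η.unop2.toNatTrans.app (h.unop.toFunctor.obj x.2) ≫ 𝟙 _)
  map₂_associator f g h := op2_ext fun x => Prod.ext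
    (by simp : (𝟙 x.1 : x.1 ⟶ x.1) = 𝟙 _ ≫ 𝟙 _ ≫ 𝟙 _ ≫ 𝟙 _ ≫ 𝟙 _)
    (by simp : 𝟙 (f.unop.toFunctor.obj (g.unop.toFunctor.obj (h.unop.toFunctor.obj x.2))) =
      𝟙 _ ≫ 𝟙 _ ≫ 𝟙 _ ≫ f.unop.toFunctor.map (𝟙 _) ≫ 𝟙 _)
  map₂_left_unitor f := op2_ext fun x => Prod.ext
    (by simp : (𝟙 x.1 : x.1 ⟶ x.1) = 𝟙 _ ≫ 𝟙 _ ≫ 𝟙 _)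
    (by simp : 𝟙 (f.unop.toFunctor.obj x.2) = 𝟙 _ ≫ 𝟙 _ ≫ 𝟙 _)
  map₂_right_unitor f := op2_ext fun x => Prod.ext
    (by simp : (𝟙 x.1 : x.1 ⟶ x.1) = 𝟙 _ ≫ 𝟙 _ ≫ 𝟙 _)
    (by simp : 𝟙 (f.unop.toFunctor.obj x.2) = 𝟙 _ ≫ f.unop.toFunctor.map (𝟙 _) ≫ 𝟙 _)

end Prederivator

namespace Prederivator

/-- Restriction along `u × B`, as a transformation which is natural in `B`. -/
def prodRestr {A A' : Cat.{w, w}} (u : A ⟶ A') : prodLeft A' ⟶ prodLeft A where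
  app B := (prodMap u (𝟙 B.unop)).op
  naturality v := (Cat.Hom.isoMk (Iso.refl (u.toFunctor.prod v.unop.toFunctor))).op2
  naturality_naturality {B B'} v v' α := op2_ext fun x => Prod.ext
    (by simp : 𝟙 (u.toFunctor.obj x.1) ≫ 𝟙 _ = 𝟙 _ ≫ u.toFunctor.map (𝟙 x.1))
    (by simp : α.unop2.toNatTrans.app x.2 ≫ 𝟙 _ = 𝟙 _ ≫ α.unop2.toNatTrans.app x.2)
  naturality_id B := op2_ext fun x => Prod.ext
    (by simp : 𝟙 (u.toFunctor.obj x.1) ≫ u.toFunctor.map (𝟙 _) = 𝟙 _ ≫ 𝟙 _ ≫ 𝟙 _)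
    (by simp : 𝟙 x.2 ≫ 𝟙 _ = 𝟙 _ ≫ 𝟙 _ ≫ 𝟙 _)
  naturality_comp {B B' B''} v v' := op2_ext fun x => Prod.ext
    (by simp : 𝟙 (u.toFunctor.obj x.1) ≫ u.toFunctor.map (𝟙 _) =
      𝟙 _ ≫ 𝟙 _ ≫ 𝟙 _ ≫ 𝟙 _ ≫ 𝟙 _ ≫ 𝟙 _)
    (by simp : 𝟙 (v.unop.toFunctor.obj (v'.unop.toFunctor.obj x.2)) ≫ 𝟙 _ =
      𝟙 _ ≫ 𝟙 _ ≫ v.unop.toFunctor.map (𝟙 _) ≫ 𝟙 _ ≫ 𝟙 _ ≫ 𝟙 _)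

/-- The prederivator `D^A` with `D^A(B) = D(A × B)`. -/
def exp (A : Cat.{w, w}) (D : Prederivator.{w, v, u}) : Prederivator.{w, v, u} :=
  (prodLeft A).comp D

/-! ### Full subprederivators -/

section

variable {C C' : Cat.{v, u}} (P : ObjectProperty C) (Q : ObjectProperty C')

/-- The functor between full subcategories induced by a functor. -/
def fullHom (F : C ⟶ C') (h : ∀ X, P X → Q (F.toFunctor.obj X)) :
    Cat.of P.FullSubcategory ⟶ Cat.of Q.FullSubcategory :=
  (Q.lift (P.ι ⋙ F.toFunctor) fun X => h _ X.property).toCatHom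

variable {P Q}

theorem full_ext {X : Cat.{v, u}} {F G : X ⟶ Cat.of Q.FullSubcategory} {α β : F ⟶ G}
    (h : ∀ x, (α.toNatTrans.app x).hom = (β.toNatTrans.app x).hom) : α = β :=
  Cat.Hom₂.ext (NatTrans.ext (funext fun x => ObjectProperty.hom_ext _ (h x)))

/-- The natural transformation between functors of full subcategories induced by a natural
transformation. -/
def fullHom₂ {F G : C ⟶ C'} (α : F ⟶ G) (h : ∀ X, P X → Q (F.toFunctor.obj X))
    (h' : ∀ X, P X → Q (G.toFunctor.obj X)) : fullHom P Q F h ⟶ fullHom P Q G h' :=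
  NatTrans.toCatHom₂
    { app X := ObjectProperty.homMk (α.toNatTrans.app X.obj)
      naturality _ _ f := ObjectProperty.hom_ext _ (α.toNatTrans.naturality f.hom) }

/-- The natural isomorphism between functors of full subcategories induced by a natural
isomorphism. -/
def fullIso {F G : C ⟶ C'} (α : F ≅ G) (h : ∀ X, P X → Q (F.toFunctor.obj X))
    (h' : ∀ X, P X → Q (G.toFunctor.obj X)) : fullHom P Q F h ≅ fullHom P Q G h' where
  hom := fullHom₂ α.hom h h'
  inv := fullHom₂ α.inv h' h
  hom_inv_id := full_ext fun x => Cat.Hom.hom_inv_id_toNatTrans_app α x.obj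
  inv_hom_id := full_ext fun x => Cat.Hom.inv_hom_id_toNatTrans_app α x.obj

end

theorem app_congr {C C' : Cat.{v, u}} {F G : C ⟶ C'} {α β : F ⟶ G} (h : α = β) (X : C) :
    α.toNatTrans.app X = β.toNatTrans.app X := by rw [h]

section

variable (D : Prederivator.{w, v, u}) (P : ∀ B : Cat.{w, w}ᵒᵖ, ObjectProperty (D.obj B))

/-- A property of coherent diagrams is stable if it is preserved by restrictions. -/
def Restricts : Prop :=
  ∀ ⦃A B : Cat.{w, w}ᵒᵖ⦄ (f : A ⟶ B) (X : D.obj A), P A X → P B ((D.map f).toFunctor.obj X)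

variable {P} (hP : Restricts D P)

/-- The full subprederivator spanned by the coherent diagrams with property `P`. -/
def sub : Prederivator.{w, v, u} where
  obj B := Cat.of (P B).FullSubcategory
  map f := fullHom _ _ (D.map f) (hP f)
  map₂ {_ _ f g} α := fullHom₂ (D.map₂ α) (hP f) (hP g)
  map₂_id f := full_ext fun X => app_congr (D.map₂_id f) X.obj
  map₂_comp α β := full_ext fun X => app_congr (D.map₂_comp α β) X.obj
  mapId B := fullIso (D.mapId B) (hP (𝟙 B)) (fun _ h => h)
  mapComp f g := fullIso (D.mapComp f g) (hP (f ≫ g)) (fun X h => hP g _ (hP f X h))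
  map₂_whisker_left f _ _ η := full_ext fun X => app_congr (D.map₂_whisker_left f η) X.obj
  map₂_whisker_right η h := full_ext fun X => app_congr (D.map₂_whisker_right η h) X.obj
  map₂_associator f g h := full_ext fun X => app_congr (D.map₂_associator f g h) X.obj
  map₂_left_unitor f := full_ext fun X => app_congr (D.map₂_left_unitor f) X.obj
  map₂_right_unitor f := full_ext fun X => app_congr (D.map₂_right_unitor f) X.obj

/-- The inclusion of a full subprederivator. -/
def subIncl : D.sub hP ⟶ D where
  app B := (P B).ι.toCatHom
  naturality f := Cat.Hom.isoMk (Iso.refl ((P _).ι ⋙ (D.map f).toFunctor))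
  naturality_naturality {A B f g} α := Cat.Hom₂.ext <| NatTrans.ext <| funext fun X =>
    (by simp : (D.map₂ α).toNatTrans.app X.obj ≫ 𝟙 _ = 𝟙 _ ≫ (D.map₂ α).toNatTrans.app X.obj)
  naturality_id A := Cat.Hom₂.ext <| NatTrans.ext <| funext fun X =>
    (by simp : 𝟙 _ ≫ (D.mapId A).hom.toNatTrans.app X.obj =
      (D.mapId A).hom.toNatTrans.app X.obj ≫ 𝟙 _ ≫ 𝟙 _)
  naturality_comp f g := Cat.Hom₂.ext <| NatTrans.ext <| funext fun X =>
    (by simp : 𝟙 _ ≫ (D.mapComp f g).hom.toNatTrans.app X.obj =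
      (D.mapComp f g).hom.toNatTrans.app X.obj ≫ 𝟙 _ ≫ 𝟙 _ ≫ 𝟙 _ ≫ (D.map g).toFunctor.map (𝟙 _)
        ≫ 𝟙 _)

end

section

variable {D E : Prederivator.{w, v, u}} {P : ∀ B : Cat.{w, w}ᵒᵖ, ObjectProperty (D.obj B)}
  {Q : ∀ B : Cat.{w, w}ᵒᵖ, ObjectProperty (E.obj B)} (hP : Restricts D P) (hQ : Restricts E Q)

/-- The morphism `F` sends diagrams with property `P` to diagrams with property `Q`. -/
def MapsTo (P : ∀ B : Cat.{w, w}ᵒᵖ, ObjectProperty (D.obj B))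
    (Q : ∀ B : Cat.{w, w}ᵒᵖ, ObjectProperty (E.obj B)) (F : D ⟶ E) : Prop :=
  ∀ (B : Cat.{w, w}ᵒᵖ) (X : D.obj B), P B X → Q B ((F.app B).toFunctor.obj X)

/-- The morphism between full subprederivators induced by a morphism of prederivators. -/
def subMap (F : D ⟶ E) (hF : MapsTo P Q F) : D.sub hP ⟶ E.sub hQ where
  app B := fullHom _ _ (F.app B) (hF B)
  naturality {A B} f := fullIso (F.naturality f) (fun X h => hF B _ (hP f X h))
    (fun X h => hQ f _ (hF A X h))
  naturality_naturality α := full_ext fun X => app_congr (F.naturality_naturality α) X.obj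
  naturality_id A := full_ext fun X => app_congr (F.naturality_id A) X.obj
  naturality_comp f g := full_ext fun X => app_congr (F.naturality_comp f g) X.obj

/-- The transformation induced on full subprederivators. -/
def subMap₂ {F G : D ⟶ E} (Γ : F ⟶ G) (hF : MapsTo P Q F) (hG : MapsTo P Q G) :
    subMap hP hQ F hF ⟶ subMap hP hQ G hG where
  as :=
    { app B := fullHom₂ (Γ.as.app B) (hF B) (hG B)
      naturality f := full_ext fun X => app_congr (Γ.as.naturality f) X.obj }

end

end Prederivator

namespace Prederivator

section

variable {K : Type u₁} [Bicategory.{w₁, v₁} K] (Φ : K ⥤ᵖ Prederivator.{w, v, u})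
  {P : ∀ (k : K) (B : Cat.{w, w}ᵒᵖ), ObjectProperty ((Φ.obj k).obj B)}
  (hP : ∀ k, Restricts (Φ.obj k) (P k))
  (hM : ∀ ⦃k l : K⦄ (F : k ⟶ l), MapsTo (P k) (P l) (Φ.map F))

theorem mod_ext {D E : Prederivator.{w, v, u}} {F G : D ⟶ E} {Γ Θ : F ⟶ G}
    (h : ∀ B, Γ.as.app B = Θ.as.app B) : Γ = Θ := by
  ext B : 1
  exact h B

theorem mod_app_congr {D E : Prederivator.{w, v, u}} {F G : D ⟶ E} {Γ Θ : F ⟶ G} (h : Γ = Θ)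
    (B : Cat.{w, w}ᵒᵖ) (X : D.obj B) :
    (Γ.as.app B).toNatTrans.app X = (Θ.as.app B).toNatTrans.app X := by rw [h]

/-- The isomorphism induced on full subprederivators. -/
def subIso {D E : Prederivator.{w, v, u}} {P : ∀ B : Cat.{w, w}ᵒᵖ, ObjectProperty (D.obj B)}
    {Q : ∀ B : Cat.{w, w}ᵒᵖ, ObjectProperty (E.obj B)} (hP : Restricts D P) (hQ : Restricts E Q)
    {F G : D ⟶ E} (Γ : F ≅ G) (hF : MapsTo P Q F) (hG : MapsTo P Q G) :
    subMap hP hQ F hF ≅ subMap hP hQ G hG where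
  hom := subMap₂ hP hQ Γ.hom hF hG
  inv := subMap₂ hP hQ Γ.inv hG hF
  hom_inv_id := mod_ext fun B => full_ext fun X => mod_app_congr Γ.hom_inv_id B X.obj
  inv_hom_id := mod_ext fun B => full_ext fun X => mod_app_congr Γ.inv_hom_id B X.obj

/-- Full subprederivators as a pseudofunctor. -/
def subFunctor : K ⥤ᵖ Prederivator.{w, v, u} where
  obj k := (Φ.obj k).sub (hP k)
  map {k l} F := subMap (hP k) (hP l) (Φ.map F) (hM F)
  map₂ {k l F G} Γ := subMap₂ (hP k) (hP l) (Φ.map₂ Γ) (hM F) (hM G)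
  map₂_id F := mod_ext fun B => full_ext fun X => mod_app_congr (Φ.map₂_id F) B X.obj
  map₂_comp Γ Θ := mod_ext fun B => full_ext fun X => mod_app_congr (Φ.map₂_comp Γ Θ) B X.obj
  mapId k := subIso (hP k) (hP k) (Φ.mapId k) (hM (𝟙 k)) (fun _ _ h => h)
  mapComp {k _ m} F G := subIso (hP k) (hP m) (Φ.mapComp F G) (hM (F ≫ G))
    (fun B X h => hM G B _ (hM F B X h))
  map₂_whisker_left F _ _ Γ := mod_ext fun B => full_ext fun X =>
    mod_app_congr (Φ.map₂_whisker_left F Γ) B X.obj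
  map₂_whisker_right Γ F := mod_ext fun B => full_ext fun X =>
    mod_app_congr (Φ.map₂_whisker_right Γ F) B X.obj
  map₂_associator F G H := mod_ext fun B => full_ext fun X =>
    mod_app_congr (Φ.map₂_associator F G H) B X.obj
  map₂_left_unitor F := mod_ext fun B => full_ext fun X =>
    mod_app_congr (Φ.map₂_left_unitor F) B X.obj
  map₂_right_unitor F := mod_ext fun B => full_ext fun X =>
    mod_app_congr (Φ.map₂_right_unitor F) B X.obj

/-- The inclusion of full subprederivators is natural. -/
def subIncl₂ {k l : K} (F : k ⟶ l) :
    subMap (hP k) (hP l) (Φ.map F) (hM F) ≫ subIncl (Φ.obj l) (hP l) ≅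
      subIncl (Φ.obj k) (hP k) ≫ Φ.map F :=
  Pseudofunctor.StrongTrans.isoMk
    (fun B => Cat.Hom.isoMk (Iso.refl ((P k B).ι ⋙ ((Φ.map F).app B).toFunctor)))
    (fun {_ B} f => Cat.Hom₂.ext <| NatTrans.ext <| funext fun X =>
      (by simp : 𝟙 _ ≫ 𝟙 _ ≫ ((Φ.map F).app B).toFunctor.map (𝟙 _) ≫ 𝟙 _ ≫
          ((Φ.map F).naturality f).hom.toNatTrans.app X.obj ≫ 𝟙 _ =
        (𝟙 _ ≫ ((Φ.map F).naturality f).hom.toNatTrans.app X.obj ≫ 𝟙 _ ≫ 𝟙 _ ≫ 𝟙 _) ≫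
          ((Φ.obj l).map f).toFunctor.map (𝟙 _)))

theorem id_comp_aux {C : Type u₁} {C' : Type u₂} [Category.{v₁} C] [Category.{v₂} C']
    (G : C ⥤ C') {X : C'} {Y : C} (f : X ⟶ G.obj Y) :
    𝟙 _ ≫ f = f ≫ 𝟙 _ ≫ 𝟙 _ ≫ 𝟙 _ ≫ G.map (𝟙 Y) ≫ 𝟙 _ := by simp

/-- The inclusion of full subprederivators, as a pseudonatural transformation. -/
def subFunctorIncl : subFunctor Φ hP hM ⟶ Φ where
  app k := subIncl (Φ.obj k) (hP k)
  naturality F := subIncl₂ Φ hP hM F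
  naturality_naturality Γ := mod_ext fun B => Cat.Hom₂.ext <| NatTrans.ext <| funext fun X =>
    (by simp : ((Φ.map₂ Γ).as.app B).toNatTrans.app X.obj ≫ 𝟙 _ =
      𝟙 _ ≫ ((Φ.map₂ Γ).as.app B).toNatTrans.app X.obj)
  naturality_id k := mod_ext fun B => Cat.Hom₂.ext <| NatTrans.ext <| funext fun X =>
    (by simp : 𝟙 _ ≫ ((Φ.mapId k).hom.as.app B).toNatTrans.app X.obj =
      ((Φ.mapId k).hom.as.app B).toNatTrans.app X.obj ≫ 𝟙 _ ≫ 𝟙 _)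
  naturality_comp F G := mod_ext fun B => Cat.Hom₂.ext <| NatTrans.ext <| funext fun X =>
    id_comp_aux ((Φ.map G).app B).toFunctor (((Φ.mapComp F G).hom.as.app B).toNatTrans.app X.obj)

end

end Prederivator

/-! ### The `2`-category of stable derivators -/

set_option linter.checkUnivs false in
/-- A stable derivator. -/
structure StableDerivator where
  pre : Prederivator.{w, v, u}
  isStable : pre.IsStable

namespace StableDerivator

open Prederivator

/-- An exact morphism of stable derivators. -/
structure ExactHom (D E : StableDerivator.{w, v, u}) where
  hom : D.pre ⟶ E.pre
  exact : IsExact hom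

instance : CategoryStruct StableDerivator.{w, v, u} where
  Hom D E := ExactHom D E
  id D := ⟨𝟙 D.pre, isExact_id D.pre⟩
  comp {_ E _} F G := ⟨F.hom ≫ G.hom, isExact_comp E.isStable.isDerivator F.exact G.exact⟩

instance (D E : StableDerivator.{w, v, u}) : Category (D ⟶ E) where
  Hom F G := F.hom ⟶ G.hom
  id F := 𝟙 F.hom
  comp Γ Θ := Γ ≫ Θ

/-- The morphism of prederivators underlying an exact morphism. -/
abbrev hom {D E : StableDerivator.{w, v, u}} (F : D ⟶ E) : D.pre ⟶ E.pre := ExactHom.hom F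

instance : Bicategory StableDerivator.{w, v, u} where
  whiskerLeft F _ _ Γ := (hom F) ◁ Γ
  whiskerRight Γ F := Γ ▷ (hom F)
  associator F G H :=
    { hom := (α_ (hom F) (hom G) (hom H)).hom
      inv := (α_ (hom F) (hom G) (hom H)).inv
      hom_inv_id := (α_ (hom F) (hom G) (hom H)).hom_inv_id
      inv_hom_id := (α_ (hom F) (hom G) (hom H)).inv_hom_id }
  leftUnitor F :=
    { hom := (λ_ (hom F)).hom
      inv := (λ_ (hom F)).inv
      hom_inv_id := (λ_ (hom F)).hom_inv_id
      inv_hom_id := (λ_ (hom F)).inv_hom_id }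
  rightUnitor F :=
    { hom := (ρ_ (hom F)).hom
      inv := (ρ_ (hom F)).inv
      hom_inv_id := (ρ_ (hom F)).hom_inv_id
      inv_hom_id := (ρ_ (hom F)).inv_hom_id }
  whiskerLeft_id F G := Bicategory.whiskerLeft_id (hom F) (hom G)
  whiskerLeft_comp F _ _ _ Γ Θ := Bicategory.whiskerLeft_comp (hom F) Γ Θ
  id_whiskerLeft {_ _ F G} Γ := Bicategory.id_whiskerLeft (f := (hom F)) (g := (hom G)) Γ
  comp_whiskerLeft {_ _ _ _} F G {H H'} Γ := Bicategory.comp_whiskerLeft (hom F) (hom G) (h := (hom H))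
    (h' := (hom H')) Γ
  id_whiskerRight F G := Bicategory.id_whiskerRight (hom F) (hom G)
  comp_whiskerRight {_ _ _} {F G H} Γ Θ I := Bicategory.comp_whiskerRight (f := (hom F))
    (g := (hom G)) (h := (hom H)) Γ Θ (hom I)
  whiskerRight_id {_ _} {F G} Γ := Bicategory.whiskerRight_id (f := (hom F)) (g := (hom G)) Γ
  whiskerRight_comp {_ _ _ _} {F F'} Γ G H := Bicategory.whiskerRight_comp (f := (hom F))
    (f' := (hom F')) Γ (hom G) (hom H)
  whisker_assoc {_ _ _ _} F {G G'} Γ H := Bicategory.whisker_assoc (hom F) (g := (hom G))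
    (g' := (hom G')) Γ (hom H)
  whisker_exchange {_ _ _} {F G H I} Γ Θ := Bicategory.whisker_exchange (f := (hom F))
    (g := (hom G)) (h := (hom H)) (i := (hom I)) Γ Θ
  pentagon F G H I := Bicategory.pentagon (hom F) (hom G) (hom H) (hom I)
  triangle F G := Bicategory.triangle (hom F) (hom G)

/-- The forgetful functor from stable derivators and exact morphisms to prederivators. -/
def forget : StableDerivator.{w, v, u} ⥤ᵖ Prederivator.{w, v, u} where
  obj D := D.pre
  map F := hom F
  map₂ Γ := Γ
  map₂_id _ := rfl
  map₂_comp _ _ := rfl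
  mapId D := Iso.refl (𝟙 D.pre)
  mapComp {_ _ _} F G := Iso.refl ((hom F) ≫ (hom G))
  map₂_whisker_left {_ _ _} F {G H} Γ := by
    let Γ' : hom G ⟶ hom H := Γ
    change hom F ◁ Γ' = 𝟙 (hom F ≫ hom G) ≫ hom F ◁ Γ' ≫ 𝟙 (hom F ≫ hom H)
    rw [Category.id_comp, Category.comp_id]
  map₂_whisker_right {_ _ _ F G} Γ H := by
    let Γ' : hom F ⟶ hom G := Γ
    change Γ' ▷ hom H = 𝟙 (hom F ≫ hom H) ≫ Γ' ▷ hom H ≫ 𝟙 (hom G ≫ hom H)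
    rw [Category.id_comp, Category.comp_id]
  map₂_associator F G H := by
    change (α_ (hom F) (hom G) (hom H)).hom =
      𝟙 _ ≫ 𝟙 _ ▷ (hom H) ≫ (α_ (hom F) (hom G) (hom H)).hom ≫ (hom F) ◁ 𝟙 _ ≫ 𝟙 _
    simp
  map₂_left_unitor F := by
    change (λ_ (hom F)).hom = 𝟙 _ ≫ 𝟙 _ ▷ (hom F) ≫ (λ_ (hom F)).hom
    simp
  map₂_right_unitor F := by
    change (ρ_ (hom F)).hom = 𝟙 _ ≫ (hom F) ◁ 𝟙 _ ≫ (ρ_ (hom F)).hom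
    simp

end StableDerivator

/-! ### Mesh categories -/

/-- The vertices `(k, l)`, `k ∈ ℤ`, `0 ≤ l ≤ n + 1`, of the repetitive quiver of the linearly
oriented quiver `0 → 1 → ⋯ → n + 1`. -/
@[ext]
structure Mesh (n : ℕ) where
  k : ℤ
  l : ℕ
  l_le : l ≤ n + 1

namespace Mesh

variable {n : ℕ}

/-- The mesh category `M_n` is a poset; by `le_iff` its order is the one generated by the
arrows of the repetitive quiver. -/
instance : PartialOrder (Mesh n) where
  le x y := x.k ≤ y.k ∧ x.k + x.l ≤ y.k + y.l
  le_refl x := ⟨le_rfl, le_rfl⟩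
  le_trans x y z h h' := ⟨h.1.trans h'.1, h.2.trans h'.2⟩
  le_antisymm x y h h' := by
    have h1 := le_antisymm h.1 h'.1
    have h2 := le_antisymm h.2 h'.2
    ext
    · exact h1
    · omega

theorem le_def {x y : Mesh n} : x ≤ y ↔ x.k ≤ y.k ∧ x.k + x.l ≤ y.k + y.l := Iff.rfl

/-- The arrows `(k, l) ⟶ (k, l + 1)` and `(k, l + 1) ⟶ (k + 1, l)` of the repetitive quiver. -/
inductive Arrow : Mesh n → Mesh n → Prop
  | up (k : ℤ) (l : ℕ) (h : l + 1 ≤ n + 1) : Arrow ⟨k, l, by omega⟩ ⟨k, l + 1, h⟩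
  | down (k : ℤ) (l : ℕ) (h : l + 1 ≤ n + 1) : Arrow ⟨k, l + 1, h⟩ ⟨k + 1, l, by omega⟩

theorem le_iff {x y : Mesh n} : x ≤ y ↔ Relation.ReflTransGen Arrow x y := by
  constructor
  · intro h
    obtain ⟨N, hN⟩ : ∃ N : ℕ, (N : ℤ) = (y.k - x.k) + ((y.k + y.l) - (x.k + x.l)) :=
      ⟨((y.k - x.k) + ((y.k + y.l) - (x.k + x.l))).toNat, Int.toNat_of_nonneg (by
        have := h.1; have := h.2; omega)⟩
    induction N generalizing x with
    | zero =>
      have h1 := h.1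
      have h2 := h.2
      have : x = y := by
        ext
        · omega
        · omega
      rw [this]
    | succ N ih =>
      obtain ⟨k, l, hl⟩ := x
      obtain ⟨k', l', hl'⟩ := y
      simp only [le_def] at h hN ih
      by_cases hk : k < k' ∧ 0 < l
      · obtain ⟨l, rfl⟩ : ∃ m, l = m + 1 := ⟨l - 1, by omega⟩
        refine Relation.ReflTransGen.head (Arrow.down k l hl) (ih ?_ ?_)
        · dsimp only; omega
        · dsimp only; push_cast at hN ⊢; omega
      · have hl1 : l + 1 ≤ n + 1 := by omega
        refine Relation.ReflTransGen.head (Arrow.up k l hl1) (ih ?_ ?_)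
        · dsimp only; push_cast at hN ⊢; omega
        · dsimp only; push_cast at hN ⊢; omega
  · intro h
    induction h with
    | refl => exact le_rfl
    | tail _ h ih =>
      refine ih.trans ?_
      cases h <;> refine le_def.2 ?_ <;> dsimp only <;> push_cast <;> omega

/-- The vertices `(k, 0)` of the lower boundary stripe. -/
def lower (k : ℤ) : Mesh n := ⟨k, 0, by omega⟩

/-- The vertices `(k, n + 1)` of the upper boundary stripe. -/
def upper (k : ℤ) : Mesh n := ⟨k, n + 1, le_rfl⟩

/-- For `0 ≤ l < n`, the square in `M_n` with vertices `(k, l + 1)`, `(k, l + 2)`, `(k + 1, l)`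
and `(k + 1, l + 1)`. -/
def square (k : ℤ) (l : Fin n) (s : Prederivator.Sq) : Mesh n :=
  ⟨k + s.1.val, l.val + 1 + s.2.val - s.1.val, by omega⟩

theorem square_zero_zero (k : ℤ) (l : Fin n) :
    square k l (0, 0) = ⟨k, l.val + 1, by omega⟩ := by
  ext <;> simp [square]

theorem square_zero_one (k : ℤ) (l : Fin n) :
    square k l (0, 1) = ⟨k, l.val + 2, by omega⟩ := by
  ext <;> simp [square]

theorem square_one_zero (k : ℤ) (l : Fin n) :
    square k l (1, 0) = ⟨k + 1, l.val, by omega⟩ := by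
  ext <;> simp [square]

theorem square_one_one (k : ℤ) (l : Fin n) :
    square k l (1, 1) = ⟨k + 1, l.val + 1, by omega⟩ := by
  ext <;> simp [square]

theorem monotone_square (k : ℤ) (l : Fin n) : Monotone (square k l) := by
  intro s t h
  have h1 : s.1.val ≤ t.1.val := h.1
  have h2 : s.2.val ≤ t.2.val := h.2
  refine le_def.2 ?_
  simp only [square]
  omega

/-- The inclusion of `A_n = (1 < ⋯ < n)`, which sends `l` to `(0, l)`. -/
def ofLinear (l : Fin n) : Mesh n := ⟨0, l.val + 1, by omega⟩

theorem monotone_ofLinear : Monotone (ofLinear (n := n)) := by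
  intro l l' h
  have h' : l.val ≤ l'.val := h
  refine le_def.2 ?_
  simp only [ofLinear]
  omega

end Mesh

namespace Prederivator

/-- The mesh category `M_n`. -/
abbrev mesh (n : ℕ) : Cat.{w, w} := shape.{w} (Mesh n)

/-- The poset `A_n = (1 < ⋯ < n)`. -/
abbrev linear (n : ℕ) : Cat.{w, w} := shape.{w} (Fin n)

/-- The functor `i : A_n ⟶ M_n`. -/
def linearToMesh (n : ℕ) : linear.{w} n ⟶ mesh.{w} n :=
  shapeMap Mesh.ofLinear Mesh.monotone_ofLinear

/-- A mesh square, together with an object `b` of `B`. -/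
def meshSquare {n : ℕ} {B : Cat.{w, w}} (k : ℤ) (l : Fin n) (b : B) :
    shape.{w} Sq ⟶ prod (mesh.{w} n) B :=
  ((shapeMap (Mesh.square k l) (Mesh.monotone_square k l)).toFunctor.prod'
    ((Functor.const _).obj b)).toCatHom

variable (D : Prederivator.{w, v, u}) (n : ℕ)

/-- The coherent diagrams in `D^{M_n}(B) = D(M_n × B)` which, for every object `b` of `B`,
vanish on the boundary stripes and make all squares bicartesian. -/
structure IsMeshExact (B : Cat.{w, w}ᵒᵖ) (X : (exp (mesh n) D).obj B) : Prop where
  lower : ∀ (b : B.unop) (k : ℤ), Limits.IsZero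
    ((D.restr (point (A := prod (mesh n) B.unop) (⟨Mesh.lower k⟩, b))).obj X)
  upper : ∀ (b : B.unop) (k : ℤ), Limits.IsZero
    ((D.restr (point (A := prod (mesh n) B.unop) (⟨Mesh.upper k⟩, b))).obj X)
  square : ∀ (b : B.unop) (k : ℤ) (l : Fin n),
    D.IsBicartesian ((D.restr (meshSquare k l b)).obj X)

variable {D n}

theorem IsBicartesian.of_iso {X Y : D.dia (shape Sq)} (h : D.IsBicartesian X) (e : X ≅ Y) :
    D.IsBicartesian Y := by
  obtain ⟨⟨L, adj, hL⟩, ⟨R, adj', hR⟩⟩ := h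
  exact ⟨⟨L, adj, hL.ofIso e⟩, ⟨R, adj', hR.ofIso e⟩⟩

theorem restr_restr {A B C : Cat.{w, w}} (p : A ⟶ B) (q : B ⟶ C) (r : A ⟶ C)
    (e : p.toFunctor ⋙ q.toFunctor ≅ r.toFunctor) (X : D.dia C) :
    Nonempty ((D.restr p).obj ((D.restr q).obj X) ≅ (D.restr r).obj X) :=
  ⟨(Cat.Hom.toNatIso ((D.mapComp q.op p.op).symm ≪≫
    D.map₂Iso (Cat.Hom.isoMk e : p ≫ q ≅ r).op2)).app X⟩

theorem mesh_hom_eq {x y : Shape.{w} (Mesh n)} (f g : x ⟶ y) : f = g := Subsingleton.elim _ _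

theorem restricts_isMeshExact : Restricts (exp (mesh n) D) (D.IsMeshExact n) := by
  intro B B' f X h
  have key (m : Shape (Mesh n)) (b : B'.unop) := restr_restr (D := D)
    (point (A := prod (mesh n) B'.unop) (m, b)) (prodMap (𝟙 (mesh n)) f.unop)
    (point (A := prod (mesh n) B.unop) (m, f.unop.toFunctor.obj b))
    (NatIso.ofComponents (fun _ => Iso.refl _) fun _ => Prod.ext (mesh_hom_eq _ _)
      (by simp : f.unop.toFunctor.map (𝟙 b) ≫ 𝟙 _ = 𝟙 _ ≫ 𝟙 _)) X
  refine ⟨fun b k => ?_, fun b k => ?_, fun b k l => ?_⟩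
  · exact (h.lower (f.unop.toFunctor.obj b) k).of_iso (key _ b).some
  · exact (h.upper (f.unop.toFunctor.obj b) k).of_iso (key _ b).some
  · have := restr_restr (D := D) (meshSquare k l b) (prodMap (𝟙 (mesh n)) f.unop)
      (meshSquare k l (f.unop.toFunctor.obj b)) (NatIso.ofComponents (fun _ => Iso.refl _) fun _ => Prod.ext (mesh_hom_eq _ _)
      (by simp : f.unop.toFunctor.map (𝟙 b) ≫ 𝟙 _ = 𝟙 _ ≫ 𝟙 _)) X
    exact (h.square (f.unop.toFunctor.obj b) k l).of_iso this.some.symm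

variable (D n)

/-- The full subprederivator `D^{M_n, ex}` of `D^{M_n}`. -/
def meshEx : Prederivator.{w, v, u} := sub (exp (mesh n) D) (restricts_isMeshExact (n := n))

/-- The inclusion of `D^{M_n, ex}` in `D^{M_n}`. -/
def meshIncl : meshEx D n ⟶ exp (mesh n) D := subIncl (exp (mesh n) D) restricts_isMeshExact

/-- Restriction `u^* : D^{A'} ⟶ D^A` along `u : A ⟶ A'`. -/
def expRestr {A A' : Cat.{w, w}} (u : A ⟶ A') : exp A' D ⟶ exp A D :=
  Precomp.post (prodRestr u) D

/-- The restriction `i^* : D^{M_n, ex} ⟶ D^{A_n}`. -/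
def meshRestr : meshEx D n ⟶ exp (linear n) D := meshIncl D n ≫ expRestr D (linearToMesh n)

end Prederivator

namespace StableDerivator

open Prederivator

/-- The assignment `D ↦ D^A` for stable derivators and exact morphisms. -/
def expFunctor (A : Cat.{w, w}) : StableDerivator.{w, v, u} ⥤ᵖ Prederivator.{w, v, u} :=
  forget.comp (Precomp.functor (prodLeft A))

variable (n : ℕ)

/-- For every exact morphism `F : D ⟶ E` the induced morphism `D^{M_n} ⟶ E^{M_n}` restricts to
a morphism `D^{M_n, ex} ⟶ E^{M_n, ex}`. -/
def PreservesMeshExact : Prop :=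
  ∀ ⦃D E : StableDerivator.{w, v, u}⦄ (F : D ⟶ E),
    MapsTo (D := exp (mesh n) D.pre) (E := exp (mesh n) E.pre)
      (D.pre.IsMeshExact n) (E.pre.IsMeshExact n) ((expFunctor (mesh n)).map F)

variable {n} (h : PreservesMeshExact.{w, v, u} n)

/-- The assignment `D ↦ D^{M_n, ex}` for stable derivators and exact morphisms. -/
def meshExFunctor : StableDerivator.{w, v, u} ⥤ᵖ Prederivator.{w, v, u} :=
  subFunctor (expFunctor (mesh n)) (P := fun D => D.pre.IsMeshExact n)
    (fun _ => restricts_isMeshExact) h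

/-- The restrictions `i^* : D^{M_n, ex} ⟶ D^{A_n}`, pseudonaturally in exact morphisms. -/
def meshRestrTrans : meshExFunctor h ⟶ expFunctor (linear n) :=
  subFunctorIncl (expFunctor (mesh n)) _ h ≫
    Precomp.transf forget (Precomp.postTransf (prodRestr (linearToMesh n)))

theorem meshExFunctor_obj (D : StableDerivator.{w, v, u}) :
    (meshExFunctor h).obj D = meshEx D.pre n := rfl

theorem expFunctor_obj (A : Cat.{w, w}) (D : StableDerivator.{w, v, u}) :
    (expFunctor A).obj D = exp A D.pre := rfl

theorem meshRestrTrans_app (D : StableDerivator.{w, v, u}) :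
    (meshRestrTrans h).app D = meshRestr D.pre n := rfl

end StableDerivator

end

/-!
The idea is to factor `i : A_n ⟶ M_n` into inclusions along each of which an exact diagram is a
Kan extension of its restriction, for a reason which is visible at every single vertex.

Write `A_n ⊆ fringe ⊆ frame ⊆ upperHalf ⊆ M_n`, where the fringe adds to `A_n` the boundary vertices
to its right, the frame adds the other boundary vertices, and the upper half adds the vertices
`(k, l)` with `0 ≤ k`. A right Kan extension is terminal at a vertex which has no morphisms to
the domain, and a left Kan extension is initial at a vertex which receives none; so the first
two steps (right, then left Kan extension) are extensions by zero. A left Kan extension from the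
frame makes the mesh squares with `0 ≤ k` cocartesian, and a right Kan extension from the upper half
makes those with `k < 0` cartesian, since a vertex below (above) a mesh square has a reflection
(coreflection) in it. Conversely, comparing an exact diagram with the Kan extension of its
restriction and working outwards square by square, one sees that the comparison is invertible at
all vertices. As fully faithful Kan extensions restrict bijectively on morphisms, restriction to
`A_n` is fully faithful on exact diagrams (`IsExactMesh.bijective_restr_map`) and essentially
surjective (`exists_isExactMesh`). Parameters in `B` are absorbed by replacing the stable derivator
`D` with `D^B`, using that a square in `D^B` is cocartesian if it is so at every object of `B`
(`IsDerivator.isCocartesian_exp_iff`).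

Kan extensions are handled through universal arrows: no adjoints are chosen, and invertibility of a
mate becomes the statement that a transformation preserves universal arrows
(`Functor.isIso_mateEquiv_symm_iff`). All base change is obtained from one criterion: a
square of categories with initial (terminal) factorizations is homotopy exact
(`IsDerivator.preservesUniversal_square` and its dual). Its proof reduces to (Der4), because
the induced functor of slice categories has an adjoint.

The remaining claims are consequences. A morphism whose components are equivalences is itself
an equivalence (`StrongTrans.exists_equivalence`), and a prederivator which is levelwise
equivalent to a derivator is a derivator (`IsDerivator.of_isEquivalence`); this turns the levelwise
statement into both equivalences of the theorem. Exact diagrams are closed under Kan extensions in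
the parameter, again by base change, so the inclusion of exact diagrams is exact
(`IsStable.isMeshExact_of_isUniversal`). Finally an exact morphism preserves cocartesian
squares, since a square is cocartesian precisely if its final vertex is a colimit of its span
(`IsDerivator.isCocartesian_iff_isUniversal`), and these are bicartesian by stability.
-/

noncomputable section

/-! ### Levelwise equivalences of pseudofunctors -/

namespace CategoryTheory.Bicategory

variable {B : Type u₁} [Bicategory.{w₁, v₁} B]

section

variable {c d e f : B} {g g' : c ⟶ e} {h h' : d ⟶ f} {l₁ : c ⟶ d} {r₁ : d ⟶ c} {l₂ : e ⟶ f}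
  {r₂ : f ⟶ e} (adj₁ : Bicategory.Adjunction l₁ r₁) (adj₂ : Bicategory.Adjunction l₂ r₂)

theorem mateEquiv_whiskerRight_comp (φ : g' ⟶ g) (α : g ≫ l₂ ⟶ l₁ ≫ h) :
    Bicategory.mateEquiv adj₁ adj₂ (φ ▷ l₂ ≫ α) = r₁ ◁ φ ≫ Bicategory.mateEquiv adj₁ adj₂ α := by
  rw [mateEquiv_apply', mateEquiv_apply']
  calc
    _ = 𝟙 _ ⊗≫ r₁ ◁ (g' ◁ adj₂.unit ≫ φ ▷ (l₂ ≫ r₂)) ⊗≫ r₁ ◁ α ▷ r₂ ⊗≫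
        adj₁.counit ▷ h ▷ r₂ ⊗≫ 𝟙 _ := by bicategory
    _ = _ := by rw [whisker_exchange]; bicategory

theorem mateEquiv_comp_whiskerLeft (α : g ≫ l₂ ⟶ l₁ ≫ h) (ψ : h ⟶ h') :
    Bicategory.mateEquiv adj₁ adj₂ (α ≫ l₁ ◁ ψ) = Bicategory.mateEquiv adj₁ adj₂ α ≫ ψ ▷ r₂ := by
  rw [mateEquiv_apply', mateEquiv_apply']
  calc
    _ = 𝟙 _ ⊗≫ r₁ ◁ g ◁ adj₂.unit ⊗≫ r₁ ◁ α ▷ r₂ ⊗≫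
        ((r₁ ≫ l₁) ◁ ψ ≫ adj₁.counit ▷ h') ▷ r₂ ⊗≫ 𝟙 _ := by bicategory
    _ = _ := by rw [whisker_exchange]; bicategory

theorem isIso_mateEquiv (α : g ≫ l₂ ⟶ l₁ ≫ h) [IsIso α] [IsIso adj₁.counit] [IsIso adj₂.unit] :
    IsIso (Bicategory.mateEquiv adj₁ adj₂ α) := by
  rw [Bicategory.mateEquiv_apply, Adjunction.homEquiv₂_apply, Adjunction.homEquiv₁_apply]
  infer_instance

/-- The unit satisfies the naturality condition of a modification, with mates as naturality cells of
the right adjoints. -/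
theorem unit_comp_mateEquiv (α : g ≫ l₂ ⟶ l₁ ≫ h) :
    (ρ_ g).inv ≫ g ◁ adj₂.unit ≫ (α_ _ _ _).inv ≫ α ▷ r₂ ≫ (α_ _ _ _).hom =
      (λ_ g).inv ≫ adj₁.unit ▷ g ≫ (α_ _ _ _).hom ≫ l₁ ◁ Bicategory.mateEquiv adj₁ adj₂ α := by
  have h := (mateEquiv_eq_iff adj₁ adj₂ α _).1 rfl
  rw [Adjunction.homEquiv₂_apply, Adjunction.homEquiv₁_symm_apply] at h
  simpa using h.symm

/-- The counit satisfies the naturality condition of a modification, with mates as naturality cells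
of the right adjoints. -/
theorem mateEquiv_comp_counit (α : g ≫ l₂ ⟶ l₁ ≫ h) :
    Bicategory.mateEquiv adj₁ adj₂ α ▷ l₂ ≫ (α_ _ _ _).hom ≫ h ◁ adj₂.counit ≫ (ρ_ h).hom =
      (α_ _ _ _).hom ≫ r₁ ◁ α ≫ (α_ _ _ _).inv ≫ adj₁.counit ▷ h ≫ (λ_ h).hom := by
  rw [mateEquiv_apply']
  calc
    _ = 𝟙 _ ⊗≫ r₁ ◁ g ◁ adj₂.unit ▷ l₂ ⊗≫ r₁ ◁ α ▷ (r₂ ≫ l₂) ⊗≫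
        (adj₁.counit ▷ (h ≫ r₂ ≫ l₂) ≫ 𝟙 d ◁ (h ◁ adj₂.counit)) ⊗≫ 𝟙 _ := by bicategory
    _ = 𝟙 _ ⊗≫ r₁ ◁ g ◁ adj₂.unit ▷ l₂ ⊗≫ (r₁ ◁ (α ▷ (r₂ ≫ l₂) ≫ (l₁ ≫ h) ◁ adj₂.counit)) ⊗≫
        adj₁.counit ▷ h ⊗≫ 𝟙 _ := by rw [← whisker_exchange]; bicategory
    _ = 𝟙 _ ⊗≫ r₁ ◁ g ◁ leftZigzag adj₂.unit adj₂.counit ⊗≫ r₁ ◁ α ⊗≫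
        adj₁.counit ▷ h ⊗≫ 𝟙 _ := by rw [← whisker_exchange]; bicategory
    _ = _ := by rw [adj₂.left_triangle]; bicategory

end

end CategoryTheory.Bicategory

namespace CategoryTheory.Pseudofunctor.StrongTrans

variable {B : Type u₁} [Bicategory.{w₁, v₁} B] {C : Type u₂} [Bicategory.{w₂, v₂} C]
  {F G : B ⥤ᵖ C} (η : F ⟶ G) {g : ∀ a, G.obj a ⟶ F.obj a}
  (adj : ∀ a, Bicategory.Adjunction (η.app a) (g a))
  [∀ a, IsIso (adj a).unit] [∀ a, IsIso (adj a).counit]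

/-- The mate of a naturality isomorphism of a strong transformation whose components are adjoint
equivalences. -/
def mateIso {a b : B} (f : a ⟶ b) : G.map f ≫ g b ≅ g a ≫ F.map f :=
  haveI := isIso_mateEquiv (adj a) (adj b) (η.naturality f).hom
  (asIso (Bicategory.mateEquiv (adj a) (adj b) (η.naturality f).hom)).symm

theorem mateIso_inv {a b : B} (f : a ⟶ b) :
    (mateIso η adj f).inv = Bicategory.mateEquiv (adj a) (adj b) (η.naturality f).hom := rfl

/-- The pseudoinverse of a strong transformation whose components are adjoint equivalences. -/
def pseudoinverse : G ⟶ F where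
  app := g
  naturality f := mateIso η adj f
  naturality_naturality {a b f f'} β := by
    rw [← Iso.inv_comp_eq, ← Category.assoc, ← Iso.eq_comp_inv, mateIso_inv, mateIso_inv,
      ← mateEquiv_whiskerRight_comp, ← mateEquiv_comp_whiskerLeft, η.naturality_naturality]
  naturality_id a := by
    rw [← Iso.eq_inv_comp, mateIso_inv]
    have h := congrArg (Bicategory.mateEquiv (adj a) (adj a)) (η.naturality_id a)
    rw [mateEquiv_comp_whiskerLeft, mateEquiv_whiskerRight_comp,
      mateEquiv_leftUnitor_hom_rightUnitor_inv] at h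
    rw [reassoc_of% h]
    simp
  naturality_comp {a b c} f f' := by
    rw [← Iso.eq_inv_comp, mateIso_inv]
    have h := congrArg (Bicategory.mateEquiv (adj a) (adj c)) (η.naturality_comp f f')
    rw [mateEquiv_comp_whiskerLeft, mateEquiv_whiskerRight_comp] at h
    have h' := Bicategory.mateEquiv_vcomp (adj a) (adj b) (adj c) (η.naturality f).hom
      (η.naturality f').hom
    simp only [leftAdjointSquare.vcomp, rightAdjointSquare.vcomp, ← mateIso_inv] at h'
    rw [h'] at h
    rw [← mateIso_inv] at h ⊢
    rw [reassoc_of% h]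
    simp

/-- A strong transformation whose components are equivalences is an equivalence. -/
theorem exists_equivalence {F G : B ⥤ᵖ C} (η : F ⟶ G)
    (h : ∀ a, ∃ e : Bicategory.Equivalence (F.obj a) (G.obj a), e.hom = η.app a) :
    ∃ e : Bicategory.Equivalence F G, e.hom = η := by
  -- adjoint equivalences are needed so that the naturality cells of the inverse can be mates
  have h (a : B) : ∃ (g : G.obj a ⟶ F.obj a) (adj : Bicategory.Adjunction (η.app a) g),
      IsIso adj.unit ∧ IsIso adj.counit := by
    obtain ⟨e, he⟩ := h a
    rw [← he]
    exact ⟨e.inv, ⟨e.unit.hom, e.counit.hom, e.left_triangle_hom, e.right_triangle_hom⟩,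
      inferInstance, inferInstance⟩
  choose g adj hadj using h
  have (a : B) : IsIso (adj a).unit := (hadj a).1
  have (a : B) : IsIso (adj a).counit := (hadj a).2
  refine ⟨Bicategory.Equivalence.mkOfAdjointifyCounit (f := η) (g := pseudoinverse η adj)
    (isoMk (fun a => @asIso _ _ _ _ (adj a).unit (hadj a).1) fun {a b} f => ?_)
    (isoMk (fun a => @asIso _ _ _ _ (adj a).counit (hadj a).2) fun {a b} f => ?_), rfl⟩
  · have h := unit_comp_mateEquiv (adj a) (adj b) (η.naturality f).hom
    rw [← mateIso_inv] at h
    change F.map f ◁ (adj b).unit ≫ ((α_ _ _ _).inv ≫ (η.naturality f).hom ▷ g b ≫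
      (α_ _ _ _).hom ≫ η.app a ◁ (mateIso η adj f).hom ≫ (α_ _ _ _).inv) =
      ((ρ_ _).hom ≫ (λ_ _).inv) ≫ (adj a).unit ▷ F.map f
    rw [← cancel_epi (ρ_ (F.map f)).inv]
    simp only [Category.assoc]
    rw [reassoc_of% h]
    simp
  · have h := mateEquiv_comp_counit (adj a) (adj b) (η.naturality f).hom
    rw [← mateIso_inv] at h
    change G.map f ◁ (adj b).counit ≫ ((ρ_ _).hom ≫ (λ_ _).inv) =
      ((α_ _ _ _).inv ≫ (mateIso η adj f).hom ▷ η.app b ≫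
      (α_ _ _ _).hom ≫ g a ◁ (η.naturality f).hom ≫ (α_ _ _ _).inv) ≫
        (adj a).counit ▷ G.map f
    rw [← cancel_mono (λ_ (G.map f)).hom, ← cancel_epi (α_ _ _ _).hom,
      ← cancel_epi ((mateIso η adj f).inv ▷ η.app b)]
    simp only [Category.assoc]
    simp only [Iso.inv_hom_id, Category.comp_id]
    rw [h]
    simp

end CategoryTheory.Pseudofunctor.StrongTrans

/-! ### Universal arrows and mates -/

namespace CategoryTheory.Functor

variable {C : Type u₁} {C' : Type u₂} {C'' : Type u₃} [Category.{v₁} C] [Category.{v₂} C']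
  [Category.{v₃} C'']

/-- `η : X ⟶ R.obj U` is a universal arrow from `X` to the functor `R`. If `R` has a left adjoint
this means that `η` exhibits `U` as its value at `X`. -/
def IsUniversal (R : C ⥤ C') {X : C'} {U : C} (η : X ⟶ R.obj U) : Prop :=
  ∀ Z : C, Function.Bijective fun g : U ⟶ Z => η ≫ R.map g

/-- `ξ : L.obj U ⟶ X` is a universal arrow from the functor `L` to `X`. -/
def IsCouniversal (L : C ⥤ C') {X : C'} {U : C} (ξ : L.obj U ⟶ X) : Prop :=
  ∀ Z : C, Function.Bijective fun g : Z ⟶ U => L.map g ≫ ξ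

/-- `R` is fully faithful on morphisms out of `U`. If `R` is a restriction functor this means that
`U` is a left Kan extension of its own restriction. -/
def LeftExtended (R : C ⥤ C') (U : C) : Prop :=
  ∀ Z : C, Function.Bijective fun g : U ⟶ Z => R.map g

/-- `R` is fully faithful on morphisms into `U`. If `R` is a restriction functor this means that
`U` is a right Kan extension of its own restriction. -/
def RightExtended (R : C ⥤ C') (U : C) : Prop :=
  ∀ Z : C, Function.Bijective fun g : Z ⟶ U => R.map g

theorem isUniversal_unit {L : C' ⥤ C} {R : C ⥤ C'} (adj : L ⊣ R) (X : C') :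
    R.IsUniversal (X := X) (U := L.obj X) (adj.unit.app X) := fun Z => by
  have := (adj.homEquiv X Z).bijective
  rwa [show ⇑(adj.homEquiv X Z) = fun g => adj.unit.app X ≫ R.map g from
    funext fun g => adj.homEquiv_unit X Z g] at this

theorem isCouniversal_counit {L : C' ⥤ C} {R : C ⥤ C'} (adj : L ⊣ R) (X : C) :
    L.IsCouniversal (X := X) (U := R.obj X) (adj.counit.app X) := fun Z => by
  have := (adj.homEquiv Z X).symm.bijective
  rwa [show ⇑(adj.homEquiv Z X).symm = fun g => L.map g ≫ adj.counit.app X from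
    funext fun g => adj.homEquiv_counit Z X g] at this

theorem isRightAdjoint_of_isUniversal {R : C ⥤ C'}
    (h : ∀ X, ∃ (U : C) (η : X ⟶ R.obj U), R.IsUniversal η) : R.IsRightAdjoint := by
  choose U η h using h
  exact ⟨_, ⟨Adjunction.adjunctionOfEquivLeft
    (fun X Y => Equiv.ofBijective _ (h X Y)) (fun X Y Y' g h => by simp)⟩⟩

theorem isLeftAdjoint_of_isCouniversal {L : C ⥤ C'}
    (h : ∀ X, ∃ (U : C) (ξ : L.obj U ⟶ X), L.IsCouniversal ξ) : L.IsLeftAdjoint := by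
  choose U ξ h using h
  exact ⟨_, ⟨Adjunction.adjunctionOfEquivRight
    (fun X Y => (Equiv.ofBijective _ (h Y X)).symm) (fun X' X Y f g => by
      apply (Equiv.ofBijective _ (h Y X')).injective
      rw [Equiv.apply_symm_apply]
      change _ = L.map (f ≫ _) ≫ ξ Y
      rw [L.map_comp, Category.assoc]
      congr 1
      exact ((Equiv.ofBijective _ (h Y X)).apply_symm_apply g).symm)⟩⟩

variable {R : C ⥤ C'}

theorem exists_isUniversal [R.IsRightAdjoint] (X : C') :
    ∃ (U : C) (η : X ⟶ R.obj U), R.IsUniversal η :=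
  ⟨_, _, isUniversal_unit (Adjunction.ofIsRightAdjoint R) X⟩

theorem exists_isCouniversal [R.IsLeftAdjoint] (X : C') :
    ∃ (U : C) (ξ : R.obj U ⟶ X), R.IsCouniversal ξ :=
  ⟨_, _, isCouniversal_counit (Adjunction.ofIsLeftAdjoint R) X⟩

/-- The comparison of a universal arrow with a second arrow is invertible if and only if the second
arrow is universal. -/
theorem IsUniversal.isIso_iff {X : C'} {U V : C} {η : X ⟶ R.obj U} (h : R.IsUniversal η)
    {θ : X ⟶ R.obj V} (g : U ⟶ V) (hg : η ≫ R.map g = θ) : IsIso g ↔ R.IsUniversal θ := by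
  constructor
  · intro _ Z
    convert (h Z).comp ((asIso g).homFromEquiv.symm.bijective) using 2 with k
    simp [← hg, Iso.homFromEquiv]
  · intro h'
    obtain ⟨k, hk⟩ := (h' U).2 η
    dsimp at hk
    refine ⟨k, (h U).1 ?_, (h' V).1 ?_⟩
    · simp [reassoc_of% hg, hk]
    · simp [reassoc_of% hk, hg]

theorem IsCouniversal.isIso_iff {X : C'} {U V : C} {ξ : R.obj U ⟶ X} (h : R.IsCouniversal ξ)
    {θ : R.obj V ⟶ X} (g : V ⟶ U) (hg : R.map g ≫ ξ = θ) : IsIso g ↔ R.IsCouniversal θ := by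
  constructor
  · intro _ Z
    convert (h Z).comp ((asIso g).homToEquiv.bijective) using 2 with k
    simp [← hg, Iso.homToEquiv]
  · intro h'
    obtain ⟨k, hk⟩ := (h' U).2 ξ
    dsimp at hk
    refine ⟨k, (h' V).1 ?_, (h U).1 ?_⟩
    · simp [hg, hk]
    · simp [hk, hg]

theorem IsUniversal.congr {X : C'} {U : C} {η θ : X ⟶ R.obj U} (h : R.IsUniversal η)
    (e : θ = η) : R.IsUniversal θ := e ▸ h

theorem IsCouniversal.congr {X : C'} {U : C} {η θ : R.obj U ⟶ X} (h : R.IsCouniversal η)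
    (e : θ = η) : R.IsCouniversal θ := e ▸ h

theorem IsUniversal.precomp {X X' : C'} {U : C} {η : X ⟶ R.obj U} (h : R.IsUniversal η)
    (e : X' ⟶ X) [IsIso e] : R.IsUniversal (e ≫ η) := fun Z => by
  convert ((asIso e).homFromEquiv.symm.bijective).comp (h Z) using 2 with k
  simp [Iso.homFromEquiv]

theorem IsCouniversal.postcomp {X X' : C'} {U : C} {ξ : R.obj U ⟶ X} (h : R.IsCouniversal ξ)
    (e : X ⟶ X') [IsIso e] : R.IsCouniversal (ξ ≫ e) := fun Z => by
  convert ((asIso e).homToEquiv.bijective).comp (h Z) using 2 with k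
  simp [Iso.homToEquiv]

theorem IsUniversal.postcomp {X : C'} {U V : C} {η : X ⟶ R.obj U} (h : R.IsUniversal η)
    (e : U ⟶ V) [IsIso e] : R.IsUniversal (η ≫ R.map e) :=
  (h.isIso_iff e rfl).1 inferInstance

theorem IsCouniversal.precomp {X : C'} {U V : C} {ξ : R.obj U ⟶ X} (h : R.IsCouniversal ξ)
    (e : V ⟶ U) [IsIso e] : R.IsCouniversal (R.map e ≫ ξ) :=
  (h.isIso_iff e rfl).1 inferInstance

theorem IsUniversal.natIso {R' : C ⥤ C'} (i : R ≅ R') {X : C'} {U : C} {η : X ⟶ R.obj U}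
    (h : R.IsUniversal η) : R'.IsUniversal (η ≫ i.hom.app U) := fun Z => by
  convert ((i.app Z).homToEquiv.bijective).comp (h Z) using 2 with k
  simp [Iso.homToEquiv]

theorem IsCouniversal.natIso {R' : C ⥤ C'} (i : R' ≅ R) {X : C'} {U : C} {ξ : R.obj U ⟶ X}
    (h : R.IsCouniversal ξ) : R'.IsCouniversal (i.hom.app U ≫ ξ) := fun Z => by
  convert ((i.app Z).homFromEquiv.symm.bijective).comp (h Z) using 2 with k
  simp [Iso.homFromEquiv]

theorem IsUniversal.comp {S : C'' ⥤ C} {X : C'} {U : C} {V : C''} {η : X ⟶ R.obj U}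
    (h : R.IsUniversal η) {θ : U ⟶ S.obj V} (h' : S.IsUniversal θ) :
    (S ⋙ R).IsUniversal (η ≫ R.map θ) := fun Z => by
  have := (h _).comp (h' Z)
  simpa only [Function.comp_def, map_comp, Category.assoc, ← comp_map] using this

theorem IsCouniversal.comp {S : C'' ⥤ C} {X : C'} {U : C} {V : C''} {ξ : R.obj U ⟶ X}
    (h : R.IsCouniversal ξ) {θ : S.obj V ⟶ U} (h' : S.IsCouniversal θ) :
    (S ⋙ R).IsCouniversal (R.map θ ≫ ξ) := fun Z => by
  have := (h _).comp (h' Z)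
  simpa only [Function.comp_def, map_comp, Category.assoc, ← comp_map] using this

/-- A universal arrow which is invertible exhibits its target as a left extended object. -/
theorem IsUniversal.leftExtended {X : C'} {U : C} {η : X ⟶ R.obj U} (h : R.IsUniversal η)
    [IsIso η] : R.LeftExtended U := fun Z => by
  convert ((asIso η).homFromEquiv.bijective).comp (h Z) using 2 with k
  simp [Iso.homFromEquiv]

theorem IsCouniversal.rightExtended {X : C'} {U : C} {ξ : R.obj U ⟶ X} (h : R.IsCouniversal ξ)
    [IsIso ξ] : R.RightExtended U := fun Z => by
  convert ((asIso ξ).homToEquiv.symm.bijective).comp (h Z) using 2 with k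
  simp [Iso.homToEquiv]

theorem LeftExtended.isUniversal {U : C} (h : R.LeftExtended U) {X : C'} (e : X ⟶ R.obj U)
    [IsIso e] : R.IsUniversal e := fun Z => by
  convert ((asIso e).homFromEquiv.symm.bijective).comp (h Z) using 2 with k
  simp [Iso.homFromEquiv]

theorem RightExtended.isCouniversal {U : C} (h : R.RightExtended U) {X : C'} (e : R.obj U ⟶ X)
    [IsIso e] : R.IsCouniversal e := fun Z => by
  convert ((asIso e).homToEquiv.bijective).comp (h Z) using 2 with k
  simp [Iso.homToEquiv]

theorem LeftExtended.of_iso {U V : C} (h : R.LeftExtended U) (e : U ≅ V) : R.LeftExtended V :=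
  have : R.IsUniversal (R.map e.hom) := by
    simpa using (h.isUniversal (𝟙 _)).postcomp e.hom
  this.leftExtended

theorem RightExtended.of_iso {U V : C} (h : R.RightExtended U) (e : U ≅ V) :
    R.RightExtended V :=
  have : R.IsCouniversal (R.map e.inv) := by
    simpa using (h.isCouniversal (𝟙 _)).precomp e.inv
  this.rightExtended

theorem LeftExtended.isIso {U V : C} (hU : R.LeftExtended U) (hV : R.LeftExtended V) (c : U ⟶ V)
    [IsIso (R.map c)] : IsIso c :=
  ((hU.isUniversal (𝟙 _)).isIso_iff c (Category.id_comp _)).2 (hV.isUniversal _)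

theorem RightExtended.isIso {U V : C} (hU : R.RightExtended U) (hV : R.RightExtended V)
    (c : U ⟶ V) [IsIso (R.map c)] : IsIso c :=
  ((hV.isCouniversal (𝟙 _)).isIso_iff c (Category.comp_id _)).2 (hU.isCouniversal _)

section mates

variable {C₁ : Type u₁} {C₂ : Type u₂} {D₁ : Type u₁} {D₂ : Type u₂} [Category.{v₁} C₁]
  [Category.{v₂} C₂] [Category.{v₁} D₁] [Category.{v₂} D₂]

/-- The transformation `β` carries universal arrows to universal arrows. If left adjoints exist
this means that the mate of `β` is invertible. -/
def PreservesUniversal {R₁ : D₁ ⥤ C₁} {H : D₁ ⥤ D₂} {G : C₁ ⥤ C₂} {R₂ : D₂ ⥤ C₂}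
    (β : R₁ ⋙ G ⟶ H ⋙ R₂) : Prop :=
  ∀ ⦃X : C₁⦄ ⦃U : D₁⦄ (η : X ⟶ R₁.obj U), R₁.IsUniversal η →
    R₂.IsUniversal (G.map η ≫ β.app U)

/-- The transformation `γ` carries couniversal arrows to couniversal arrows. If right adjoints
exist this means that the mate of `γ` is invertible. -/
def PreservesCouniversal {G : C₁ ⥤ C₂} {L₁ : C₁ ⥤ D₁} {L₂ : C₂ ⥤ D₂} {H : D₁ ⥤ D₂}
    (γ : G ⋙ L₂ ⟶ L₁ ⋙ H) : Prop :=
  ∀ ⦃X : D₁⦄ ⦃U : C₁⦄ (ξ : L₁.obj U ⟶ X), L₁.IsCouniversal ξ →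
    L₂.IsCouniversal (γ.app U ≫ H.map ξ)

theorem map_comp_comp_app {R₁ : D₁ ⥤ C₁} {H : D₁ ⥤ D₂} {G : C₁ ⥤ C₂} {R₂ : D₂ ⥤ C₂}
    (β : R₁ ⋙ G ⟶ H ⋙ R₂) {X : C₁} {U V : D₁} (θ : X ⟶ R₁.obj U) (c : U ⟶ V) :
    G.map (θ ≫ R₁.map c) ≫ β.app V = (G.map θ ≫ β.app U) ≫ R₂.map (H.map c) := by
  simp only [map_comp, Category.assoc]
  congr 1
  exact β.naturality c

theorem app_comp_map_comp {G : C₁ ⥤ C₂} {L₁ : C₁ ⥤ D₁} {L₂ : C₂ ⥤ D₂} {H : D₁ ⥤ D₂}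
    (γ : G ⋙ L₂ ⟶ L₁ ⋙ H) {X : D₁} {U V : C₁} (θ : L₁.obj V ⟶ X) (c : U ⟶ V) :
    γ.app U ≫ H.map (L₁.map c ≫ θ) = L₂.map (G.map c) ≫ γ.app V ≫ H.map θ := by
  simp only [map_comp, ← Category.assoc]
  congr 1
  exact (γ.naturality c).symm

/-- Universal arrows from a given object are unique, so preservation of one of them suffices. -/
theorem preservesUniversal_of_exists {R₁ : D₁ ⥤ C₁} {H : D₁ ⥤ D₂} {G : C₁ ⥤ C₂} {R₂ : D₂ ⥤ C₂}
    {β : R₁ ⋙ G ⟶ H ⋙ R₂} (h : ∀ X, ∃ (U : D₁) (η : X ⟶ R₁.obj U), R₁.IsUniversal η ∧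
      R₂.IsUniversal (G.map η ≫ β.app U)) : PreservesUniversal β := fun X V θ hθ => by
  obtain ⟨U, η, hη, hη'⟩ := h X
  obtain ⟨g, hg⟩ := (hη V).2 θ
  dsimp at hg
  have : IsIso g := (hη.isIso_iff g hg).2 hθ
  rw [← hg, map_comp_comp_app]
  exact hη'.postcomp (H.map g)

/-- Couniversal arrows to a given object are unique, so preservation of one of them suffices. -/
theorem preservesCouniversal_of_exists {G : C₁ ⥤ C₂} {L₁ : C₁ ⥤ D₁} {L₂ : C₂ ⥤ D₂} {H : D₁ ⥤ D₂}
    {γ : G ⋙ L₂ ⟶ L₁ ⋙ H} (h : ∀ X, ∃ (U : C₁) (ξ : L₁.obj U ⟶ X), L₁.IsCouniversal ξ ∧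
      L₂.IsCouniversal (γ.app U ≫ H.map ξ)) : PreservesCouniversal γ := fun X V θ hθ => by
  obtain ⟨U, ξ, hξ, hξ'⟩ := h X
  obtain ⟨g, hg⟩ := (hξ V).2 θ
  dsimp at hg
  have : IsIso g := (hξ.isIso_iff g hg).2 hθ
  rw [← hg, app_comp_map_comp]
  exact hξ'.precomp (G.map g)

/-- The mate at `X` is the comparison of a universal arrow with the image of the unit at `X`. -/
theorem isIso_mateEquiv_symm_iff {R₁ : D₁ ⥤ C₁} {H : D₁ ⥤ D₂} {G : C₁ ⥤ C₂} {R₂ : D₂ ⥤ C₂}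
    {L₁ : C₁ ⥤ D₁} {L₂ : C₂ ⥤ D₂} (adj₁ : L₁ ⊣ R₁) (adj₂ : L₂ ⊣ R₂)
    (β : R₁ ⋙ G ⟶ H ⋙ R₂) :
    IsIso ((CategoryTheory.mateEquiv adj₁ adj₂).symm β).natTrans ↔ PreservesUniversal β := by
  have key (X : C₁) : IsIso (((CategoryTheory.mateEquiv adj₁ adj₂).symm β).natTrans.app X) ↔
      R₂.IsUniversal (G.map (adj₁.unit.app X) ≫ β.app (L₁.obj X)) :=
    (isUniversal_unit adj₂ (G.obj X)).isIso_iff _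
      (unit_mateEquiv_symm adj₁ adj₂ β X).symm
  rw [NatTrans.isIso_iff_isIso_app]
  refine ⟨fun h => preservesUniversal_of_exists fun X =>
    ⟨_, _, isUniversal_unit adj₁ X, (key X).1 (h X)⟩,
    fun h X => (key X).2 (h _ (isUniversal_unit adj₁ X))⟩

/-- The mate at `X` is the comparison of the image of the counit at `X` with a couniversal arrow. -/
theorem isIso_mateEquiv_iff {G : C₁ ⥤ C₂} {L₁ : C₁ ⥤ D₁} {L₂ : C₂ ⥤ D₂} {H : D₁ ⥤ D₂}
    {R₁ : D₁ ⥤ C₁} {R₂ : D₂ ⥤ C₂} (adj₁ : L₁ ⊣ R₁) (adj₂ : L₂ ⊣ R₂)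
    (γ : G ⋙ L₂ ⟶ L₁ ⋙ H) :
    IsIso (CategoryTheory.mateEquiv adj₁ adj₂ γ).natTrans ↔ PreservesCouniversal γ := by
  have key (X : D₁) : IsIso ((CategoryTheory.mateEquiv adj₁ adj₂ γ).natTrans.app X) ↔
      L₂.IsCouniversal (γ.app (R₁.obj X) ≫ H.map (adj₁.counit.app X)) :=
    (isCouniversal_counit adj₂ (H.obj X)).isIso_iff _
      (CategoryTheory.mateEquiv_counit adj₁ adj₂ γ X)
  rw [NatTrans.isIso_iff_isIso_app]
  refine ⟨fun h => preservesCouniversal_of_exists fun X =>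
    ⟨_, _, isCouniversal_counit adj₁ X, (key X).1 (h X)⟩,
    fun h X => (key X).2 (h _ (isCouniversal_counit adj₁ X))⟩

end mates

end CategoryTheory.Functor

/-! ### Calculus of restrictions -/

namespace Prederivator

section calculus

variable (D : Prederivator.{w, v, u}) {A B C S : Cat.{w, w}}

/-- Restriction along a composite. -/
def restrComp (p : A ⟶ B) (u : B ⟶ C) : D.restr (p ≫ u) ≅ D.restr u ⋙ D.restr p :=
  Cat.Hom.toNatIso (D.mapComp u.op p.op)

/-- Restriction along an identity. -/
def restrId (A : Cat.{w, w}) : D.restr (𝟙 A) ≅ 𝟭 (D.dia A) :=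
  Cat.Hom.toNatIso (D.mapId (op A))

/-- The transformation of restrictions induced by a natural transformation. -/
def cell {f g : A ⟶ B} (α : f ⟶ g) : D.restr f ⟶ D.restr g :=
  (D.map₂ (Bicategory.Opposite.op2 α)).toNatTrans

/-- The isomorphism of restrictions induced by a natural isomorphism. -/
def cellIso {f g : A ⟶ B} (α : f ≅ g) : D.restr f ≅ D.restr g :=
  Cat.Hom.toNatIso (D.map₂Iso α.op2)

theorem cell_comp {f g h : A ⟶ B} (α : f ⟶ g) (β : g ⟶ h) :
    D.cell (α ≫ β) = D.cell α ≫ D.cell β :=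
  congrArg Cat.Hom₂.toNatTrans
    (D.map₂_comp (Bicategory.Opposite.op2 α) (Bicategory.Opposite.op2 β))

@[simp]
theorem cell_hom_inv_app {f g : A ⟶ B} (e : f ≅ g) (X : D.dia B) :
    (D.cell e.hom).app X ≫ (D.cell e.inv).app X = 𝟙 _ :=
  (D.cellIso e).hom_inv_id_app X

@[simp]
theorem cell_inv_hom_app {f g : A ⟶ B} (e : f ≅ g) (X : D.dia B) :
    (D.cell e.inv).app X ≫ (D.cell e.hom).app X = 𝟙 _ :=
  (D.cellIso e).inv_hom_id_app X

instance {f g : A ⟶ B} (α : f ⟶ g) [IsIso α] : IsIso (D.cell α) :=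
  (D.cellIso (asIso α)).isIso_hom

theorem square_app {B' : Cat.{w, w}} {p : A ⟶ B} {u : B ⟶ C} {q : A ⟶ B'} {v : B' ⟶ C}
    (α : p ≫ u ⟶ q ≫ v) (X : D.dia C) :
    (D.square α).app X = (D.restrComp p u).inv.app X ≫ (D.cell α).app X ≫
      (D.restrComp q v).hom.app X := rfl

instance {B' : Cat.{w, w}} {p : A ⟶ B} {u : B ⟶ C} {q : A ⟶ B'} {v : B' ⟶ C}
    (α : p ≫ u ⟶ q ≫ v) [IsIso α] : IsIso (D.square α) :=
  have (X : D.dia C) : IsIso ((D.square α).app X) := by rw [square_app]; infer_instance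
  NatIso.isIso_of_isIso_app _

theorem cell_whiskerLeft_app (r : S ⟶ A) {f g : A ⟶ B} (α : f ⟶ g) (X : D.dia B) :
    (D.cell (r ◁ α)).app X ≫ (D.restrComp r g).hom.app X =
      (D.restrComp r f).hom.app X ≫ (D.restr r).map ((D.cell α).app X) := by
  have h := app_congr (D.map₂_whisker_right (Bicategory.Opposite.op2 α) r.op) X
  rw [← Iso.app_hom, ← Iso.app_hom, ← Iso.eq_comp_inv, Category.assoc]
  exact h

theorem cell_whiskerRight_app {r s : S ⟶ A} (β : r ⟶ s) (f : A ⟶ B) (X : D.dia B) :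
    (D.cell (β ▷ f)).app X ≫ (D.restrComp s f).hom.app X =
      (D.restrComp r f).hom.app X ≫ (D.cell β).app ((D.restr f).obj X) := by
  have h := app_congr (D.map₂_whisker_left f.op (Bicategory.Opposite.op2 β)) X
  rw [← Iso.app_hom, ← Iso.app_hom, ← Iso.eq_comp_inv, Category.assoc]
  exact h

theorem restrComp_assoc_app (r : S ⟶ A) (p : A ⟶ B) (u : B ⟶ C) (X : D.dia C) :
    (D.restrComp (r ≫ p) u).hom.app X ≫ (D.restrComp r p).hom.app ((D.restr u).obj X) =
      (D.cell (α_ r p u).hom).app X ≫ (D.restrComp r (p ≫ u)).hom.app X ≫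
        (D.restr r).map ((D.restrComp p u).hom.app X) := by
  have h : (D.cell (α_ r p u).inv).app X =
      (D.restrComp r (p ≫ u)).hom.app X ≫ (D.restr r).map ((D.restrComp p u).hom.app X) ≫ 𝟙 _ ≫
        (D.restrComp r p).inv.app ((D.restr u).obj X) ≫ (D.restrComp (r ≫ p) u).inv.app X :=
    app_congr (D.map₂_associator u.op p.op r.op) X
  have h' := D.cell_hom_inv_app (α_ r p u) X
  rw [h] at h'
  rw [← cancel_mono ((D.restrComp r p).inv.app ((D.restr u).obj X) ≫
    (D.restrComp (r ≫ p) u).inv.app X)]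
  simpa using h'.symm

/-- The pasting of two squares along a common edge `q`. -/
def vpaste {B' T : Cat.{w, w}} {p : A ⟶ B} {u : B ⟶ C} {q : A ⟶ B'} {v : B' ⟶ C}
    (α : p ≫ u ⟶ q ≫ v) {r : S ⟶ A} {π : S ⟶ T} {b : T ⟶ B'} (κ : r ≫ q ⟶ π ≫ b) :
    (r ≫ p) ≫ u ⟶ π ≫ (b ≫ v) :=
  (α_ r p u).hom ≫ r ◁ α ≫ (α_ r q v).inv ≫ κ ▷ v ≫ (α_ π b v).hom

/-- The pasting of two squares along a common edge `p`. -/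
def hpaste {B' T : Cat.{w, w}} {p : A ⟶ B} {u : B ⟶ C} {q : A ⟶ B'} {v : B' ⟶ C}
    (α : p ≫ u ⟶ q ≫ v) {r : S ⟶ A} {π : S ⟶ T} {b : T ⟶ B} (κ : π ≫ b ⟶ r ≫ p) :
    π ≫ (b ≫ u) ⟶ (r ≫ q) ≫ v :=
  (α_ π b u).inv ≫ κ ▷ u ≫ (α_ r p u).hom ≫ r ◁ α ≫ (α_ r q v).inv

theorem square_vpaste_app {B' T : Cat.{w, w}} {p : A ⟶ B} {u : B ⟶ C} {q : A ⟶ B'} {v : B' ⟶ C}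
    (α : p ≫ u ⟶ q ≫ v) {r : S ⟶ A} {π : S ⟶ T} {b : T ⟶ B'} (κ : r ≫ q ⟶ π ≫ b)
    (X : D.dia C) :
    (D.square (vpaste α κ)).app X ≫ (D.restr π).map ((D.restrComp b v).hom.app X) =
      (D.restrComp r p).hom.app ((D.restr u).obj X) ≫ (D.restr r).map ((D.square α).app X) ≫
        (D.square κ).app ((D.restr v).obj X) := by
  simp only [square_app, vpaste, cell_comp, NatTrans.comp_app, Functor.map_comp, Category.assoc]
  rw [← cancel_epi ((D.restrComp (r ≫ p) u).hom.app X), Iso.hom_inv_id_app_assoc,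
    reassoc_of% D.restrComp_assoc_app, ← Functor.map_comp_assoc _ ((D.restrComp p u).hom.app X),
    Iso.hom_inv_id_app, CategoryTheory.Functor.map_id, Category.id_comp,
    ← reassoc_of% D.cell_whiskerLeft_app, ← restrComp_assoc_app,
    reassoc_of% D.cell_whiskerRight_app]
  congr 2
  rw [← cancel_epi ((D.cell (α_ r q v).hom).app X), ← reassoc_of% D.restrComp_assoc_app,
    Iso.hom_inv_id_app_assoc, reassoc_of% D.cell_hom_inv_app]

theorem square_hpaste_app {B' T : Cat.{w, w}} {p : A ⟶ B} {u : B ⟶ C} {q : A ⟶ B'} {v : B' ⟶ C}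
    (α : p ≫ u ⟶ q ≫ v) {r : S ⟶ A} {π : S ⟶ T} {b : T ⟶ B} (κ : π ≫ b ⟶ r ≫ p)
    (X : D.dia C) :
    (D.square (hpaste α κ)).app X ≫ (D.restrComp r q).hom.app ((D.restr v).obj X) =
      (D.restr π).map ((D.restrComp b u).hom.app X) ≫ (D.square κ).app ((D.restr u).obj X) ≫
        (D.restr r).map ((D.square α).app X) := by
  simp only [square_app, hpaste, cell_comp, NatTrans.comp_app, Functor.map_comp, Category.assoc]
  rw [← cancel_epi ((D.restrComp π (b ≫ u)).hom.app X), Iso.hom_inv_id_app_assoc,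
    restrComp_assoc_app, ← cancel_epi ((D.cell (α_ π b u).hom).app X),
    ← reassoc_of% D.restrComp_assoc_app, Iso.hom_inv_id_app_assoc, reassoc_of% D.cell_hom_inv_app,
    ← reassoc_of% D.cell_whiskerRight_app,
    reassoc_of% D.cell_inv_hom_app, reassoc_of% D.restrComp_assoc_app,
    ← Functor.map_comp_assoc _ ((D.restrComp p u).hom.app X), Iso.hom_inv_id_app,
    CategoryTheory.Functor.map_id, Category.id_comp, reassoc_of% D.cell_whiskerLeft_app]

/-- A square restricted along `Φ`. -/
def restrictSquare {B' : Cat.{w, w}} {p : A ⟶ B} {u : B ⟶ C} {q : A ⟶ B'} {v : B' ⟶ C}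
    (Φ : S ⟶ A) (α : p ≫ u ⟶ q ≫ v) : (Φ ≫ p) ≫ u ⟶ (Φ ≫ q) ≫ v :=
  (α_ Φ p u).hom ≫ Φ ◁ α ≫ (α_ Φ q v).inv

theorem square_restrictSquare_app {B' : Cat.{w, w}} {p : A ⟶ B} {u : B ⟶ C} {q : A ⟶ B'}
    {v : B' ⟶ C} (Φ : S ⟶ A) (α : p ≫ u ⟶ q ≫ v) (X : D.dia C) :
    (D.square (restrictSquare Φ α)).app X ≫ (D.restrComp Φ q).hom.app ((D.restr v).obj X) =
      (D.restrComp Φ p).hom.app ((D.restr u).obj X) ≫ (D.restr Φ).map ((D.square α).app X) := by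
  simp only [square_app, restrictSquare, cell_comp, NatTrans.comp_app, Functor.map_comp,
    Category.assoc]
  rw [restrComp_assoc_app, reassoc_of% D.cell_inv_hom_app, reassoc_of% D.cell_whiskerLeft_app,
    ← cancel_epi ((D.restrComp (Φ ≫ p) u).hom.app X), Iso.hom_inv_id_app_assoc,
    reassoc_of% D.restrComp_assoc_app, ← Functor.map_comp_assoc _ ((D.restrComp p u).hom.app X),
    Iso.hom_inv_id_app, CategoryTheory.Functor.map_id, Category.id_comp]

theorem square_comp_whiskerLeft_app {B' : Cat.{w, w}} {p : A ⟶ B} {u : B ⟶ C} {q : A ⟶ B'}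
    {v v' : B' ⟶ C} (α : p ≫ u ⟶ q ≫ v) (β : v ⟶ v') (X : D.dia C) :
    (D.square (α ≫ q ◁ β)).app X = (D.square α).app X ≫ (D.restr q).map ((D.cell β).app X) := by
  simp only [square_app, cell_comp, NatTrans.comp_app, Category.assoc, cell_whiskerLeft_app]

theorem square_whiskerLeft_comp_app {B' : Cat.{w, w}} {p : A ⟶ B} {u u' : B ⟶ C} {q : A ⟶ B'}
    {v : B' ⟶ C} (α : p ≫ u ⟶ q ≫ v) (β : u' ⟶ u) (X : D.dia C) :
    (D.square (p ◁ β ≫ α)).app X = (D.restr p).map ((D.cell β).app X) ≫ (D.square α).app X := by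
  simp only [square_app, cell_comp, NatTrans.comp_app, Category.assoc]
  rw [← cancel_epi ((D.restrComp p u').hom.app X), Iso.hom_inv_id_app_assoc,
    ← reassoc_of% D.cell_whiskerLeft_app, Iso.hom_inv_id_app_assoc]

end calculus
end Prederivator

/-! ### Homotopy exact squares -/

namespace Prederivator

open Functor

section

variable {A B C B' S T : Cat.{w, w}}

/-- The `2`-cell of the slice square `(u/b)`. -/
abbrev commaCellLeft (u : A ⟶ B) (b : B) :
    (Comma.fst u.toFunctor (Functor.fromPUnit.{w} b)).toCatHom ≫ u ⟶
      (Comma.snd u.toFunctor (Functor.fromPUnit.{w} b)).toCatHom ≫ point b :=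
  NatTrans.toCatHom₂ (Comma.natTrans u.toFunctor (Functor.fromPUnit.{w} b))

/-- The `2`-cell of the slice square `(b/u)`. -/
abbrev commaCellRight (u : A ⟶ B) (b : B) :
    (Comma.fst (Functor.fromPUnit.{w} b) u.toFunctor).toCatHom ≫ point b ⟶
      (Comma.snd (Functor.fromPUnit.{w} b) u.toFunctor).toCatHom ≫ u :=
  NatTrans.toCatHom₂ (Comma.natTrans (Functor.fromPUnit.{w} b) u.toFunctor)

variable {p : A ⟶ B} {u : B ⟶ C} {q : A ⟶ B'} {v : B' ⟶ C}

/-- Every morphism `u x ⟶ v b` factors through a component of `α`, and there is an initial such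
factorization. -/
def InitialFactorization (α : p ≫ u ⟶ q ≫ v) : Prop :=
  ∀ (x : B) (b : B') (g : u.toFunctor.obj x ⟶ v.toFunctor.obj b),
    ∃ (a : A) (m : x ⟶ p.toFunctor.obj a) (h : q.toFunctor.obj a ⟶ b),
      u.toFunctor.map m ≫ α.toNatTrans.app a ≫ v.toFunctor.map h = g ∧
      ∀ (a' : A) (m' : x ⟶ p.toFunctor.obj a') (h' : q.toFunctor.obj a' ⟶ b),
        u.toFunctor.map m' ≫ α.toNatTrans.app a' ≫ v.toFunctor.map h' = g →
          ∃! t : a ⟶ a', m ≫ p.toFunctor.map t = m' ∧ q.toFunctor.map t ≫ h' = h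

/-- Every morphism `u x ⟶ v b` factors through a component of `α`, and there is a terminal such
factorization. -/
def TerminalFactorization (α : p ≫ u ⟶ q ≫ v) : Prop :=
  ∀ (x : B) (b : B') (g : u.toFunctor.obj x ⟶ v.toFunctor.obj b),
    ∃ (a : A) (m : x ⟶ p.toFunctor.obj a) (h : q.toFunctor.obj a ⟶ b),
      u.toFunctor.map m ≫ α.toNatTrans.app a ≫ v.toFunctor.map h = g ∧
      ∀ (a' : A) (m' : x ⟶ p.toFunctor.obj a') (h' : q.toFunctor.obj a' ⟶ b),
        u.toFunctor.map m' ≫ α.toNatTrans.app a' ≫ v.toFunctor.map h' = g →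
          ∃! t : a' ⟶ a, m' ≫ p.toFunctor.map t = m ∧ q.toFunctor.map t ≫ h = h'

theorem naturality_of_cell (α : p ≫ u ⟶ q ≫ v) {a a' : A} (f : a ⟶ a') :
    u.toFunctor.map (p.toFunctor.map f) ≫ α.toNatTrans.app a' =
      α.toNatTrans.app a ≫ v.toFunctor.map (q.toFunctor.map f) :=
  α.toNatTrans.naturality f

/-- The functor `(q/b) ⥤ (u/v b)` induced by a square. -/
def commaMapLeft (α : p ≫ u ⟶ q ≫ v) (b : B') :
    Comma q.toFunctor (Functor.fromPUnit.{w} b) ⥤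
      Comma u.toFunctor (Functor.fromPUnit.{w} (v.toFunctor.obj b)) where
  obj Y :=
    { left := p.toFunctor.obj Y.left
      right := Y.right
      hom := α.toNatTrans.app Y.left ≫ v.toFunctor.map Y.hom }
  map {Y Y'} f :=
    { left := p.toFunctor.map f.left
      right := f.right
      w := by
        have h := f.w
        dsimp at h ⊢
        rw [reassoc_of% naturality_of_cell α f.left, ← Functor.map_comp, h]
        simp }

/-- The functor `(x/p) ⥤ (u x/v)` induced by a square. -/
def commaMapRight (α : p ≫ u ⟶ q ≫ v) (x : B) :
    Comma (Functor.fromPUnit.{w} x) p.toFunctor ⥤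
      Comma (Functor.fromPUnit.{w} (u.toFunctor.obj x)) v.toFunctor where
  obj Y :=
    { left := Y.left
      right := q.toFunctor.obj Y.right
      hom := u.toFunctor.map Y.hom ≫ α.toNatTrans.app Y.right }
  map {Y Y'} f :=
    { left := f.left
      right := q.toFunctor.map f.right
      w := by
        have h := f.w
        dsimp at h ⊢
        rw [Category.assoc, ← naturality_of_cell α f.right, ← Functor.map_comp_assoc, ← h]
        simp }

/-- The initial factorizations are the values of the left adjoint. -/
theorem isRightAdjoint_commaMapLeft {α : p ≫ u ⟶ q ≫ v} (h : InitialFactorization α) (b : B') :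
    (commaMapLeft α b).IsRightAdjoint := by
  refine isRightAdjoint_of_isUniversal fun X => ?_
  obtain ⟨a, m, k, hk, H⟩ := h X.left b X.hom
  refine ⟨⟨a, X.right, k⟩, ⟨m, 𝟙 _, by simpa [commaMapLeft] using hk⟩, fun Z => ⟨?_, ?_⟩⟩
  · intro f f' hf
    have h1 := congrArg CommaMorphism.left hf
    obtain ⟨t, -, ht⟩ := H Z.left (m ≫ p.toFunctor.map f.left) Z.hom (by
      have := f.w
      dsimp at this
      rw [Functor.map_comp, Category.assoc, reassoc_of% naturality_of_cell α f.left,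
        ← Functor.map_comp, this]
      simpa using hk)
    have e1 := ht f.left ⟨rfl, by simp⟩
    have e2 := ht f'.left ⟨h1.symm, by simp⟩
    exact CommaMorphism.ext (e1.trans e2.symm) (Subsingleton.elim _ _)
  · intro f
    obtain ⟨t, ht, -⟩ := H Z.left f.left Z.hom (by simpa [commaMapLeft] using f.w)
    exact ⟨⟨t, f.right, by simpa using ht.2⟩,
      CommaMorphism.ext ht.1 (Subsingleton.elim _ _)⟩

/-- The terminal factorizations are the values of the right adjoint. -/
theorem isLeftAdjoint_commaMapRight {α : p ≫ u ⟶ q ≫ v} (h : TerminalFactorization α) (x : B) :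
    (commaMapRight α x).IsLeftAdjoint := by
  refine isLeftAdjoint_of_isCouniversal fun X => ?_
  obtain ⟨a, m, k, hk, H⟩ := h x X.right X.hom
  refine ⟨⟨X.left, a, m⟩, ⟨𝟙 _, k, by simpa [commaMapRight] using hk.symm⟩, fun Z => ⟨?_, ?_⟩⟩
  · intro f f' hf
    have h1 := congrArg CommaMorphism.right hf
    obtain ⟨t, -, ht⟩ := H Z.right Z.hom (q.toFunctor.map f.right ≫ k) (by
      have := f.w
      dsimp at this
      rw [Functor.map_comp, ← reassoc_of% naturality_of_cell α f.right,
        ← Functor.map_comp_assoc, ← this]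
      simpa using hk)
    have e1 := ht f.right ⟨by simpa using f.w.symm, rfl⟩
    have e2 := ht f'.right ⟨by simpa using f'.w.symm, h1.symm⟩
    exact CommaMorphism.ext (Subsingleton.elim _ _) (e1.trans e2.symm)
  · intro f
    obtain ⟨t, ht, -⟩ := H Z.right Z.hom f.right (by simpa [commaMapRight] using f.w.symm)
    exact ⟨⟨f.left, t, by simpa using ht.1.symm⟩,
      CommaMorphism.ext (Subsingleton.elim _ _) ht.2⟩

theorem isIso_cell_of_pt {f g : A ⟶ pt.{w}} (α : f ⟶ g) : IsIso α := by
  have key {x y : Discrete PUnit.{w + 1}} (k : x ⟶ y) : IsIso k := inferInstance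
  have (X : A) : IsIso (α.toNatTrans.app X) := key _
  have : IsIso α.toNatTrans := NatIso.isIso_of_isIso_app _
  exact (Cat.Hom.isoMk (asIso α.toNatTrans)).isIso_hom

variable (D : Prederivator.{w, v, u})

/-- Restriction functors along adjoint functors are adjoint. -/
def restrAdjunction {F : A ⟶ B} {G : B ⟶ A} (adj : F.toFunctor ⊣ G.toFunctor) :
    D.restr G ⊣ D.restr F :=
  Adjunction.ofCat (D.mapAdjunction (f := G.op) (g := F.op)
    { unit := Bicategory.Opposite.op2 (NatTrans.toCatHom₂ adj.unit)
      counit := Bicategory.Opposite.op2 (NatTrans.toCatHom₂ adj.counit)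
      left_triangle := op2_ext fun x => by
        have := adj.right_triangle_components x
        simp [leftZigzag, bicategoricalComp]
        exact this
      right_triangle := op2_ext fun x => by
        have := adj.left_triangle_components x
        simp [rightZigzag, bicategoricalComp]
        exact this })

/-- Restriction of constant diagrams along natural transformations is invertible. -/
theorem isIso_cell_app_of_pt {r s : S ⟶ A} (β : r ⟶ s) (t : A ⟶ pt.{w}) (Y : D.dia pt) :
    IsIso ((D.cell β).app ((D.restr t).obj Y)) := by
  have := isIso_cell_of_pt (β ▷ t)
  have h := D.cell_whiskerRight_app β t Y
  have h' : IsIso ((D.restrComp r t).hom.app Y ≫ (D.cell β).app ((D.restr t).obj Y)) := by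
    rw [← h]; infer_instance
  exact IsIso.of_isIso_comp_left ((D.restrComp r t).hom.app Y) _

theorem exists_iso_restr_pt (F : T ⟶ S) (t : T ⟶ pt.{w}) (Y : D.dia pt) :
    Nonempty ((D.restr F).obj ((D.restr (toPt S)).obj Y) ≅ (D.restr t).obj Y) :=
  restr_restr F (toPt S) t (Functor.punitExt _ _) Y

/-- Restriction along a functor which has a left adjoint does not change colimits. -/
theorem bijective_restr_map_of_isRightAdjoint (Φ : S ⟶ T) [Φ.toFunctor.IsRightAdjoint]
    (t : T ⟶ pt.{w}) (Z : D.dia T) (Y : D.dia pt) :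
    Function.Bijective fun g : Z ⟶ (D.restr t).obj Y => (D.restr Φ).map g := by
  let adj := D.restrAdjunction (F := Φ.toFunctor.leftAdjoint.toCatHom) (G := Φ)
    (Adjunction.ofIsRightAdjoint Φ.toFunctor)
  let W := (D.restr (toPt S)).obj Y
  obtain ⟨i⟩ := D.exists_iso_restr_pt Φ.toFunctor.leftAdjoint.toCatHom t Y
  have hc : IsIso (adj.counit.app W) := by
    have := D.isIso_cell_app_of_pt (r := Φ ≫ Φ.toFunctor.leftAdjoint.toCatHom) (s := 𝟙 S)
      (NatTrans.toCatHom₂ (Adjunction.ofIsRightAdjoint Φ.toFunctor).counit) (toPt S) Y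
    exact IsIso.comp_isIso' (f := (D.restrComp _ _).inv.app W) inferInstance
      (IsIso.comp_isIso' this (inferInstance : IsIso ((D.restrId S).hom.app W)))
  have h := ((isCouniversal_counit adj W).rightExtended).of_iso i
  exact h Z

/-- Restriction along a functor which has a right adjoint does not change limits. -/
theorem bijective_restr_map_of_isLeftAdjoint (Φ : S ⟶ T) [Φ.toFunctor.IsLeftAdjoint]
    (t : T ⟶ pt.{w}) (Z : D.dia T) (Y : D.dia pt) :
    Function.Bijective fun g : (D.restr t).obj Y ⟶ Z => (D.restr Φ).map g := by
  let adj := D.restrAdjunction (F := Φ) (G := Φ.toFunctor.rightAdjoint.toCatHom)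
    (Adjunction.ofIsLeftAdjoint Φ.toFunctor)
  let W := (D.restr (toPt S)).obj Y
  obtain ⟨i⟩ := D.exists_iso_restr_pt Φ.toFunctor.rightAdjoint.toCatHom t Y
  have hc : IsIso (adj.unit.app W) := by
    have := D.isIso_cell_app_of_pt (r := 𝟙 S) (s := Φ ≫ Φ.toFunctor.rightAdjoint.toCatHom)
      (NatTrans.toCatHom₂ (Adjunction.ofIsLeftAdjoint Φ.toFunctor).unit) (toPt S) Y
    exact IsIso.comp_isIso' (f := (D.restrId S).inv.app W) inferInstance
      (IsIso.comp_isIso' this (inferInstance : IsIso ((D.restrComp _ _).hom.app W)))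
  have h := ((isUniversal_unit adj W).leftExtended).of_iso i
  exact h Z

theorem IsUniversal.restr {D : Prederivator.{w, v, u}} (Φ : S ⟶ T) [Φ.toFunctor.IsRightAdjoint]
    {t : T ⟶ pt.{w}} {Z : D.dia T} {U : D.dia pt} {ζ : Z ⟶ (D.restr t).obj U}
    (h : (D.restr t).IsUniversal ζ) :
    (D.restr (Φ ≫ t)).IsUniversal ((D.restr Φ).map ζ ≫ (D.restrComp Φ t).inv.app U) := by
  have : (D.restr t ⋙ D.restr Φ).IsUniversal (U := U) ((D.restr Φ).map ζ) := fun Y => by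
    have := (D.bijective_restr_map_of_isRightAdjoint Φ t Z Y).comp (h Y)
    simpa [Function.comp_def] using this
  exact this.natIso (D.restrComp Φ t).symm

theorem IsCouniversal.restr {D : Prederivator.{w, v, u}} (Φ : S ⟶ T) [Φ.toFunctor.IsLeftAdjoint]
    {t : T ⟶ pt.{w}} {Z : D.dia T} {U : D.dia pt} {ζ : (D.restr t).obj U ⟶ Z}
    (h : (D.restr t).IsCouniversal ζ) :
    (D.restr (Φ ≫ t)).IsCouniversal ((D.restrComp Φ t).hom.app U ≫ (D.restr Φ).map ζ) := by
  have : (D.restr t ⋙ D.restr Φ).IsCouniversal (U := U) ((D.restr Φ).map ζ) := fun Y => by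
    have := (D.bijective_restr_map_of_isLeftAdjoint Φ t Z Y).comp (h Y)
    simpa [Function.comp_def] using this
  exact this.natIso (D.restrComp Φ t)

namespace IsDerivator

variable {D} (hD : D.IsDerivator)
include hD

theorem isIso_of_points {X Y : D.dia B} (f : X ⟶ Y)
    (h : ∀ b : B, IsIso ((D.restr (point b)).map f)) : IsIso f := (hD.der2 B f).2 h

theorem preservesUniversal_comma (u : A ⟶ B) (b : B) :
    PreservesUniversal (D.square (commaCellLeft u b)) := by
  have := hD.der3_left u
  have := hD.der3_left (Comma.snd u.toFunctor (Functor.fromPUnit.{w} b)).toCatHom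
  exact (isIso_mateEquiv_symm_iff (Adjunction.ofIsRightAdjoint (D.restr u))
    (Adjunction.ofIsRightAdjoint _) _).1 (hD.der4_left u b _ _)

theorem preservesCouniversal_comma (u : A ⟶ B) (b : B) :
    PreservesCouniversal (D.square (commaCellRight u b)) := by
  have := hD.der3_right u
  have := hD.der3_right (Comma.fst (Functor.fromPUnit.{w} b) u.toFunctor).toCatHom
  exact (isIso_mateEquiv_iff (Adjunction.ofIsLeftAdjoint (D.restr u))
    (Adjunction.ofIsLeftAdjoint _) _).1 (hD.der4_right u b _ _)

/-- Left Kan extensions are detected pointwise. -/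
theorem isUniversal_of_points (u : A ⟶ B) {X : D.dia A} {U : D.dia B}
    (η : X ⟶ (D.restr u).obj U)
    (h : ∀ b : B, (D.restr (Comma.snd u.toFunctor (Functor.fromPUnit.{w} b)).toCatHom).IsUniversal
      ((D.restr (Comma.fst u.toFunctor (Functor.fromPUnit.{w} b)).toCatHom).map η ≫
        (D.square (commaCellLeft u b)).app U)) : (D.restr u).IsUniversal η := by
  have := hD.der3_left u
  obtain ⟨V, θ, hθ⟩ := exists_isUniversal (R := D.restr u) X
  obtain ⟨c, hc⟩ := (hθ U).2 η
  dsimp only at hc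
  refine (hθ.isIso_iff c hc).1 (hD.isIso_of_points _ fun b => ?_)
  refine ((hD.preservesUniversal_comma u b θ hθ).isIso_iff _ ?_).2 (h b)
  rw [← hc]
  exact (map_comp_comp_app (D.square (commaCellLeft u b)) θ c).symm

/-- Right Kan extensions are detected pointwise. -/
theorem isCouniversal_of_points (u : A ⟶ B) {X : D.dia A} {U : D.dia B}
    (ξ : (D.restr u).obj U ⟶ X)
    (h : ∀ b : B, (D.restr (Comma.fst (Functor.fromPUnit.{w} b) u.toFunctor).toCatHom).IsCouniversal
      ((D.square (commaCellRight u b)).app U ≫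
        (D.restr (Comma.snd (Functor.fromPUnit.{w} b) u.toFunctor).toCatHom).map ξ)) :
    (D.restr u).IsCouniversal ξ := by
  have := hD.der3_right u
  obtain ⟨V, θ, hθ⟩ := exists_isCouniversal (R := D.restr u) X
  obtain ⟨c, hc⟩ := (hθ U).2 ξ
  dsimp only at hc
  refine (hθ.isIso_iff c hc).1 (hD.isIso_of_points _ fun b => ?_)
  refine ((hD.preservesCouniversal_comma u b θ hθ).isIso_iff _ ?_).2 (h b)
  rw [← hc]
  exact (app_comp_map_comp (D.square (commaCellRight u b)) θ c).symm

end IsDerivator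

theorem square_whiskerRight_comp_app {p' : A ⟶ B} (β : p' ⟶ p) (α : p ≫ u ⟶ q ≫ v)
    (X : D.dia C) :
    (D.square (β ▷ u ≫ α)).app X = (D.cell β).app ((D.restr u).obj X) ≫ (D.square α).app X := by
  simp only [square_app, cell_comp, NatTrans.comp_app, Category.assoc]
  rw [← cancel_epi ((D.restrComp p' u).hom.app X), Iso.hom_inv_id_app_assoc,
    ← reassoc_of% D.cell_whiskerRight_app, Iso.hom_inv_id_app_assoc]

theorem square_comp_whiskerRight_app {q' : A ⟶ B'} (α : p ≫ u ⟶ q ≫ v) (β : q ⟶ q')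
    (X : D.dia C) :
    (D.square (α ≫ β ▷ v)).app X = (D.square α).app X ≫ (D.cell β).app ((D.restr v).obj X) := by
  simp only [square_app, cell_comp, NatTrans.comp_app, Category.assoc, cell_whiskerRight_app]

/-- Universality for a slice square is inherited along the restriction functor `Φ` between slices
which is induced by a square `α`. -/
theorem isUniversal_vpaste (α : p ≫ u ⟶ q ≫ v) {Φ : S ⟶ T} [Φ.toFunctor.IsRightAdjoint]
    {r : S ⟶ A} {r' : T ⟶ B} {s : T ⟶ pt} {b : pt ⟶ B'} {c : pt ⟶ C}
    (κ : r ≫ q ⟶ (Φ ≫ s) ≫ b) (κ' : r' ≫ u ⟶ s ≫ c) (ρ : r ≫ p ≅ Φ ≫ r') (ι : b ≫ v ≅ c)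
    (h : vpaste α κ ≫ (Φ ≫ s) ◁ ι.hom = ρ.hom ▷ u ≫ restrictSquare Φ κ') {X : D.dia B}
    {U : D.dia C} {η : X ⟶ (D.restr u).obj U}
    (hη : (D.restr s).IsUniversal ((D.restr r').map η ≫ (D.square κ').app U)) :
    (D.restr (Φ ≫ s)).IsUniversal ((D.restr r).map ((D.restr p).map η ≫ (D.square α).app U) ≫
      (D.square κ).app ((D.restr v).obj U)) := by
  have h1 := ((IsUniversal.restr Φ hη).precomp ((D.restrComp r p).inv.app X ≫
    (D.cell ρ.hom).app X ≫ (D.restrComp Φ r').hom.app X)).postcomp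
      ((D.cell ι.inv).app U ≫ (D.restrComp b v).hom.app U)
  refine h1.congr ?_
  have h2 := D.square_vpaste_app α κ U
  have h3 := NatTrans.congr_app (congrArg D.square h) U
  rw [square_comp_whiskerLeft_app, square_whiskerRight_comp_app] at h3
  have h4 := D.square_restrictSquare_app Φ κ' U
  have h5 : (D.square (vpaste α κ)).app U = (D.cell ρ.hom).app ((D.restr u).obj U) ≫
      (D.restrComp Φ r').hom.app _ ≫ (D.restr Φ).map ((D.square κ').app U) ≫
        (D.restrComp Φ s).inv.app _ ≫ (D.restr (Φ ≫ s)).map ((D.cell ι.inv).app U) := by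
    rw [← reassoc_of% h4, Iso.hom_inv_id_app_assoc, ← reassoc_of% h3, ← Functor.map_comp,
      cell_hom_inv_app]
    simp
  rw [h5] at h2
  rw [← cancel_epi ((D.restrComp r p).hom.app X)]
  simp only [Functor.map_comp, Category.assoc, Iso.hom_inv_id_app_assoc] at h2 ⊢
  have n1 := (D.restrComp r p).hom.naturality η
  have n2 := (D.cell ρ.hom).naturality η
  have n3 := (D.restrComp Φ r').hom.naturality η
  dsimp at n1 n2 n3
  rw [← reassoc_of% n1, ← h2, ← reassoc_of% n3, ← reassoc_of% n2]

/-- Couniversality for a slice square is inherited along the restriction functor `Φ` between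
slices which is induced by a square `α`. -/
theorem isCouniversal_hpaste (α : p ≫ u ⟶ q ≫ v) {Φ : S ⟶ T} [Φ.toFunctor.IsLeftAdjoint]
    {r : S ⟶ A} {r' : T ⟶ B'} {s : T ⟶ pt} {b : pt ⟶ B} {c : pt ⟶ C}
    (κ : (Φ ≫ s) ≫ b ⟶ r ≫ p) (κ' : s ≫ c ⟶ r' ≫ v) (ρ : r ≫ q ≅ Φ ≫ r') (ι : c ≅ b ≫ u)
    (h : (Φ ≫ s) ◁ ι.hom ≫ hpaste α κ = restrictSquare Φ κ' ≫ ρ.inv ▷ v) {X : D.dia B'}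
    {U : D.dia C} {ξ : (D.restr v).obj U ⟶ X}
    (hξ : (D.restr s).IsCouniversal ((D.square κ').app U ≫ (D.restr r').map ξ)) :
    (D.restr (Φ ≫ s)).IsCouniversal ((D.square κ).app ((D.restr u).obj U) ≫
      (D.restr r).map ((D.square α).app U ≫ (D.restr q).map ξ)) := by
  have h1 := ((IsCouniversal.restr Φ hξ).postcomp ((D.restrComp Φ r').inv.app X ≫
    (D.cell ρ.inv).app X ≫ (D.restrComp r q).hom.app X)).precomp
      ((D.restrComp b u).inv.app U ≫ (D.cell ι.inv).app U)
  refine h1.congr ?_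
  have h2 := D.square_hpaste_app α κ U
  have h3 := NatTrans.congr_app (congrArg D.square h) U
  rw [square_whiskerLeft_comp_app, square_comp_whiskerRight_app] at h3
  have h4 := D.square_restrictSquare_app Φ κ' U
  have h5 : (D.square (hpaste α κ)).app U = (D.restr (Φ ≫ s)).map ((D.cell ι.inv).app U) ≫
      (D.restrComp Φ s).hom.app _ ≫ (D.restr Φ).map ((D.square κ').app U) ≫
        (D.restrComp Φ r').inv.app _ ≫ (D.cell ρ.inv).app ((D.restr v).obj U) := by
    rw [← reassoc_of% h4, Iso.hom_inv_id_app_assoc, ← h3, ← Functor.map_comp_assoc,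
      cell_inv_hom_app]
    simp
  rw [h5] at h2
  have n1 := (D.restrComp r q).hom.naturality ξ
  have n2 := (D.cell ρ.inv).naturality ξ
  have n3 := (D.restrComp Φ r').inv.naturality ξ
  dsimp at n1 n2 n3
  rw [← cancel_epi ((D.restr (Φ ≫ s)).map ((D.restrComp b u).hom.app U))]
  simp only [Functor.map_comp, Category.assoc] at h2 ⊢
  rw [← reassoc_of% h2, ← Functor.map_comp_assoc _ ((D.restrComp b u).hom.app U),
    Iso.hom_inv_id_app, CategoryTheory.Functor.map_id, Category.id_comp, ← n1, ← reassoc_of% n2,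
    ← reassoc_of% n3]

namespace IsDerivator

variable {D} (hD : D.IsDerivator)
include hD

/-- A square in which initial factorizations exist is homotopy exact: left Kan extensions satisfy
base change along it. -/
theorem preservesUniversal_square {α : p ≫ u ⟶ q ≫ v} (h : InitialFactorization α) :
    PreservesUniversal (D.square α) := by
  intro X U η hη
  refine hD.isUniversal_of_points q _ fun b => ?_
  have : (commaMapLeft α b).toCatHom.toFunctor.IsRightAdjoint := isRightAdjoint_commaMapLeft h b
  exact D.isUniversal_vpaste α (Φ := (commaMapLeft α b).toCatHom) (b := point b)
    (commaCellLeft q b)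
    (commaCellLeft u (v.toFunctor.obj b)) (Iso.refl _)
    (Cat.Hom.isoMk (NatIso.ofComponents (fun _ => Iso.refl (v.toFunctor.obj b)) fun _ =>
      (by simp : v.toFunctor.map (𝟙 b) ≫ 𝟙 _ = 𝟙 _ ≫ 𝟙 _)))
    (Cat.Hom₂.ext <| NatTrans.ext <| funext fun Y =>
      (by simp : (𝟙 _ ≫ α.toNatTrans.app Y.left ≫ 𝟙 _ ≫ v.toFunctor.map Y.hom ≫ 𝟙 _) ≫ 𝟙 _ =
        u.toFunctor.map (𝟙 _) ≫ 𝟙 _ ≫ (α.toNatTrans.app Y.left ≫ v.toFunctor.map Y.hom) ≫ 𝟙 _))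
    (hD.preservesUniversal_comma u (v.toFunctor.obj b) η hη)

/-- A square in which terminal factorizations exist is homotopy exact: right Kan extensions
satisfy base change along it. -/
theorem preservesCouniversal_square {α : p ≫ u ⟶ q ≫ v} (h : TerminalFactorization α) :
    PreservesCouniversal (D.square α) := by
  intro X U ξ hξ
  refine hD.isCouniversal_of_points p _ fun x => ?_
  have : (commaMapRight α x).toCatHom.toFunctor.IsLeftAdjoint := isLeftAdjoint_commaMapRight h x
  exact D.isCouniversal_hpaste α (Φ := (commaMapRight α x).toCatHom) (b := point x)
    (commaCellRight p x)
    (commaCellRight v (u.toFunctor.obj x)) (Iso.refl _)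
    (Cat.Hom.isoMk (NatIso.ofComponents (fun _ => Iso.refl (u.toFunctor.obj x)) fun _ =>
      (by simp : 𝟙 _ ≫ 𝟙 _ = 𝟙 _ ≫ u.toFunctor.map (𝟙 x))))
    (Cat.Hom₂.ext <| NatTrans.ext <| funext fun Y =>
      (by simp : 𝟙 _ ≫ 𝟙 _ ≫ u.toFunctor.map Y.hom ≫ 𝟙 _ ≫ α.toNatTrans.app Y.right ≫ 𝟙 _ =
        (𝟙 _ ≫ (u.toFunctor.map Y.hom ≫ α.toNatTrans.app Y.right) ≫ 𝟙 _) ≫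
          v.toFunctor.map (𝟙 _)))
    (hD.preservesCouniversal_comma v (u.toFunctor.obj x) ξ hξ)

end IsDerivator

end
end Prederivator

/-! ### Exponentials of derivators -/

namespace Prederivator

open Functor

section

variable {A B C B' S : Cat.{w, w}} {p : A ⟶ B} {u : B ⟶ C} {q : A ⟶ B'} {v : B' ⟶ C}

/-- The product of a square with `S`. -/
def prodSquare (S : Cat.{w, w}) (α : p ≫ u ⟶ q ≫ v) :
    prodMap (𝟙 S) p ≫ prodMap (𝟙 S) u ⟶ prodMap (𝟙 S) q ≫ prodMap (𝟙 S) v :=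
  NatTrans.toCatHom₂
    { app x := ((𝟙 x.1, α.toNatTrans.app x.2) : (x.1, _) ⟶ (x.1, _))
      naturality x y f := Prod.ext (by simp : f.1 ≫ 𝟙 _ = 𝟙 _ ≫ f.1)
        (naturality_of_cell α f.2) }

theorem InitialFactorization.prodSquare {α : p ≫ u ⟶ q ≫ v} (h : InitialFactorization α) :
    InitialFactorization (prodSquare S α) := by
  rintro ⟨s, x⟩ ⟨t, b⟩ ⟨g₁, g₂⟩
  obtain ⟨a, m, k, hk, H⟩ := h x b g₂
  refine ⟨(s, a), (𝟙 s, m), (g₁, k), Prod.ext (by simp : 𝟙 _ ≫ 𝟙 _ ≫ g₁ = g₁) hk, ?_⟩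
  rintro ⟨s', a'⟩ ⟨m₁, m₂⟩ ⟨k₁, k₂⟩ e
  obtain ⟨t, ht, ht'⟩ := H a' m₂ k₂ (congrArg Prod.snd e)
  have e₁ : m₁ ≫ 𝟙 _ ≫ k₁ = g₁ := congrArg Prod.fst e
  refine ⟨(m₁, t), ⟨Prod.ext (Category.id_comp _) ht.1,
    Prod.ext (by simpa using e₁ : m₁ ≫ k₁ = g₁) ht.2⟩, ?_⟩
  rintro ⟨t₁, t₂⟩ ⟨h₁, h₂⟩
  exact Prod.ext ((Category.id_comp t₁).symm.trans (congrArg Prod.fst h₁))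
    (ht' t₂ ⟨congrArg Prod.snd h₁, congrArg Prod.snd h₂⟩)

theorem TerminalFactorization.prodSquare {α : p ≫ u ⟶ q ≫ v} (h : TerminalFactorization α) :
    TerminalFactorization (prodSquare S α) := by
  rintro ⟨s, x⟩ ⟨t, b⟩ ⟨g₁, g₂⟩
  obtain ⟨a, m, k, hk, H⟩ := h x b g₂
  refine ⟨(t, a), (g₁, m), (𝟙 t, k), Prod.ext (by simp : g₁ ≫ 𝟙 _ ≫ 𝟙 _ = g₁) hk, ?_⟩
  rintro ⟨s', a'⟩ ⟨m₁, m₂⟩ ⟨k₁, k₂⟩ e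
  obtain ⟨t, ht, ht'⟩ := H a' m₂ k₂ (congrArg Prod.snd e)
  have e₁ : m₁ ≫ 𝟙 _ ≫ k₁ = g₁ := congrArg Prod.fst e
  refine ⟨(k₁, t), ⟨Prod.ext (by simpa using e₁ : m₁ ≫ k₁ = g₁) ht.1,
    Prod.ext (Category.comp_id _) ht.2⟩, ?_⟩
  rintro ⟨t₁, t₂⟩ ⟨h₁, h₂⟩
  exact Prod.ext ((Category.comp_id t₁).symm.trans (congrArg Prod.fst h₂))
    (ht' t₂ ⟨congrArg Prod.snd h₁, congrArg Prod.snd h₂⟩)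

theorem initialFactorization_commaCellLeft (u : A ⟶ B) (b : B) :
    InitialFactorization (commaCellLeft u b) := by
  rintro (x : A) ⟨⟨⟩⟩ (g : u.toFunctor.obj x ⟶ b)
  refine ⟨⟨x, ⟨⟨⟩⟩, g⟩, 𝟙 _, 𝟙 _, (by simp : u.toFunctor.map (𝟙 x) ≫ g ≫ 𝟙 b = g),
    fun a' m' h' e => ?_⟩
  have e' : u.toFunctor.map m' ≫ a'.hom ≫ 𝟙 b = g := e
  exact ⟨⟨m', eqToHom (Subsingleton.elim (α := Discrete PUnit) _ _),
      (by simpa using e' : u.toFunctor.map m' ≫ a'.hom = g ≫ 𝟙 b)⟩,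
    ⟨Category.id_comp _, Subsingleton.elim (α := (_ : Discrete PUnit) ⟶ _) _ _⟩,
    fun t ht => CommaMorphism.ext ((Category.id_comp _).symm.trans ht.1)
      (Subsingleton.elim (α := (_ : Discrete PUnit) ⟶ _) _ _)⟩

theorem terminalFactorization_commaCellRight (u : A ⟶ B) (b : B) :
    TerminalFactorization (commaCellRight u b) := by
  rintro ⟨⟨⟩⟩ (x : A) (g : b ⟶ u.toFunctor.obj x)
  refine ⟨⟨⟨⟨⟩⟩, x, g⟩, 𝟙 _, 𝟙 _, (by simp : 𝟙 b ≫ g ≫ u.toFunctor.map (𝟙 x) = g),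
    fun a' m' h' e => ?_⟩
  have e' : 𝟙 b ≫ a'.hom ≫ u.toFunctor.map h' = g := e
  exact ⟨⟨eqToHom (Subsingleton.elim (α := Discrete PUnit) _ _), h',
      (by simpa using e'.symm : 𝟙 b ≫ g = a'.hom ≫ u.toFunctor.map h')⟩,
    ⟨Subsingleton.elim (α := (_ : Discrete PUnit) ⟶ _) _ _, Category.comp_id _⟩,
    fun t ht => CommaMorphism.ext (Subsingleton.elim (α := (_ : Discrete PUnit) ⟶ _) _ _)
      ((Category.comp_id _).symm.trans ht.2)⟩

/-- The functor `S × -` preserves composition. -/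
def prodComp (S : Cat.{w, w}) (p : A ⟶ B) (u : B ⟶ C) :
    prodMap (𝟙 S) (p ≫ u) ≅ prodMap (𝟙 S) p ≫ prodMap (𝟙 S) u :=
  Cat.Hom.isoMk (Iso.refl _)

/-- The product of a natural transformation with `S`. -/
def prodCell (S : Cat.{w, w}) {p p' : A ⟶ B} (α : p ⟶ p') :
    prodMap (𝟙 S) p ⟶ prodMap (𝟙 S) p' :=
  NatTrans.toCatHom₂ (NatTrans.prod (𝟙 (𝟭 S)) α.toNatTrans)

variable (D : Prederivator.{w, v, u})

theorem square_prodSquare_app (S : Cat.{w, w}) (α : p ≫ u ⟶ q ≫ v) (X : D.dia (prod S C)) :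
    (D.square (prodSquare S α)).app X = ((D.restrComp _ _).inv.app X ≫
      (D.cell (prodComp S p u).inv).app X) ≫ (D.cell (prodCell S α)).app X ≫
        (D.cell (prodComp S q v).hom).app X ≫ (D.restrComp _ _).hom.app X := by
  have h : prodSquare S α = (prodComp S p u).inv ≫ prodCell S α ≫ (prodComp S q v).hom :=
    Cat.Hom₂.ext <| NatTrans.ext <| funext fun x => Prod.ext
      (by simp : 𝟙 x.1 = 𝟙 _ ≫ 𝟙 _ ≫ 𝟙 _)
      (by simp : α.toNatTrans.app x.2 = 𝟙 _ ≫ α.toNatTrans.app x.2 ≫ 𝟙 _)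
  rw [h, square_app, cell_comp, cell_comp]
  simp only [NatTrans.comp_app, Category.assoc]

/-- The squares of `D^S` are the squares of `D` which are multiplied with `S`. In this way base
change for `D^S` is reduced to base change for `D`. -/
theorem square_exp (S : Cat.{w, w}) (α : p ≫ u ⟶ q ≫ v) :
    (exp S D).square α = D.square (prodSquare S α) := by
  ext X
  exact (D.square_prodSquare_app S α X).symm

theorem preservesUniversal_exp {S : Cat.{w, w}} {α : p ≫ u ⟶ q ≫ v}
    (h : PreservesUniversal (D.square (prodSquare S α))) :
    PreservesUniversal ((exp S D).square α) := by
  rw [square_exp]; exact h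

theorem preservesCouniversal_exp {S : Cat.{w, w}} {α : p ≫ u ⟶ q ≫ v}
    (h : PreservesCouniversal (D.square (prodSquare S α))) :
    PreservesCouniversal ((exp S D).square α) := by
  rw [square_exp]; exact h

/-- Restriction along isomorphic functors. -/
def restrIso {f : A ⟶ B} {g : B ⟶ C} {k : A ⟶ C}
    (e : f.toFunctor ⋙ g.toFunctor ≅ k.toFunctor) : D.restr g ⋙ D.restr f ≅ D.restr k :=
  (D.restrComp f g).symm ≪≫ D.cellIso (Cat.Hom.isoMk e)

theorem isEquivalence_restr (f : A ⟶ B) [f.toFunctor.IsEquivalence] :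
    (D.restr f).IsEquivalence :=
  (CategoryTheory.Equivalence.mk (D.restr f) (D.restr f.toFunctor.inv.toCatHom)
    ((D.restrIso (f := f.toFunctor.inv.toCatHom) (g := f) (k := 𝟙 B)
      f.toFunctor.asEquivalence.counitIso) ≪≫ D.restrId B).symm
    (D.restrIso (f := f) (g := f.toFunctor.inv.toCatHom) (k := 𝟙 A)
      f.toFunctor.asEquivalence.unitIso.symm ≪≫ D.restrId A)).isEquivalence_functor

/-- The equivalence between `∐ S × B_i` and `S × ∐ B_i`. -/
def sigmaProd (S : Cat.{w, w}) {I : Type w} (B : I → Cat.{w, w}) :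
    Cat.of (Σ i, prod S (B i)) ⟶ prod S (Cat.of (Σ i, B i)) :=
  (Sigma.desc fun i => (𝟭 S).prod (Sigma.incl (C := fun i => (B i : Type w)) i)).toCatHom

theorem exists_sigmaProd_map_eq (S : Cat.{w, w}) {I : Type w} (B : I → Cat.{w, w})
    {x y : Σ i, (B i : Type w)} (g : x ⟶ y) {s s' : S} (f : s ⟶ s') :
    ∃ h : (⟨x.1, (s, x.2)⟩ : Σ i, (prod S (B i) : Type w)) ⟶ ⟨y.1, (s', y.2)⟩,
      (sigmaProd S B).toFunctor.map h = ((f, g) : (s, x) ⟶ (s', y)) := by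
  obtain ⟨g⟩ := g
  exact ⟨Sigma.SigmaHom.mk (f, g), rfl⟩

instance (S : Cat.{w, w}) {I : Type w} (B : I → Cat.{w, w}) :
    (sigmaProd S B).toFunctor.IsEquivalence where
  faithful := ⟨by
    rintro ⟨i, s, b⟩ ⟨j, s', b'⟩ ⟨f⟩ ⟨g⟩ h
    have h1 : f.1 = g.1 := congrArg (fun t => t.1) h
    have h2 : Sigma.SigmaHom.mk (C := fun i => (B i : Type w)) f.2 =
        Sigma.SigmaHom.mk (C := fun i => (B i : Type w)) g.2 := congrArg (fun t => t.2) h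
    rw [Sigma.SigmaHom.mk.injEq] at h2
    exact congrArg Sigma.SigmaHom.mk (Prod.ext h1 (by simpa using h2))⟩
  full := ⟨fun {x y} f => exists_sigmaProd_map_eq S B (x := ⟨x.1, x.2.2⟩) (y := ⟨y.1, y.2.2⟩)
    f.2 f.1⟩
  essSurj := ⟨fun ⟨s, i, b⟩ => ⟨⟨i, s, b⟩, ⟨Iso.refl _⟩⟩⟩

namespace IsDerivator

variable {D} (hD : D.IsDerivator)
include hD

theorem exp (S : Cat.{w, w}) : (Prederivator.exp S D).IsDerivator where
  der1 I B := by
    have h1 := hD.der1 I fun i => prod S (B i)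
    have h2 := D.isEquivalence_restr (sigmaProd S B)
    have h3 := isEquivalence_trans (D.restr (sigmaProd S B)) (pi' fun i => D.restr
      (A := prod S (B i)) (B := Cat.of (Σ i, prod S (B i)))
      (Sigma.incl (C := fun i => (prod S (B i) : Type w)) i).toCatHom)
    exact isEquivalence_of_iso (F := D.restr (sigmaProd S B) ⋙ pi' fun i => D.restr
      (A := prod S (B i)) (B := Cat.of (Σ i, prod S (B i)))
      (Sigma.incl (C := fun i => (prod S (B i) : Type w)) i).toCatHom)
      (NatIso.pi' fun i => D.restrIso
      (f := (Sigma.incl (C := fun i => (prod S (B i) : Type w)) i).toCatHom) (g := sigmaProd S B)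
      (k := prodMap (𝟙 S) (Sigma.incl (C := fun i => (B i : Type w)) i).toCatHom)
      (Sigma.inclDesc (fun i => (𝟭 S).prod (Sigma.incl (C := fun i => (B i : Type w)) i)) i))
  der2 B X Y f := by
    refine ⟨fun _ _ => inferInstance, fun h => hD.isIso_of_points _ fun ⟨s, b⟩ => ?_⟩
    have : IsIso ((D.restr (prodMap (𝟙 S) (point b))).map f) := h b
    have h1 : IsIso ((D.restr (point (A := prod S pt) (s, ⟨⟨⟩⟩))).map
      ((D.restr (prodMap (𝟙 S) (point b))).map f)) := map_isIso _ _
    exact (NatIso.isIso_map_iff (D.restrIso (f := point (A := prod S pt) (s, ⟨⟨⟩⟩))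
      (g := prodMap (𝟙 S) (point b)) (k := point (A := prod S B) (s, b))
      (NatIso.ofComponents (fun _ => Iso.refl ((s, b) : S × B)) fun _ => Prod.ext
        (by simp : 𝟙 s ≫ 𝟙 s = 𝟙 s ≫ 𝟙 s) (by simp : 𝟙 b ≫ 𝟙 b = 𝟙 b ≫ 𝟙 b))) f).1 h1
  der3_left u := hD.der3_left _
  der3_right u := hD.der3_right _
  der4_left u b L₁ adj₁ L₂ adj₂ := by
    refine (isIso_mateEquiv_symm_iff adj₁ adj₂ _).2 ?_
    exact D.preservesUniversal_exp <| hD.preservesUniversal_square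
      (initialFactorization_commaCellLeft u b).prodSquare
  der4_right u b R₁ adj₁ R₂ adj₂ := by
    refine (isIso_mateEquiv_iff adj₁ adj₂ _).2 ?_
    exact D.preservesCouniversal_exp <| hD.preservesCouniversal_square
      (terminalFactorization_commaCellRight u b).prodSquare

end IsDerivator

end
end Prederivator

/-! ### Morphisms of prederivators -/

namespace CategoryTheory.Functor

section

variable {C₁ : Type u₁} {C₂ : Type u₂} {D₁ : Type u₁} {D₂ : Type u₂} [Category.{v₁} C₁]
  [Category.{v₂} C₂] [Category.{v₁} D₁] [Category.{v₂} D₂]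

theorem isUniversal_iff_of_isEquivalence {R : D₁ ⥤ C₁} {R' : D₂ ⥤ C₂} {G : C₁ ⥤ C₂} {H : D₁ ⥤ D₂}
    [G.IsEquivalence] [H.IsEquivalence] (n : R ⋙ G ≅ H ⋙ R') {X : C₁} {U : D₁}
    (η : X ⟶ R.obj U) : R'.IsUniversal (G.map η ≫ n.hom.app U) ↔ R.IsUniversal η := by
  have key (Z : D₁) : Function.Bijective (fun g : U ⟶ Z => η ≫ R.map g) ↔
      Function.Bijective fun g : H.obj U ⟶ H.obj Z => (G.map η ≫ n.hom.app U) ≫ R'.map g := by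
    rw [← Function.Bijective.of_comp_iff _ (FullyFaithful.ofFullyFaithful H).homEquiv.bijective,
      ← Function.Bijective.of_comp_iff' ((FullyFaithful.ofFullyFaithful G).homEquiv.trans
        (n.app Z).homToEquiv).bijective]
    refine iff_of_eq (congrArg _ (funext fun g => ?_))
    have := congrArg (fun t => G.map η ≫ t) (n.hom.naturality g)
    simpa [FullyFaithful.homEquiv, Iso.homToEquiv] using this
  refine ⟨fun h Z => (key Z).2 (h _), fun h Z => ?_⟩
  have h1 := (key (H.objPreimage Z)).1 (h _)
  let e := H.objObjPreimageIso Z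
  have h2 := ((R'.mapIso e).homToEquiv.bijective.comp h1).comp e.homToEquiv.symm.bijective
  convert h2 using 2 with g
  simp [Iso.homToEquiv]

theorem isCouniversal_iff_of_isEquivalence {R : D₁ ⥤ C₁} {R' : D₂ ⥤ C₂} {G : C₁ ⥤ C₂}
    {H : D₁ ⥤ D₂} [G.IsEquivalence] [H.IsEquivalence] (n : R ⋙ G ≅ H ⋙ R') {X : C₁} {U : D₁}
    (ξ : R.obj U ⟶ X) : R'.IsCouniversal (n.inv.app U ≫ G.map ξ) ↔ R.IsCouniversal ξ := by
  have key (Z : D₁) : Function.Bijective (fun g : Z ⟶ U => R.map g ≫ ξ) ↔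
      Function.Bijective fun g : H.obj Z ⟶ H.obj U => R'.map g ≫ n.inv.app U ≫ G.map ξ := by
    rw [← Function.Bijective.of_comp_iff _ (FullyFaithful.ofFullyFaithful H).homEquiv.bijective,
      ← Function.Bijective.of_comp_iff' ((FullyFaithful.ofFullyFaithful G).homEquiv.trans
        (n.app Z).homFromEquiv).bijective]
    refine iff_of_eq (congrArg _ (funext fun g => ?_))
    have := n.inv.naturality_assoc g (G.map ξ)
    simpa [FullyFaithful.homEquiv, Iso.homFromEquiv] using this.symm
  refine ⟨fun h Z => (key Z).2 (h _), fun h Z => ?_⟩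
  have h1 := (key (H.objPreimage Z)).1 (h _)
  let e := H.objObjPreimageIso Z
  have h2 := ((R'.mapIso e).homFromEquiv.bijective.comp h1).comp e.homFromEquiv.symm.bijective
  convert h2 using 2 with g
  simp [Iso.homFromEquiv]

end

end CategoryTheory.Functor

namespace Prederivator

open Functor

section

variable {P Q : Prederivator.{w, v, u}} (F : P ⟶ Q) {A B C B' : Cat.{w, w}}

/-- The components of a morphism of prederivators. -/
abbrev level (A : Cat.{w, w}) : P.dia A ⥤ Q.dia A := (F.app (op A)).toFunctor

/-- The isomorphism `F u^* ≅ u^* F`. -/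
def commRestr (u : A ⟶ B) : P.restr u ⋙ level F A ≅ level F B ⋙ Q.restr u :=
  Cat.Hom.toNatIso (F.naturality u.op)

theorem cell_commRestr {f g : A ⟶ B} (α : f ⟶ g) (X : P.dia B) :
    (level F A).map ((P.cell α).app X) ≫ (commRestr F g).hom.app X =
      (commRestr F f).hom.app X ≫ (Q.cell α).app ((level F B).obj X) :=
  app_congr (F.naturality_naturality (Bicategory.Opposite.op2 α)) X

theorem restrComp_commRestr (p : A ⟶ B) (u : B ⟶ C) (X : P.dia C) :
    (commRestr F (p ≫ u)).hom.app X ≫ (Q.restrComp p u).hom.app ((level F C).obj X) =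
      (level F A).map ((P.restrComp p u).hom.app X) ≫
        (commRestr F p).hom.app ((P.restr u).obj X) ≫
          (Q.restr p).map ((commRestr F u).hom.app X) := by
  have h : (commRestr F (p ≫ u)).hom.app X ≫ (Q.restrComp p u).hom.app ((level F C).obj X) =
      (level F A).map ((P.restrComp p u).hom.app X) ≫ 𝟙 _ ≫
        (commRestr F p).hom.app ((P.restr u).obj X) ≫ 𝟙 _ ≫
          (Q.restr p).map ((commRestr F u).hom.app X) ≫ 𝟙 _ :=
    app_congr (F.naturality_comp u.op p.op) X
  simpa using h

theorem square_commRestr {p : A ⟶ B} {u : B ⟶ C} {q : A ⟶ B'} {v : B' ⟶ C}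
    (α : p ≫ u ⟶ q ≫ v) (X : P.dia C) :
    (level F A).map ((P.square α).app X) ≫ (commRestr F q).hom.app ((P.restr v).obj X) ≫
        (Q.restr q).map ((commRestr F v).hom.app X) =
      (commRestr F p).hom.app ((P.restr u).obj X) ≫ (Q.restr p).map ((commRestr F u).hom.app X) ≫
        (Q.square α).app ((level F C).obj X) := by
  simp only [square_app, Functor.map_comp, Category.assoc]
  rw [← restrComp_commRestr, reassoc_of% cell_commRestr F α,
    ← cancel_epi ((level F A).map ((P.restrComp p u).hom.app X)), ← Functor.map_comp_assoc,
    Iso.hom_inv_id_app, CategoryTheory.Functor.map_id, Category.id_comp,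
    ← reassoc_of% restrComp_commRestr F p u X, Iso.hom_inv_id_app_assoc]

variable [∀ A, (level F A).IsEquivalence]
include F

theorem preservesUniversal_of_isEquivalence {p : A ⟶ B} {u : B ⟶ C} {q : A ⟶ B'} {v : B' ⟶ C}
    {α : p ≫ u ⟶ q ≫ v} (h : PreservesUniversal (Q.square α)) :
    PreservesUniversal (P.square α) := fun X U η hη => by
  have h1 := h _ ((isUniversal_iff_of_isEquivalence (commRestr F u) η).2 hη)
  refine (isUniversal_iff_of_isEquivalence (commRestr F q) _).1 ?_
  refine ((h1.precomp ((commRestr F p).hom.app X)).postcomp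
    ((commRestr F v).inv.app U)).congr ?_
  have h2 := square_commRestr F α U
  have h3 := (commRestr F p).hom.naturality η
  dsimp at h3
  rw [← cancel_mono ((Q.restr q).map ((commRestr F v).hom.app U))]
  simp only [Functor.map_comp, Category.assoc]
  rw [h2, ← reassoc_of% h3, ← Functor.map_comp, Iso.inv_hom_id_app]
  simp

theorem preservesCouniversal_of_isEquivalence {p : A ⟶ B} {u : B ⟶ C} {q : A ⟶ B'} {v : B' ⟶ C}
    {α : p ≫ u ⟶ q ≫ v} (h : PreservesCouniversal (Q.square α)) :
    PreservesCouniversal (P.square α) := fun X U ξ hξ => by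
  have h1 := h _ ((isCouniversal_iff_of_isEquivalence (commRestr F v) ξ).2 hξ)
  refine (isCouniversal_iff_of_isEquivalence (commRestr F p) _).1 ?_
  refine ((h1.postcomp ((commRestr F q).inv.app X)).precomp
    ((commRestr F u).hom.app U)).congr ?_
  have h2 := square_commRestr F α U
  have h3 := (commRestr F q).inv.naturality ξ
  dsimp at h3
  rw [← cancel_epi ((commRestr F p).hom.app ((P.restr u).obj U)), Iso.hom_inv_id_app_assoc]
  simp only [Functor.map_comp, Category.assoc]
  rw [← reassoc_of% h2, ← Functor.map_comp_assoc _ ((commRestr F v).hom.app U),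
    Iso.hom_inv_id_app, CategoryTheory.Functor.map_id, Category.id_comp, h3,
    Iso.hom_inv_id_app_assoc]

theorem isRightAdjoint_restr_of_isEquivalence (u : A ⟶ B) [(Q.restr u).IsRightAdjoint] :
    (P.restr u).IsRightAdjoint := by
  have : (P.restr u ⋙ level F A).IsRightAdjoint :=
    isRightAdjoint_of_iso (commRestr F u).symm
  exact isRightAdjoint_of_iso (isoWhiskerLeft (P.restr u)
    (level F A).asEquivalence.unitIso.symm ≪≫ rightUnitor _ :
      (P.restr u ⋙ level F A) ⋙ (level F A).inv ≅ P.restr u)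

theorem isLeftAdjoint_restr_of_isEquivalence (u : A ⟶ B) [(Q.restr u).IsLeftAdjoint] :
    (P.restr u).IsLeftAdjoint := by
  have : (P.restr u ⋙ level F A).IsLeftAdjoint :=
    isLeftAdjoint_of_iso (commRestr F u).symm
  exact isLeftAdjoint_of_iso (isoWhiskerLeft (P.restr u)
    (level F A).asEquivalence.unitIso.symm ≪≫ rightUnitor _ :
      (P.restr u ⋙ level F A) ⋙ (level F A).inv ≅ P.restr u)

/-- A prederivator which is levelwise equivalent to a derivator is a derivator. -/
theorem IsDerivator.of_isEquivalence (hQ : Q.IsDerivator) : P.IsDerivator where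
  der1 I B := by
    have h1 := hQ.der1 I B
    let U (i : I) : P.dia (Cat.of (Σ i, B i)) ⥤ P.dia (B i) :=
      P.restr (A := B i) (B := Cat.of (Σ i, B i))
        (Sigma.incl (C := fun i => (B i : Type w)) i).toCatHom
    let V (i : I) : Q.dia (Cat.of (Σ i, B i)) ⥤ Q.dia (B i) :=
      Q.restr (A := B i) (B := Cat.of (Σ i, B i))
        (Sigma.incl (C := fun i => (B i : Type w)) i).toCatHom
    have h2 : (level F (Cat.of (Σ i, B i)) ⋙ pi' V).IsEquivalence := isEquivalence_trans _ _
    have h3 : (pi' U ⋙ Functor.pi fun i => level F (B i)).IsEquivalence :=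
      isEquivalence_of_iso (F := level F (Cat.of (Σ i, B i)) ⋙ pi' V) (NatIso.pi' fun i =>
        (commRestr F (A := B i) (B := Cat.of (Σ i, B i))
          (Sigma.incl (C := fun i => (B i : Type w)) i).toCatHom).symm)
    have h4 : (Functor.pi fun i => level F (B i)).IsEquivalence :=
      (Equivalence.pi fun i => (level F (B i)).asEquivalence).isEquivalence_functor
    exact isEquivalence_of_comp_right (pi' U) (Functor.pi fun i => level F (B i))
  der2 B X Y f := by
    rw [← isIso_iff_of_reflects_iso f (level F B), hQ.der2]
    refine forall_congr' fun b => ?_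
    rw [← isIso_iff_of_reflects_iso _ (level F pt)]
    exact (NatIso.isIso_map_iff (commRestr F (point b)) f).symm
  der3_left u := by
    have := hQ.der3_left u
    exact isRightAdjoint_restr_of_isEquivalence F u
  der3_right u := by
    have := hQ.der3_right u
    exact isLeftAdjoint_restr_of_isEquivalence F u
  der4_left u b L₁ adj₁ L₂ adj₂ := (isIso_mateEquiv_symm_iff adj₁ adj₂ _).2
    (preservesUniversal_of_isEquivalence F (hQ.preservesUniversal_comma u b))
  der4_right u b R₁ adj₁ R₂ adj₂ := (isIso_mateEquiv_iff adj₁ adj₂ _).2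
    (preservesCouniversal_of_isEquivalence F (hQ.preservesCouniversal_comma u b))

end
end Prederivator

/-! ### Kan extensions along fully faithful functors -/

namespace CategoryTheory.Functor

section

variable {C : Type u₁} {C' : Type u₂} [Category.{v₁} C] [Category.{v₂} C'] {R : C ⥤ C'}

theorem IsUniversal.isIso_of_isEquivalence [R.IsEquivalence] {X : C'} {U : C} {η : X ⟶ R.obj U}
    (h : R.IsUniversal η) : IsIso η := by
  have h1 : R.IsUniversal (R.objObjPreimageIso X).inv := fun Z => by
    convert ((R.objObjPreimageIso X).homFromEquiv.bijective.comp
      (FullyFaithful.ofFullyFaithful R).homEquiv.bijective) using 2 with g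
    simp [Iso.homFromEquiv, FullyFaithful.homEquiv]
  obtain ⟨c, hc⟩ := (h1 U).2 η
  dsimp only at hc
  have := (h1.isIso_iff c hc).2 h
  rw [← hc]
  infer_instance

theorem IsCouniversal.isIso_of_isEquivalence [R.IsEquivalence] {X : C'} {U : C} {ξ : R.obj U ⟶ X}
    (h : R.IsCouniversal ξ) : IsIso ξ := by
  have h1 : R.IsCouniversal (R.objObjPreimageIso X).hom := fun Z => by
    convert ((R.objObjPreimageIso X).homToEquiv.bijective.comp
      (FullyFaithful.ofFullyFaithful R).homEquiv.bijective) using 2 with g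
    simp [Iso.homToEquiv, FullyFaithful.homEquiv]
  obtain ⟨c, hc⟩ := (h1 U).2 ξ
  dsimp only at hc
  have := (h1.isIso_iff c hc).2 h
  rw [← hc]
  infer_instance

theorem IsUniversal.isIso_of_isUniversal {X : C'} {U V : C} {η : X ⟶ R.obj U} {θ : X ⟶ R.obj V}
    (h : R.IsUniversal η) (h' : R.IsUniversal θ) : ∃ e : U ≅ V, η ≫ R.map e.hom = θ := by
  obtain ⟨c, hc⟩ := (h V).2 θ
  have := (h.isIso_iff c hc).2 h'
  exact ⟨asIso c, hc⟩

theorem IsCouniversal.isIso_of_isCouniversal {X : C'} {U V : C} {η : R.obj U ⟶ X}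
    {θ : R.obj V ⟶ X} (h : R.IsCouniversal η) (h' : R.IsCouniversal θ) :
    ∃ e : V ≅ U, R.map e.hom ≫ η = θ := by
  obtain ⟨c, hc⟩ := (h V).2 θ
  have := (h.isIso_iff c hc).2 h'
  exact ⟨asIso c, hc⟩

theorem LeftExtended.natIso {R' : C ⥤ C'} (i : R ≅ R') {U : C} (h : R.LeftExtended U) :
    R'.LeftExtended U :=
  ((h.isUniversal (𝟙 _)).natIso i).leftExtended

theorem RightExtended.natIso {R' : C ⥤ C'} (i : R ≅ R') {U : C} (h : R.RightExtended U) :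
    R'.RightExtended U :=
  ((h.isCouniversal (𝟙 _)).natIso i.symm).rightExtended

end

end CategoryTheory.Functor

namespace Prederivator

open Functor

section

variable {D : Prederivator.{w, v, u}} {A B C B' : Cat.{w, w}} {p : A ⟶ B} {u : B ⟶ C} {q : A ⟶ B'}
  {v : B' ⟶ C}

theorem isEquivalence_restr_id (D : Prederivator.{w, v, u}) (A : Cat.{w, w}) :
    (D.restr (𝟙 A)).IsEquivalence :=
  isEquivalence_of_iso (D.restrId A).symm

namespace IsDerivator

variable (hD : D.IsDerivator)
include hD

/-- The unit of a left Kan extension along a fully faithful functor is invertible. -/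
theorem isIso_of_isUniversal (u : A ⟶ B) [u.toFunctor.Full] [u.toFunctor.Faithful] {X : D.dia A}
    {U : D.dia B} {η : X ⟶ (D.restr u).obj U} (h : (D.restr u).IsUniversal η) : IsIso η := by
  have hα : InitialFactorization (p := 𝟙 A) (u := u) (q := 𝟙 A) (v := u) (𝟙 _) := fun x b g => by
    obtain ⟨k, rfl⟩ := u.toFunctor.map_surjective g
    refine ⟨x, 𝟙 x, k, (by simp : u.toFunctor.map (𝟙 x) ≫ 𝟙 _ ≫ u.toFunctor.map k = _), ?_⟩
    intro a' m' h' e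
    have e' : u.toFunctor.map m' ≫ 𝟙 _ ≫ u.toFunctor.map h' = u.toFunctor.map k := e
    refine ⟨m', ⟨Category.id_comp _, u.toFunctor.map_injective ?_⟩,
      fun t ht => (Category.id_comp _).symm.trans ht.1⟩
    simpa using e'
  have := D.isEquivalence_restr_id A
  have h1 := (hD.preservesUniversal_square hα η h).isIso_of_isEquivalence
  have h2 : IsIso ((D.restr (𝟙 A)).map η) := IsIso.of_isIso_comp_right _ ((D.square (𝟙 _)).app U)
  exact isIso_of_reflects_iso η (D.restr (𝟙 A))

/-- The counit of a right Kan extension along a fully faithful functor is invertible. -/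
theorem isIso_of_isCouniversal (u : A ⟶ B) [u.toFunctor.Full] [u.toFunctor.Faithful] {X : D.dia A}
    {U : D.dia B} {ξ : (D.restr u).obj U ⟶ X} (h : (D.restr u).IsCouniversal ξ) : IsIso ξ := by
  have hα : TerminalFactorization (p := 𝟙 A) (u := u) (q := 𝟙 A) (v := u) (𝟙 _) := fun x b g => by
    obtain ⟨k, rfl⟩ := u.toFunctor.map_surjective g
    refine ⟨b, k, 𝟙 b, (by simp : u.toFunctor.map k ≫ 𝟙 _ ≫ u.toFunctor.map (𝟙 b) = _), ?_⟩
    intro a' m' h' e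
    have e' : u.toFunctor.map m' ≫ 𝟙 _ ≫ u.toFunctor.map h' = u.toFunctor.map k := e
    refine ⟨h', ⟨u.toFunctor.map_injective ?_, Category.comp_id _⟩,
      fun t ht => (Category.comp_id _).symm.trans ht.2⟩
    simpa using e'
  have := D.isEquivalence_restr_id A
  have h1 := (hD.preservesCouniversal_square hα ξ h).isIso_of_isEquivalence
  have h2 : IsIso ((D.restr (𝟙 A)).map ξ) := IsIso.of_isIso_comp_left ((D.square (𝟙 _)).app U) _
  exact isIso_of_reflects_iso ξ (D.restr (𝟙 A))

theorem exists_leftExtended (u : A ⟶ B) [u.toFunctor.Full] [u.toFunctor.Faithful] (X : D.dia A) :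
    ∃ U : D.dia B, (D.restr u).LeftExtended U ∧ Nonempty (X ≅ (D.restr u).obj U) := by
  have := hD.der3_left u
  obtain ⟨U, η, h⟩ := exists_isUniversal (R := D.restr u) X
  have := hD.isIso_of_isUniversal u h
  exact ⟨U, h.leftExtended, ⟨asIso η⟩⟩

theorem exists_rightExtended (u : A ⟶ B) [u.toFunctor.Full] [u.toFunctor.Faithful] (X : D.dia A) :
    ∃ U : D.dia B, (D.restr u).RightExtended U ∧ Nonempty (X ≅ (D.restr u).obj U) := by
  have := hD.der3_right u
  obtain ⟨U, ξ, h⟩ := exists_isCouniversal (R := D.restr u) X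
  have := hD.isIso_of_isCouniversal u h
  exact ⟨U, h.rightExtended, ⟨(asIso ξ).symm⟩⟩

/-- A left Kan extension along a composite is a left Kan extension along the second functor. -/
theorem leftExtended_of_comp {w : A ⟶ B} {v : B ⟶ C} [w.toFunctor.Full] [w.toFunctor.Faithful]
    [v.toFunctor.Full] [v.toFunctor.Faithful] {U : D.dia C}
    (h : (D.restr v ⋙ D.restr w).LeftExtended U) : (D.restr v).LeftExtended U := by
  have := hD.der3_left w
  have := hD.der3_left v
  obtain ⟨P, η, hη⟩ := exists_isUniversal (R := D.restr w) ((D.restr w).obj ((D.restr v).obj U))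
  obtain ⟨V, θ, hθ⟩ := exists_isUniversal (R := D.restr v) P
  have := hD.isIso_of_isUniversal v hθ
  obtain ⟨e, -⟩ := (hη.comp hθ).isIso_of_isUniversal (h.isUniversal (𝟙 _))
  exact hθ.leftExtended.of_iso e

/-- A right Kan extension along a composite is a right Kan extension along the second functor. -/
theorem rightExtended_of_comp {w : A ⟶ B} {v : B ⟶ C} [w.toFunctor.Full] [w.toFunctor.Faithful]
    [v.toFunctor.Full] [v.toFunctor.Faithful] {U : D.dia C}
    (h : (D.restr v ⋙ D.restr w).RightExtended U) : (D.restr v).RightExtended U := by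
  have := hD.der3_right w
  have := hD.der3_right v
  obtain ⟨P, η, hη⟩ := exists_isCouniversal (R := D.restr w) ((D.restr w).obj ((D.restr v).obj U))
  obtain ⟨V, θ, hθ⟩ := exists_isCouniversal (R := D.restr v) P
  have := hD.isIso_of_isCouniversal v hθ
  obtain ⟨e, -⟩ := (hη.comp hθ).isIso_of_isCouniversal (h.isCouniversal (𝟙 _))
  exact hθ.rightExtended.of_iso e.symm

/-- Restriction along a homotopy exact square preserves left extended diagrams. -/
theorem leftExtended_restr {α : p ≫ u ⟶ q ≫ v} [IsIso α] (hα : InitialFactorization α)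
    {U : D.dia C} (h : (D.restr u).LeftExtended U) :
    (D.restr q).LeftExtended ((D.restr v).obj U) := by
  have h1 := hD.preservesUniversal_square hα _ (h.isUniversal (𝟙 _))
  rw [CategoryTheory.Functor.map_id, Category.id_comp] at h1
  exact h1.leftExtended

/-- Restriction along a homotopy exact square preserves right extended diagrams. -/
theorem rightExtended_restr {α : p ≫ u ⟶ q ≫ v} [IsIso α] (hα : TerminalFactorization α)
    {U : D.dia C} (h : (D.restr v).RightExtended U) :
    (D.restr p).RightExtended ((D.restr u).obj U) := by
  have h1 := hD.preservesCouniversal_square hα _ (h.isCouniversal (𝟙 _))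
  rw [CategoryTheory.Functor.map_id] at h1
  exact (h1.congr (Category.comp_id _).symm).rightExtended

/-- The empty category, as an empty coproduct. -/
abbrev _root_.Prederivator.empty : Cat.{w, w} :=
  Cat.of (Σ i : PEmpty.{w + 1}, ((i.elim : Cat.{w, w}) : Type w))

/-- By (Der1) for the empty family, diagrams on the empty category carry no information. -/
theorem nonempty_unique_hom_empty (X Y : D.dia empty.{w}) : Nonempty (Unique (X ⟶ Y)) := by
  have := hD.der1 PEmpty.{w + 1} (fun i => i.elim)
  let F := pi' fun i : PEmpty.{w + 1} => D.restr (A := i.elim) (B := empty.{w})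
      (Sigma.incl (C := fun i : PEmpty.{w + 1} => ((i.elim : Cat.{w, w}) : Type w)) i).toCatHom
  have hF : F.IsEquivalence := this
  exact ⟨{ default := F.preimage fun i => i.elim
           uniq := fun f => F.map_injective (funext fun i => i.elim) }⟩

/-- A left Kan extension is initial at the objects which receive no morphisms. -/
theorem isInitial_of_isUniversal {u : A ⟶ B} {X : D.dia A} {U : D.dia B}
    {η : X ⟶ (D.restr u).obj U} (h : (D.restr u).IsUniversal η) (b : B)
    (hb : ∀ a : A, IsEmpty (u.toFunctor.obj a ⟶ b)) :
    Nonempty (Limits.IsInitial ((D.restr (point b)).obj U)) := by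
  let e (A : Cat.{w, w}) : empty.{w} ⟶ A := (Sigma.desc fun i : PEmpty.{w + 1} => i.elim).toCatHom
  let α : e A ≫ u ⟶ e pt ≫ point b := NatTrans.toCatHom₂
    { app x := x.1.elim
      naturality x := x.1.elim }
  -- the square with the empty category in the corner is homotopy exact, so `U` is at `b` a left Kan
  -- extension from the empty category
  have hα : InitialFactorization α := fun x b' g => (hb x).elim g
  have h1 := hD.preservesUniversal_square hα η h
  refine ⟨Limits.IsInitial.ofUniqueHom (fun Z => ?_) (fun Z f => ?_)⟩
  · exact ((h1 Z).2 (hD.nonempty_unique_hom_empty _ _).some.default).choose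
  · exact (h1 Z).1
      (@Subsingleton.elim _ (hD.nonempty_unique_hom_empty _ _).some.instSubsingleton _ _)

/-- A right Kan extension is terminal at the objects which support no morphisms. -/
theorem isTerminal_of_isCouniversal {u : A ⟶ B} {X : D.dia A} {U : D.dia B}
    {ξ : (D.restr u).obj U ⟶ X} (h : (D.restr u).IsCouniversal ξ) (b : B)
    (hb : ∀ a : A, IsEmpty (b ⟶ u.toFunctor.obj a)) :
    Nonempty (Limits.IsTerminal ((D.restr (point b)).obj U)) := by
  let e (A : Cat.{w, w}) : empty.{w} ⟶ A := (Sigma.desc fun i : PEmpty.{w + 1} => i.elim).toCatHom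
  let α : e pt ≫ point b ⟶ e A ≫ u := NatTrans.toCatHom₂
    { app x := x.1.elim
      naturality x := x.1.elim }
  have hα : TerminalFactorization α := fun b' x g => (hb x).elim g
  have h1 := hD.preservesCouniversal_square hα ξ h
  refine ⟨Limits.IsTerminal.ofUniqueHom (fun Z => ?_) (fun Z f => ?_)⟩
  · exact ((h1 Z).2 (hD.nonempty_unique_hom_empty _ _).some.default).choose
  · exact (h1 Z).1
      (@Subsingleton.elim _ (hD.nonempty_unique_hom_empty _ _).some.instSubsingleton _ _)

theorem restr_isInitial (u : A ⟶ B) {X : D.dia B} (h : Limits.IsInitial X) :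
    Nonempty (Limits.IsInitial ((D.restr u).obj X)) := by
  have := hD.der3_right u
  exact ⟨h.isInitialObj (D.restr u)⟩

theorem restr_isTerminal (u : A ⟶ B) {X : D.dia B} (h : Limits.IsTerminal X) :
    Nonempty (Limits.IsTerminal ((D.restr u).obj X)) := by
  have := hD.der3_left u
  exact ⟨h.isTerminalObj (D.restr u)⟩

theorem restr_isZero (u : A ⟶ B) {X : D.dia B} (h : Limits.IsZero X) :
    Limits.IsZero ((D.restr u).obj X) := by
  have h1 := (hD.restr_isInitial u h.isInitial).some
  have h2 := (hD.restr_isTerminal u h.isTerminal).some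
  exact ⟨fun Y => ⟨⟨⟨h1.to Y⟩, fun _ => h1.hom_ext _ _⟩⟩,
    fun Y => ⟨⟨⟨h2.from Y⟩, fun _ => h2.hom_ext _ _⟩⟩⟩

end IsDerivator

theorem isIso_of_isZero {C : Type u₁} [Category.{v₁} C] {X Y : C} (hX : Limits.IsZero X)
    (hY : Limits.IsZero Y) (f : X ⟶ Y) : IsIso f :=
  ⟨hY.to_ X, hX.eq_of_src _ _, hY.eq_of_src _ _⟩

theorem isZero_of_isInitial {C : Type u₁} [Category.{v₁} C] [Limits.HasZeroObject C] {X : C}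
    (h : Limits.IsInitial X) : Limits.IsZero X :=
  (Limits.isZero_zero C).of_iso (h.uniqueUpToIso (Limits.isZero_zero C).isInitial)

theorem isZero_of_isTerminal {C : Type u₁} [Category.{v₁} C] [Limits.HasZeroObject C] {X : C}
    (h : Limits.IsTerminal X) : Limits.IsZero X :=
  (Limits.isZero_zero C).of_iso (h.uniqueUpToIso (Limits.isZero_zero C).isTerminal)

namespace IsStable

variable (hD : D.IsStable)
include hD

theorem hasZeroObject (A : Cat.{w, w}) : Limits.HasZeroObject (D.dia A) := by
  have := hD.pointed
  exact ⟨_, hD.isDerivator.restr_isZero (toPt A) (Limits.isZero_zero (D.dia pt))⟩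

theorem isZero_of_points {X : D.dia A} (h : ∀ a : A, Limits.IsZero ((D.restr (point a)).obj X)) :
    Limits.IsZero X := by
  obtain ⟨Z, hZ⟩ := (hD.hasZeroObject A).zero
  have : IsIso (hZ.from_ X) := hD.isDerivator.isIso_of_points _ fun a =>
    isIso_of_isZero (h a) (hD.isDerivator.restr_isZero (point a) hZ) _
  exact hZ.of_iso (asIso (hZ.from_ X))

end IsStable

end
end Prederivator

/-! ### Diagrams on posets and squares -/

namespace Prederivator

open Functor

section

variable {α β γ : Type} [PartialOrder α] [PartialOrder β] [PartialOrder γ]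

theorem shape_hom_eq {x y : shape.{w} β} (f g : x ⟶ y) : f = g :=
  have key {x y : Shape.{w} β} (f g : x ⟶ y) : f = g := Subsingleton.elim f g
  key f g

theorem le_of_shape_hom {x y : shape.{w} β} (f : x ⟶ y) : x.val ≤ y.val :=
  @leOfHom (Shape.{w} β) _ x y f

/-- The morphism in `shape β` given by an inequality. -/
def shapeHom {x y : shape.{w} β} (h : x.val ≤ y.val) : x ⟶ y :=
  @homOfLE (Shape.{w} β) _ x y h

/-- Functors to a poset are isomorphic if they agree on objects. -/
def thinIso {A : Cat.{w, w}} {F G : A ⟶ shape.{w} β}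
    (h : ∀ a, F.toFunctor.obj a = G.toFunctor.obj a) : F ≅ G :=
  Cat.Hom.isoMk (NatIso.ofComponents (fun a => eqToIso (h a)) fun _ => shape_hom_eq _ _)

/-- The inclusion of a poset in a larger one. -/
abbrev emb (f : α ↪o β) : shape.{w} α ⟶ shape.{w} β := shapeMap f f.monotone

theorem full_shapeMap {f : α → β} (hf : Monotone f) (h : ∀ x y, f x ≤ f y → x ≤ y) :
    (shapeMap.{w} f hf).toFunctor.Full :=
  ⟨fun {x y} g => ⟨shapeHom (h x.val y.val (le_of_shape_hom g)), shape_hom_eq _ _⟩⟩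

instance (f : α → β) (hf : Monotone f) : (shapeMap.{w} f hf).toFunctor.Faithful :=
  ⟨fun _ => shape_hom_eq _ _⟩

instance (f : α ↪o β) : (emb.{w} f).toFunctor.Full :=
  full_shapeMap f.monotone fun _ _ => f.le_iff_le.1

instance : spanIncl.{w}.toFunctor.Full := full_shapeMap _ fun _ _ h => h

instance : spanIncl.{w}.toFunctor.Faithful := ⟨fun _ => shape_hom_eq _ _⟩

instance : cospanIncl.{w}.toFunctor.Full := full_shapeMap _ fun _ _ h => h

instance : cospanIncl.{w}.toFunctor.Faithful := ⟨fun _ => shape_hom_eq _ _⟩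

/-- A functor evaluated at an object, as a composite. -/
def pointComp {A B : Cat.{w, w}} (u : A ⟶ B) (a : A) :
    (point a).toFunctor ⋙ u.toFunctor ≅ (point (u.toFunctor.obj a)).toFunctor :=
  NatIso.ofComponents (fun _ => Iso.refl (u.toFunctor.obj a)) fun _ =>
    (by simp : u.toFunctor.map (𝟙 a) ≫ 𝟙 _ = 𝟙 _ ≫ 𝟙 _)

variable {D : Prederivator.{w, v, u}}

theorem isIso_restr_restr_iff {A B C : Cat.{w, w}} {f : A ⟶ B} {g : B ⟶ C} {k : A ⟶ C}
    (e : f.toFunctor ⋙ g.toFunctor ≅ k.toFunctor) {X Y : D.dia C} (c : X ⟶ Y) :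
    IsIso ((D.restr f).map ((D.restr g).map c)) ↔ IsIso ((D.restr k).map c) :=
  NatIso.isIso_map_iff (D.restrIso e) c

theorem isIso_point_restr_iff {A B : Cat.{w, w}} (u : A ⟶ B) (a : A) {X Y : D.dia B} (c : X ⟶ Y) :
    IsIso ((D.restr (point a)).map ((D.restr u).map c)) ↔
      IsIso ((D.restr (point (u.toFunctor.obj a))).map c) :=
  isIso_restr_restr_iff (pointComp u a) c

theorem isZero_point_restr_iff {A B : Cat.{w, w}} (u : A ⟶ B) (a : A) {X : D.dia B} :
    Limits.IsZero ((D.restr (point a)).obj ((D.restr u).obj X)) ↔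
      Limits.IsZero ((D.restr (point (u.toFunctor.obj a))).obj X) :=
  ((D.restrIso (pointComp u a)).app X).isZero_iff

namespace IsDerivator

variable (hD : D.IsDerivator)
include hD

theorem isCocartesian_iff {X : D.dia (shape Sq)} :
    D.IsCocartesian X ↔ (D.restr spanIncl).LeftExtended X := by
  constructor
  · rintro ⟨L, adj, Y, ⟨e⟩⟩
    have h := isUniversal_unit adj Y
    have := hD.isIso_of_isUniversal _ h
    exact h.leftExtended.of_iso e
  · intro h
    have := hD.der3_left spanIncl
    refine ⟨_, Adjunction.ofIsRightAdjoint (D.restr spanIncl), (D.restr spanIncl).obj X, ?_⟩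
    obtain ⟨e, -⟩ := (isUniversal_unit (Adjunction.ofIsRightAdjoint (D.restr spanIncl))
      ((D.restr spanIncl).obj X)).isIso_of_isUniversal (h.isUniversal (𝟙 _))
    exact ⟨e⟩

theorem isCartesian_iff {X : D.dia (shape Sq)} :
    D.IsCartesian X ↔ (D.restr cospanIncl).RightExtended X := by
  constructor
  · rintro ⟨R, adj, Y, ⟨e⟩⟩
    have h := isCouniversal_counit adj Y
    have := hD.isIso_of_isCouniversal _ h
    exact h.rightExtended.of_iso e
  · intro h
    have := hD.der3_right cospanIncl
    refine ⟨_, Adjunction.ofIsLeftAdjoint (D.restr cospanIncl), (D.restr cospanIncl).obj X, ?_⟩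
    obtain ⟨e, -⟩ := (isCouniversal_counit (Adjunction.ofIsLeftAdjoint (D.restr cospanIncl))
      ((D.restr cospanIncl).obj X)).isIso_of_isCouniversal (h.isCouniversal (𝟙 _))
    exact ⟨e.symm⟩

/-- Left extended diagrams are detected by comparison with left Kan extensions. -/
theorem leftExtended_of_comparison {A B : Cat.{w, w}} (u : A ⟶ B) [u.toFunctor.Full]
    [u.toFunctor.Faithful] {X : D.dia B}
    (h : ∀ (V : D.dia B) (c : V ⟶ X), (D.restr u).LeftExtended V → IsIso ((D.restr u).map c) →
      ∀ b : B, IsIso ((D.restr (point b)).map c)) : (D.restr u).LeftExtended X := by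
  obtain ⟨V, hV, ⟨e⟩⟩ := hD.exists_leftExtended u ((D.restr u).obj X)
  obtain ⟨c, hc⟩ := (hV X).2 e.inv
  dsimp only at hc
  have := hD.isIso_of_points c (h V c hV (by rw [hc]; infer_instance))
  exact hV.of_iso (asIso c)

/-- Right extended diagrams are detected by comparison with right Kan extensions. -/
theorem rightExtended_of_comparison {A B : Cat.{w, w}} (u : A ⟶ B) [u.toFunctor.Full]
    [u.toFunctor.Faithful] {X : D.dia B}
    (h : ∀ (V : D.dia B) (c : X ⟶ V), (D.restr u).RightExtended V → IsIso ((D.restr u).map c) →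
      ∀ b : B, IsIso ((D.restr (point b)).map c)) : (D.restr u).RightExtended X := by
  obtain ⟨V, hV, ⟨e⟩⟩ := hD.exists_rightExtended u ((D.restr u).obj X)
  obtain ⟨c, hc⟩ := (hV X).2 e.hom
  dsimp only at hc
  have := hD.isIso_of_points c (h V c hV (by rw [hc]; infer_instance))
  exact hV.of_iso (asIso c).symm

theorem isIso_final_vertex {f : Sq → β} (hf : Monotone f) {U V : D.dia (shape β)} (c : U ⟶ V)
    (hU : D.IsCocartesian ((D.restr (shapeMap f hf)).obj U))
    (hV : D.IsCocartesian ((D.restr (shapeMap f hf)).obj V))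
    (h : ∀ s : Sq, s ≠ (1, 1) → IsIso ((D.restr (point (A := shape β) ⟨f s⟩)).map c)) :
    IsIso ((D.restr (point (A := shape β) ⟨f (1, 1)⟩)).map c) := by
  have h1 : IsIso ((D.restr spanIncl).map ((D.restr (shapeMap f hf)).map c)) :=
    hD.isIso_of_points _ fun s => (isIso_point_restr_iff spanIncl s _).2
      ((isIso_point_restr_iff (shapeMap f hf) _ c).2 (h s.val.1 s.val.2))
  have := (hD.isCocartesian_iff.1 hU).isIso (hD.isCocartesian_iff.1 hV)
    ((D.restr (shapeMap f hf)).map c)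
  exact (isIso_point_restr_iff (shapeMap f hf) (⟨(1, 1)⟩ : Shape Sq) c).1 inferInstance

theorem isIso_initial_vertex {f : Sq → β} (hf : Monotone f) {U V : D.dia (shape β)} (c : U ⟶ V)
    (hU : D.IsCartesian ((D.restr (shapeMap f hf)).obj U))
    (hV : D.IsCartesian ((D.restr (shapeMap f hf)).obj V))
    (h : ∀ s : Sq, s ≠ (0, 0) → IsIso ((D.restr (point (A := shape β) ⟨f s⟩)).map c)) :
    IsIso ((D.restr (point (A := shape β) ⟨f (0, 0)⟩)).map c) := by
  have h1 : IsIso ((D.restr cospanIncl).map ((D.restr (shapeMap f hf)).map c)) :=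
    hD.isIso_of_points _ fun s => (isIso_point_restr_iff cospanIncl s _).2
      ((isIso_point_restr_iff (shapeMap f hf) _ c).2 (h s.val.1 s.val.2))
  have := (hD.isCartesian_iff.1 hU).isIso (hD.isCartesian_iff.1 hV)
    ((D.restr (shapeMap f hf)).map c)
  exact (isIso_point_restr_iff (shapeMap f hf) (⟨(0, 0)⟩ : Shape Sq) c).1 inferInstance

/-- A left Kan extension is cocartesian on a square whose final vertex is not in the domain, if
the span without that vertex is a reflective approximation of what lies below the square. -/
theorem isCocartesian_of_leftExtended (κ : α ↪o β) {U : D.dia (shape β)}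
    (hU : (D.restr (emb κ)).LeftExtended U) {f : Sq → β} (hf : Monotone f)
    (hκ : ∀ a, κ a ≠ f (1, 1)) (hs : ∀ s, s ≠ (1, 1) → f s ≠ f (1, 1))
    (h : ∀ y t, y ≤ f t → y ≠ f (1, 1) → ∃ s, s ≠ (1, 1) ∧ y ≤ f s ∧ s ≤ t ∧
      ∀ s', s' ≠ (1, 1) → y ≤ f s' → s ≤ s') :
    D.IsCocartesian ((D.restr (shapeMap f hf)).obj U) := by
  let γ : Type := {y : β // y ≠ f (1, 1)}
  let i : γ ↪o β := OrderEmbedding.subtype _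
  let j : α ↪o γ := ⟨⟨fun a => ⟨κ a, hκ a⟩, fun a b h => κ.injective (congrArg Subtype.val h)⟩,
    κ.le_iff_le⟩
  let g : Span → γ := fun s => ⟨f s.val, hs _ s.prop⟩
  have h1 : (D.restr (emb i)).LeftExtended U := hD.leftExtended_of_comp (w := emb j)
    (hU.natIso ((D.cellIso (thinIso fun _ => rfl : emb.{w} κ ≅ emb j ≫ emb i)) ≪≫
      D.restrComp _ _))
  rw [hD.isCocartesian_iff]
  refine hD.leftExtended_restr (p := shapeMap g fun _ _ h => hf h) (u := emb i)
    (α := (thinIso fun _ => rfl : shapeMap.{w} g _ ≫ emb i ≅ spanIncl ≫ shapeMap f hf).hom)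
    (fun y t k => ?_) h1
  obtain ⟨s, hs, hy, hst, hs'⟩ := h y.val.val t.val (le_of_shape_hom k) y.val.prop
  exact ⟨⟨⟨s, hs⟩⟩, shapeHom hy, shapeHom hst, shape_hom_eq _ _, fun a' m' h' _ =>
    ⟨shapeHom (hs' a'.val.val a'.val.prop (le_of_shape_hom m')), ⟨shape_hom_eq _ _,
      shape_hom_eq _ _⟩, fun _ _ => shape_hom_eq _ _⟩⟩

/-- A right Kan extension is cartesian on a square whose initial vertex is not in the domain, if
the cospan without that vertex is a coreflective approximation of what lies above the square. -/
theorem isCartesian_of_rightExtended (κ : α ↪o β) {U : D.dia (shape β)}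
    (hU : (D.restr (emb κ)).RightExtended U) {f : Sq → β} (hf : Monotone f)
    (hκ : ∀ a, κ a ≠ f (0, 0)) (hs : ∀ s, s ≠ (0, 0) → f s ≠ f (0, 0))
    (h : ∀ y t, f t ≤ y → y ≠ f (0, 0) → ∃ s, s ≠ (0, 0) ∧ f s ≤ y ∧ t ≤ s ∧
      ∀ s', s' ≠ (0, 0) → f s' ≤ y → s' ≤ s) :
    D.IsCartesian ((D.restr (shapeMap f hf)).obj U) := by
  let γ : Type := {y : β // y ≠ f (0, 0)}
  let i : γ ↪o β := OrderEmbedding.subtype _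
  let j : α ↪o γ := ⟨⟨fun a => ⟨κ a, hκ a⟩, fun a b h => κ.injective (congrArg Subtype.val h)⟩,
    κ.le_iff_le⟩
  let g : Cospan → γ := fun s => ⟨f s.val, hs _ s.prop⟩
  have h1 : (D.restr (emb i)).RightExtended U := hD.rightExtended_of_comp (w := emb j)
    (hU.natIso ((D.cellIso (thinIso fun _ => rfl : emb.{w} κ ≅ emb j ≫ emb i)) ≪≫
      D.restrComp _ _))
  rw [hD.isCartesian_iff]
  refine hD.rightExtended_restr (q := shapeMap g fun _ _ h => hf h) (v := emb i)
    (α := (thinIso fun _ => rfl : cospanIncl ≫ shapeMap f hf ≅ shapeMap.{w} g _ ≫ emb i).hom)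
    (fun t y k => ?_) h1
  obtain ⟨s, hs, hy, hst, hs'⟩ := h y.val.val t.val (le_of_shape_hom k) y.val.prop
  exact ⟨⟨⟨s, hs⟩⟩, shapeHom hst, shapeHom hy, shape_hom_eq _ _, fun a' m' h' _ =>
    ⟨shapeHom (hs' a'.val.val a'.val.prop (le_of_shape_hom h')), ⟨shape_hom_eq _ _,
      shape_hom_eq _ _⟩, fun _ _ => shape_hom_eq _ _⟩⟩

end IsDerivator

end
end Prederivator

/-! ### Coherent diagrams on the mesh category -/

namespace Mesh

variable {n : ℕ}

theorem square_le_square_iff (k : ℤ) (l : Fin n) {s t : Prederivator.Sq} :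
    square k l s ≤ square k l t ↔ s ≤ t := by
  rw [le_def, Prod.le_def, Fin.le_def, Fin.le_def]
  simp only [square]
  omega

theorem square_injective (k : ℤ) (l : Fin n) : Function.Injective (square k l) := fun _ _ h =>
  le_antisymm ((square_le_square_iff k l).1 h.le) ((square_le_square_iff k l).1 h.ge)

/-- A vertex below a mesh square has a reflection in the square, and this is the final vertex only
for the final vertex itself. -/
theorem exists_least_square (k : ℤ) (l : Fin n) (y : Mesh n) (t : Prederivator.Sq)
    (h : y ≤ square k l t) (hy : y ≠ square k l (1, 1)) :
    ∃ s, s ≠ (1, 1) ∧ y ≤ square k l s ∧ s ≤ t ∧ ∀ s', y ≤ square k l s' → s ≤ s' := by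
  obtain ⟨a, b, hb⟩ := y
  have hy' : ¬ (a = k + 1 ∧ a + b = k + l.val + 2) := fun hh => hy (by
    ext <;> simp [square] <;> omega)
  simp only [le_def, square, Prod.le_def, Fin.le_def, Prod.forall, ne_eq, Prod.ext_iff,
    Fin.ext_iff] at h ⊢
  refine ⟨(if a ≤ k then 0 else 1, if a + b ≤ k + l.val + 1 then 0 else 1), ?_, ?_, ?_, ?_⟩
  all_goals split_ifs <;> simp <;> omega

/-- A vertex above a mesh square has a coreflection in the square, and this is the initial vertex
only for the initial vertex itself. -/
theorem exists_greatest_square (k : ℤ) (l : Fin n) (y : Mesh n) (t : Prederivator.Sq)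
    (h : square k l t ≤ y) (hy : y ≠ square k l (0, 0)) :
    ∃ s, s ≠ (0, 0) ∧ square k l s ≤ y ∧ t ≤ s ∧ ∀ s', square k l s' ≤ y → s' ≤ s := by
  obtain ⟨a, b, hb⟩ := y
  have hy' : ¬ (a = k ∧ a + b = k + l.val + 1) := fun hh => hy (by
    ext <;> simp [square] <;> omega)
  simp only [le_def, square, Prod.le_def, Fin.le_def, Prod.forall, ne_eq, Prod.ext_iff,
    Fin.ext_iff] at h ⊢
  refine ⟨(if k + 1 ≤ a then 1 else 0, if k + l.val + 2 ≤ a + b then 1 else 0), ?_, ?_, ?_, ?_⟩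
  all_goals split_ifs <;> simp <;> omega

/-- The vertices `(0, l)` for `1 ≤ l ≤ n`, together with the boundary vertices `(k, 0)` for `1 ≤ k`
and `(k, n + 1)` for `0 ≤ k`. For `n ≠ 0` these are the boundary vertices which are not below one
of the vertices `(0, l)`. -/
def fringe (n : ℕ) : Set (Mesh n) :=
  {x | (x.k = 0 ∧ x.l ≠ 0) ∨ (1 ≤ x.k ∧ x.l = 0) ∨ (0 ≤ x.k ∧ x.l = n + 1)}

/-- The vertices `(0, l)` for `1 ≤ l ≤ n`, together with the boundary vertices. -/
def frame (n : ℕ) : Set (Mesh n) := {x | x.k = 0 ∨ x.l = 0 ∨ x.l = n + 1}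

/-- The boundary vertices, together with the vertices `(k, l)` for which `0 ≤ k`. -/
def upperHalf (n : ℕ) : Set (Mesh n) := {x | 0 ≤ x.k ∨ x.l = 0 ∨ x.l = n + 1}

/-- The inclusion of `A_n` in the fringe. -/
def ofLinearFringe (n : ℕ) : Fin n ↪o fringe n where
  toFun l := ⟨ofLinear l, Or.inl ⟨rfl, Nat.succ_ne_zero _⟩⟩
  inj' l l' h := by
    have := congrArg (fun x => x.val.l) h
    simp only [ofLinear] at this
    exact Fin.ext (by omega)
  map_rel_iff' := by
    intro l l'
    change ofLinear l ≤ ofLinear l' ↔ l ≤ l'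
    rw [le_def, Fin.le_def]
    simp only [ofLinear]
    omega

/-- The inclusion of subsets as an order embedding. -/
def inclusion {S T : Set (Mesh n)} (h : S ⊆ T) : S ↪o T :=
  ⟨⟨Set.inclusion h, Set.inclusion_injective h⟩, Iff.rfl⟩

theorem fringe_subset (n : ℕ) : fringe n ⊆ frame n := fun x h => by
  simp only [fringe, frame, Set.mem_ofPred_eq] at h ⊢
  omega

theorem frame_subset (n : ℕ) : frame n ⊆ upperHalf n := fun x h => by
  simp only [upperHalf, frame, Set.mem_ofPred_eq] at h ⊢
  omega

/-- The fringe is closed upwards in the frame. -/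
theorem not_le_of_mem_fringe {x y : Mesh n} (hx : x ∈ fringe n) (hy : y ∈ frame n)
    (hy' : y ∉ fringe n) : ¬ x ≤ y := by
  have := x.l_le
  have := y.l_le
  simp only [fringe, frame, Set.mem_ofPred_eq, le_def] at *
  omega

/-- The image of `A_n` is closed downwards in the fringe. -/
theorem mem_range_of_le {x : fringe n} {l : Fin n} (h : x ≤ ofLinearFringe n l) :
    ∃ l', ofLinearFringe n l' = x := by
  obtain ⟨⟨k, m, hm⟩, hx⟩ := x
  have h' : k ≤ 0 ∧ k + m ≤ 0 + (l.val + 1 : ℕ) := h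
  have hl := l.isLt
  simp only [fringe, Set.mem_ofPred_eq] at hx
  refine ⟨⟨m - 1, by omega⟩, Subtype.ext (Mesh.ext ?_ ?_)⟩
  · change 0 = k
    omega
  · change m - 1 + 1 = m
    omega

theorem eq_of_not_mem_range {x : fringe n} (h : ¬ ∃ l, ofLinearFringe n l = x) :
    x.val.l = 0 ∨ x.val.l = n + 1 := by
  obtain ⟨⟨k, m, hm⟩, hx⟩ := x
  simp only [fringe, Set.mem_ofPred_eq] at hx
  by_contra hm'
  dsimp only at hm'
  refine h ⟨⟨m - 1, by omega⟩, Subtype.ext (Mesh.ext ?_ ?_)⟩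
  · change 0 = k
    omega
  · change m - 1 + 1 = m
    omega

theorem square_mem_upperHalf {k : ℤ} (hk : 0 ≤ k) (l : Fin n) (s : Prederivator.Sq) :
    square k l s ∈ upperHalf n := Or.inl (by simp only [square]; omega)

/-- A mesh square in the upper half. -/
def squareUpper {k : ℤ} (hk : 0 ≤ k) (l : Fin n) (s : Prederivator.Sq) : upperHalf n :=
  ⟨square k l s, square_mem_upperHalf hk l s⟩

theorem monotone_squareUpper {k : ℤ} (hk : 0 ≤ k) (l : Fin n) : Monotone (squareUpper hk l) :=
  monotone_square k l

end Mesh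

namespace Prederivator

open Functor Mesh

section

/-- A coherent diagram on the mesh category which vanishes on the boundary stripes and makes all
squares bicartesian. -/
structure IsExactMesh (D : Prederivator.{w, v, u}) (n : ℕ) (X : D.dia (mesh n)) : Prop where
  lower : ∀ k : ℤ, Limits.IsZero ((D.restr (point (A := mesh n) ⟨Mesh.lower k⟩)).obj X)
  upper : ∀ k : ℤ, Limits.IsZero ((D.restr (point (A := mesh n) ⟨Mesh.upper k⟩)).obj X)
  square : ∀ (k : ℤ) (l : Fin n),
    D.IsBicartesian ((D.restr (shapeMap (Mesh.square k l) (Mesh.monotone_square k l))).obj X)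

variable {D : Prederivator.{w, v, u}} {n : ℕ}

theorem IsExactMesh.isZero {X : D.dia (mesh n)} (h : D.IsExactMesh n X) {x : Mesh n}
    (hx : x.l = 0 ∨ x.l = n + 1) : Limits.IsZero ((D.restr (point (A := mesh n) ⟨x⟩)).obj X) := by
  obtain ⟨k, l, hl⟩ := x
  obtain rfl | rfl := hx
  · exact h.lower k
  · exact h.upper k

/-- The inclusion of `A_n` in the fringe. -/
abbrev toFringe (n : ℕ) : linear.{w} n ⟶ shape.{w} (fringe n) := emb (ofLinearFringe n)

/-- The inclusion of the fringe in the frame. -/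
abbrev toFrame (n : ℕ) : shape.{w} (fringe n) ⟶ shape.{w} (frame n) :=
  emb (inclusion (fringe_subset n))

/-- The inclusion of the frame in the upper half. -/
abbrev toUpperHalf (n : ℕ) : shape.{w} (frame n) ⟶ shape.{w} (upperHalf n) :=
  emb (inclusion (frame_subset n))

/-- The inclusion of the upper half in `M_n`. -/
abbrev toMesh (n : ℕ) : shape.{w} (upperHalf n) ⟶ mesh.{w} n :=
  emb (OrderEmbedding.subtype (· ∈ upperHalf n))

namespace IsStable

variable (hD : D.IsStable)
include hD

theorem isBicartesian_of_isCocartesian {X : D.dia (shape Sq)} (h : D.IsCocartesian X) :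
    D.IsBicartesian X := ⟨h, (hD.cocartesian_iff X).1 h⟩

theorem isBicartesian_of_isCartesian {X : D.dia (shape Sq)} (h : D.IsCartesian X) :
    D.IsBicartesian X := ⟨(hD.cocartesian_iff X).2 h, h⟩

end IsStable

namespace IsDerivator

variable (hD : D.IsDerivator)
include hD

/-- Right Kan extension along the last inclusion makes the squares on the left cartesian. -/
theorem isCartesian_square_of_rightExtended {X : D.dia (mesh n)}
    (h : (D.restr (toMesh n)).RightExtended X) {k : ℤ} (hk : k < 0) (l : Fin n) :
    D.IsCartesian ((D.restr (shapeMap (Mesh.square k l) (Mesh.monotone_square k l))).obj X) := by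
  refine hD.isCartesian_of_rightExtended _ h (monotone_square k l) (fun a ha => ?_)
    (fun s hs e => hs (square_injective k l e)) fun y t hy hy' => ?_
  · have ha' : a.val = Mesh.square k l (0, 0) := ha
    have := a.prop
    rw [ha', square_zero_zero] at this
    simp only [upperHalf, Set.mem_ofPred_eq] at this
    omega
  · obtain ⟨s, h1, h2, h3, h4⟩ := exists_greatest_square k l y t hy hy'
    exact ⟨s, h1, h2, h3, fun s' _ => h4 s'⟩

/-- Left Kan extension along the third inclusion makes the squares of the upper half
cocartesian. -/
theorem isCocartesian_square_of_leftExtended {X : D.dia (shape (upperHalf n))}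
    (h : (D.restr (toUpperHalf n)).LeftExtended X) {k : ℤ} (hk : 0 ≤ k) (l : Fin n) :
    D.IsCocartesian ((D.restr
      (shapeMap (squareUpper hk l) (monotone_squareUpper hk l))).obj X) := by
  refine hD.isCocartesian_of_leftExtended _ h (monotone_squareUpper hk l) (fun a ha => ?_)
    (fun s hs e => hs (square_injective k l (congrArg Subtype.val e))) fun y t hy hy' => ?_
  · have ha' : a.val = Mesh.square k l (1, 1) := congrArg Subtype.val ha
    have := a.prop
    rw [ha', square_one_one] at this
    simp only [frame, Set.mem_ofPred_eq] at this
    omega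
  · obtain ⟨s, h1, h2, h3, h4⟩ :=
      exists_least_square k l y.val t hy fun e => hy' (Subtype.ext e)
    exact ⟨s, h1, h2, h3, fun s' _ => h4 s'⟩

end IsDerivator

variable (hD : D.IsStable)
include hD

namespace IsExactMesh

variable {X : D.dia (mesh n)} (hX : D.IsExactMesh n X)
include hX

/-- An exact diagram agrees with the right Kan extension from the upper half, since the squares on
the left are cartesian in both. -/
theorem rightExtended_toMesh : (D.restr (toMesh n)).RightExtended X := by
  refine hD.isDerivator.rightExtended_of_comparison _ fun V c hV hc => ?_
  rintro ⟨x⟩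
  -- `2 k + l` increases strictly along every arrow, and is less than `n + 1` outside the upper half
  induction hN : (n + 1 - 2 * x.k - x.l).toNat using Nat.strong_induction_on generalizing x with
  | _ N ih =>
    by_cases hx : x ∈ upperHalf n
    · exact (isIso_point_restr_iff (toMesh n) ⟨⟨x, hx⟩⟩ c).1 inferInstance
    · obtain ⟨k, l, hl⟩ := x
      simp only [upperHalf, Set.mem_ofPred_eq] at hx
      dsimp only at hN
      obtain ⟨l, rfl⟩ : ∃ l' : Fin n, l = l'.val + 1 := ⟨⟨l - 1, by omega⟩, by dsimp only; omega⟩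
      have hk : k < 0 := by omega
      have h1 := hD.isDerivator.isIso_initial_vertex (monotone_square k l) c (hX.square k l).2
        (hD.isDerivator.isCartesian_square_of_rightExtended hV hk l) fun s hs => ih _ ?_ _ rfl
      · have e : (⟨Mesh.square k l (0, 0)⟩ : Shape.{w} (Mesh n)) = ⟨⟨k, l.val + 1, hl⟩⟩ :=
          congrArg Shape.mk (square_zero_zero k l)
        exact e ▸ h1
      · rw [ne_eq, Prod.ext_iff, Fin.ext_iff, Fin.ext_iff] at hs
        simp only [Mesh.square, Fin.val_zero] at hs ⊢
        omega

/-- On the upper half, an exact diagram agrees with the left Kan extension from the frame, since the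
squares are cocartesian in both. -/
theorem leftExtended_toUpperHalf :
    (D.restr (toUpperHalf n)).LeftExtended ((D.restr (toMesh n)).obj X) := by
  refine hD.isDerivator.leftExtended_of_comparison _ fun V c hV hc => ?_
  rintro ⟨x⟩
  -- `2 k + l` increases strictly along every arrow, and it is positive outside the frame
  induction hN : (2 * x.val.k + x.val.l).toNat using Nat.strong_induction_on generalizing x with
  | _ N ih =>
    by_cases hx : x.val ∈ frame n
    · exact (isIso_point_restr_iff (toUpperHalf n) ⟨⟨x.val, hx⟩⟩ c).1 inferInstance
    · obtain ⟨⟨k, l, hl⟩, hx'⟩ := x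
      simp only [frame, upperHalf, Set.mem_ofPred_eq] at hx hx'
      dsimp only at hN
      obtain ⟨l, rfl⟩ : ∃ l' : Fin n, l = l'.val + 1 := ⟨⟨l - 1, by omega⟩, by dsimp only; omega⟩
      obtain ⟨k, rfl⟩ : ∃ k', k = k' + 1 := ⟨k - 1, by omega⟩
      have hk : 0 ≤ k := by omega
      have h0 : D.IsCocartesian ((D.restr (shapeMap (squareUpper hk l)
          (monotone_squareUpper hk l))).obj ((D.restr (toMesh n)).obj X)) := by
        rw [hD.isDerivator.isCocartesian_iff]
        refine (hD.isDerivator.isCocartesian_iff.1 (hX.square k l).1).of_iso ?_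
        exact (restr_restr (shapeMap (squareUpper hk l) (monotone_squareUpper hk l)) (toMesh n)
          (shapeMap (Mesh.square k l) (monotone_square k l)) (Iso.refl _) X).some.symm
      have h1 := hD.isDerivator.isIso_final_vertex (monotone_squareUpper hk l) c
        (hD.isDerivator.isCocartesian_square_of_leftExtended hV hk l) h0 fun s hs => ih _ ?_ _ rfl
      · exact h1
      · rw [ne_eq, Prod.ext_iff, Fin.ext_iff, Fin.ext_iff] at hs
        simp only [squareUpper, Mesh.square, Fin.val_one] at hs ⊢
        omega

/-- On the frame, both an exact diagram and the left Kan extension from the fringe vanish at the new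
vertices. -/
theorem leftExtended_toFrame : (D.restr (toFrame n)).LeftExtended
    ((D.restr (toUpperHalf n)).obj ((D.restr (toMesh n)).obj X)) := by
  refine hD.isDerivator.leftExtended_of_comparison _ fun V c hV hc => ?_
  have := hD.pointed
  rintro ⟨x⟩
  by_cases hx : x.val ∈ fringe n
  · exact (isIso_point_restr_iff (toFrame n) ⟨⟨x.val, hx⟩⟩ c).1 inferInstance
  · have h1 := (hD.isDerivator.isInitial_of_isUniversal (hV.isUniversal (𝟙 _))
      (⟨x⟩ : Shape (frame n))
      fun a => ⟨fun g => not_le_of_mem_fringe a.val.prop x.prop hx (le_of_shape_hom g)⟩).some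
    refine isIso_of_isZero (isZero_of_isInitial h1) ?_ _
    refine (isZero_point_restr_iff (toUpperHalf n) (⟨x⟩ : Shape (frame n))).2
      ((isZero_point_restr_iff (toMesh n) _).2 (hX.isZero ?_))
    have := x.prop
    simp only [fringe, frame, Set.mem_ofPred_eq] at hx this
    change x.val.l = 0 ∨ x.val.l = n + 1
    omega

/-- On the fringe, both an exact diagram and the right Kan extension from `A_n` vanish at the new
vertices. -/
theorem rightExtended_toFringe : (D.restr (toFringe n)).RightExtended
    ((D.restr (toFrame n)).obj ((D.restr (toUpperHalf n)).obj ((D.restr (toMesh n)).obj X))) := by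
  refine hD.isDerivator.rightExtended_of_comparison _ fun V c hV hc => ?_
  have := hD.pointed
  rintro ⟨x⟩
  by_cases hx : ∃ l, ofLinearFringe n l = x
  · obtain ⟨l, rfl⟩ := hx
    exact (isIso_point_restr_iff (toFringe n) ⟨l⟩ c).1 inferInstance
  · have h1 := (hD.isDerivator.isTerminal_of_isCouniversal (hV.isCouniversal (𝟙 _))
      (⟨x⟩ : Shape (fringe n)) fun a => ⟨fun g => hx (mem_range_of_le (le_of_shape_hom g))⟩).some
    refine isIso_of_isZero ?_ (isZero_of_isTerminal h1) _
    refine (isZero_point_restr_iff (toFrame n) (⟨x⟩ : Shape (fringe n))).2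
      ((isZero_point_restr_iff (toUpperHalf n) _).2
        ((isZero_point_restr_iff (toMesh n) _).2 (hX.isZero (eq_of_not_mem_range hx))))

end IsExactMesh

/-- The composite of the four inclusions. -/
def linearToMeshIso (D : Prederivator.{w, v, u}) (n : ℕ) :
    D.restr (toMesh n) ⋙ D.restr (toUpperHalf n) ⋙ D.restr (toFrame n) ⋙ D.restr (toFringe n) ≅
      D.restr (linearToMesh n) :=
  isoWhiskerLeft _ (isoWhiskerLeft _ (D.restrIso (f := toFringe n) (g := toFrame n)
    (k := toFringe n ≫ toFrame n) (Iso.refl _)) ≪≫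
    D.restrIso (f := toFringe n ≫ toFrame n) (g := toUpperHalf n)
      (k := (toFringe n ≫ toFrame n) ≫ toUpperHalf n) (Iso.refl _)) ≪≫
    D.restrIso (f := (toFringe n ≫ toFrame n) ≫ toUpperHalf n) (g := toMesh n)
      (k := linearToMesh n) (Iso.refl _)

/-- Restriction to `A_n` is fully faithful on the exact diagrams. -/
theorem IsExactMesh.bijective_restr_map {X Y : D.dia (mesh n)} (hX : D.IsExactMesh n X)
    (hY : D.IsExactMesh n Y) :
    Function.Bijective fun g : X ⟶ Y => (D.restr (linearToMesh n)).map g := by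
  have h1 := (hY.rightExtended_toFringe hD _).comp ((hX.leftExtended_toFrame hD _).comp
    ((hX.leftExtended_toUpperHalf hD _).comp (hY.rightExtended_toMesh hD X)))
  have h2 := ((((linearToMeshIso D n).app X).homFromEquiv.trans
    ((linearToMeshIso D n).app Y).homToEquiv).bijective).comp h1
  convert h2 using 2 with g
  simp only [Function.comp_apply, Equiv.trans_apply]
  exact (NatIso.naturality_1 (linearToMeshIso D n) g).symm.trans (Category.assoc _ _ _).symm

/-- Every diagram on `A_n` extends to an exact diagram on the mesh category. -/
theorem exists_isExactMesh (W : D.dia (linear n)) : ∃ X : D.dia (mesh n), D.IsExactMesh n X ∧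
    Nonempty (W ≅ (D.restr (linearToMesh n)).obj X) := by
  have := hD.pointed
  obtain ⟨X₁, h₁, ⟨e₁⟩⟩ := hD.isDerivator.exists_rightExtended (toFringe n) W
  obtain ⟨X₂, h₂, ⟨e₂⟩⟩ := hD.isDerivator.exists_leftExtended (toFrame n) X₁
  obtain ⟨X₃, h₃, ⟨e₃⟩⟩ := hD.isDerivator.exists_leftExtended (toUpperHalf n) X₂
  obtain ⟨X₄, h₄, ⟨e₄⟩⟩ := hD.isDerivator.exists_rightExtended (toMesh n) X₃
  -- the first two extensions vanish at the new vertices, since no morphisms lead from them to the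
  -- domain (first step) or from the domain to them (second step)
  have z₁ (x : Mesh n) (hx : x ∈ fringe n) (hx' : x.l = 0 ∨ x.l = n + 1) : Limits.IsZero
      ((D.restr (point (A := shape (fringe n)) ⟨⟨x, hx⟩⟩)).obj X₁) :=
    isZero_of_isTerminal (hD.isDerivator.isTerminal_of_isCouniversal (h₁.isCouniversal (𝟙 _))
      (⟨⟨x, hx⟩⟩ : Shape (fringe n)) fun a => ⟨fun g => by
        obtain ⟨l, hl⟩ := mem_range_of_le (le_of_shape_hom g)
        have hl' : x.l = l.val + 1 := congrArg (fun x => x.val.l) hl.symm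
        have := l.isLt
        omega⟩).some
  have z₂ (x : Mesh n) (hx : x ∈ frame n) (hx' : x.l = 0 ∨ x.l = n + 1) : Limits.IsZero
      ((D.restr (point (A := shape (frame n)) ⟨⟨x, hx⟩⟩)).obj X₂) := by
    by_cases h : x ∈ fringe n
    · exact (isZero_point_restr_iff (toFrame n) (⟨⟨x, h⟩⟩ : Shape (fringe n))).1
        ((z₁ x h hx').of_iso ((D.restr _).mapIso e₂.symm))
    · exact isZero_of_isInitial (hD.isDerivator.isInitial_of_isUniversal (h₂.isUniversal (𝟙 _))
        (⟨⟨x, hx⟩⟩ : Shape (frame n)) fun a => ⟨fun g =>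
          not_le_of_mem_fringe a.val.prop hx h (le_of_shape_hom g)⟩).some
  have z₄ (x : Mesh n) (hx' : x.l = 0 ∨ x.l = n + 1) : Limits.IsZero
      ((D.restr (point (A := mesh n) ⟨x⟩)).obj X₄) := by
    have hx : x ∈ frame n := Or.inr hx'
    have z₃ := (isZero_point_restr_iff (toUpperHalf n) (⟨⟨x, hx⟩⟩ : Shape (frame n))).1
        ((z₂ x hx hx').of_iso ((D.restr _).mapIso e₃.symm))
    exact (isZero_point_restr_iff (toMesh n) (⟨⟨x, frame_subset n hx⟩⟩ : Shape (upperHalf n))).1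
        (z₃.of_iso ((D.restr _).mapIso e₄.symm))
  refine ⟨X₄, ⟨fun k => z₄ _ (Or.inl rfl), fun k => z₄ _ (Or.inr rfl), fun k l => ?_⟩, ⟨?_⟩⟩
  · obtain hk | hk := lt_or_ge k 0
    · exact hD.isBicartesian_of_isCartesian
        (hD.isDerivator.isCartesian_square_of_rightExtended h₄ hk l)
    · have h := hD.isDerivator.isCocartesian_square_of_leftExtended h₃ hk l
      refine (hD.isBicartesian_of_isCocartesian h).of_iso ((D.restr _).mapIso e₄ ≪≫ ?_)
      exact (restr_restr (shapeMap (squareUpper hk l) (monotone_squareUpper hk l)) (toMesh n)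
        (shapeMap (Mesh.square k l) (monotone_square k l)) (Iso.refl _) X₄).some
  · exact e₁ ≪≫ (D.restr _).mapIso (e₂ ≪≫ (D.restr _).mapIso (e₃ ≪≫ (D.restr _).mapIso e₄)) ≪≫
      (linearToMeshIso D n).app X₄

end
end Prederivator

/-! ### Diagrams with parameters -/

namespace Prederivator

open Functor

section

variable {D : Prederivator.{w, v, u}} {A B J : Cat.{w, w}}

/-- The slice of `B × J` at an object `b` of `B`. -/
def slice (b : B) (J : Cat.{w, w}) : J ⟶ prod B J :=
  (((Functor.const J).obj b).prod' (𝟭 J)).toCatHom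

instance (u : A ⟶ J) [u.toFunctor.Full] : (prodMap (𝟙 B) u).toFunctor.Full :=
  ⟨fun {x y} f => ⟨((f.1, u.toFunctor.preimage f.2) : (x.1, x.2) ⟶ (y.1, y.2)),
    Prod.ext rfl (u.toFunctor.map_preimage f.2)⟩⟩

instance (u : A ⟶ J) [u.toFunctor.Faithful] : (prodMap (𝟙 B) u).toFunctor.Faithful :=
  ⟨fun h => Prod.ext (congrArg (fun t => t.1) h)
    (u.toFunctor.map_injective (congrArg (fun t => t.2) h))⟩

/-- Slices are compatible with functors in the second variable. -/
def sliceComp (b : B) (u : A ⟶ J) : slice b A ≫ prodMap (𝟙 B) u ≅ u ≫ slice b J :=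
  Cat.Hom.isoMk (NatIso.ofComponents (fun a => Iso.refl ((b, u.toFunctor.obj a) : B × J))
    fun f => Prod.ext (by simp : 𝟙 b ≫ 𝟙 b = 𝟙 b ≫ 𝟙 b)
      (by simp : u.toFunctor.map f ≫ 𝟙 _ = 𝟙 _ ≫ u.toFunctor.map f))

theorem initialFactorization_sliceComp (b : B) (u : A ⟶ J) :
    InitialFactorization (sliceComp b u).hom := by
  rintro ⟨b', a⟩ (j : J) ⟨(g₁ : b' ⟶ b), (g₂ : u.toFunctor.obj a ⟶ j)⟩
  refine ⟨a, (g₁, 𝟙 a), g₂, Prod.ext (by simp : g₁ ≫ 𝟙 b ≫ 𝟙 b = g₁)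
    (by simp : u.toFunctor.map (𝟙 a) ≫ 𝟙 _ ≫ g₂ = g₂), ?_⟩
  rintro (a' : A) ⟨(m₁ : b' ⟶ b), (m₂ : a ⟶ a')⟩ (h : u.toFunctor.obj a' ⟶ j) e
  have e₁ : m₁ ≫ 𝟙 b ≫ 𝟙 b = g₁ := congrArg (fun t => t.1) e
  have e₂ : u.toFunctor.map m₂ ≫ 𝟙 _ ≫ h = g₂ := congrArg (fun t => t.2) e
  refine ⟨m₂, ⟨Prod.ext (by simpa using e₁.symm : g₁ ≫ 𝟙 b = m₁) (Category.id_comp m₂),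
    (by simpa using e₂ : u.toFunctor.map m₂ ≫ h = g₂)⟩, fun t ht => ?_⟩
  exact (Category.id_comp t).symm.trans (congrArg (fun t => t.2) ht.1)

theorem terminalFactorization_sliceComp (b : B) (u : A ⟶ J) :
    TerminalFactorization (sliceComp b u).inv := by
  rintro (j : J) ⟨b', a⟩ ⟨(g₁ : b ⟶ b'), (g₂ : j ⟶ u.toFunctor.obj a)⟩
  refine ⟨a, g₂, (g₁, 𝟙 a), Prod.ext (by simp : 𝟙 b ≫ 𝟙 b ≫ g₁ = g₁)
    (by simp : g₂ ≫ 𝟙 _ ≫ u.toFunctor.map (𝟙 a) = g₂), ?_⟩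
  rintro (a' : A) (m : j ⟶ u.toFunctor.obj a') ⟨(h₁ : b ⟶ b'), (h₂ : a' ⟶ a)⟩ e
  have e₁ : 𝟙 b ≫ 𝟙 b ≫ h₁ = g₁ := congrArg (fun t => t.1) e
  have e₂ : m ≫ 𝟙 _ ≫ u.toFunctor.map h₂ = g₂ := congrArg (fun t => t.2) e
  refine ⟨h₂, ⟨(by simpa using e₂ : m ≫ u.toFunctor.map h₂ = g₂),
    Prod.ext (by simpa using e₁.symm : 𝟙 b ≫ g₁ = h₁) (Category.comp_id h₂)⟩, fun t ht => ?_⟩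
  exact (Category.comp_id t).symm.trans (congrArg (fun t => t.2) ht.2)

/-- A point of a product, as a point of a slice. -/
def pointSlice (b : B) (j : J) : (point j).toFunctor ⋙ (slice b J).toFunctor ≅
    (point (A := prod B J) (b, j)).toFunctor :=
  pointComp (slice b J) j

namespace IsDerivator

variable (hD : D.IsDerivator)
include hD

/-- Left extended diagrams with parameters are detected on slices. -/
theorem leftExtended_prod_iff (u : A ⟶ J) [u.toFunctor.Full] [u.toFunctor.Faithful]
    {X : D.dia (prod B J)} : (D.restr (prodMap (𝟙 B) u)).LeftExtended X ↔
      ∀ b : B, (D.restr u).LeftExtended ((D.restr (slice b J)).obj X) := by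
  refine ⟨fun h b => hD.leftExtended_restr (initialFactorization_sliceComp b u) h, fun h => ?_⟩
  refine hD.leftExtended_of_comparison _ fun V c hV hc => ?_
  rintro ⟨b, j⟩
  refine (isIso_restr_restr_iff (pointSlice b j) c).1 ?_
  have h1 := hD.leftExtended_restr (initialFactorization_sliceComp b u) hV
  have h2 : IsIso ((D.restr (slice b A)).map ((D.restr (prodMap (𝟙 B) u)).map c)) := inferInstance
  have h3 : IsIso ((D.restr u).map ((D.restr (slice b J)).map c)) :=
    (NatIso.isIso_map_iff ((D.restrComp _ _).symm ≪≫ D.cellIso (sliceComp b u) ≪≫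
      D.restrComp _ _) c).1 h2
  have h4 := h1.isIso (h b) ((D.restr (slice b J)).map c)
  infer_instance

/-- Right extended diagrams with parameters are detected on slices. -/
theorem rightExtended_prod_iff (u : A ⟶ J) [u.toFunctor.Full] [u.toFunctor.Faithful]
    {X : D.dia (prod B J)} : (D.restr (prodMap (𝟙 B) u)).RightExtended X ↔
      ∀ b : B, (D.restr u).RightExtended ((D.restr (slice b J)).obj X) := by
  refine ⟨fun h b => hD.rightExtended_restr (terminalFactorization_sliceComp b u) h, fun h => ?_⟩
  refine hD.rightExtended_of_comparison _ fun V c hV hc => ?_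
  rintro ⟨b, j⟩
  refine (isIso_restr_restr_iff (pointSlice b j) c).1 ?_
  have h1 := hD.rightExtended_restr (terminalFactorization_sliceComp b u) hV
  have h2 : IsIso ((D.restr (slice b A)).map ((D.restr (prodMap (𝟙 B) u)).map c)) := inferInstance
  have h3 : IsIso ((D.restr u).map ((D.restr (slice b J)).map c)) :=
    (NatIso.isIso_map_iff ((D.restrComp _ _).symm ≪≫ D.cellIso (sliceComp b u) ≪≫
      D.restrComp _ _) c).1 h2
  have h4 := (h b).isIso h1 ((D.restr (slice b J)).map c)
  infer_instance

theorem isCocartesian_exp_iff {X : D.dia (prod B (shape Sq))} :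
    (Prederivator.exp B D).IsCocartesian X ↔
      ∀ b : B, D.IsCocartesian ((D.restr (slice b _)).obj X) := by
  simp only [hD.isCocartesian_iff]
  exact (hD.exp B).isCocartesian_iff.trans (hD.leftExtended_prod_iff spanIncl)

theorem isCartesian_exp_iff {X : D.dia (prod B (shape Sq))} :
    (Prederivator.exp B D).IsCartesian X ↔
      ∀ b : B, D.IsCartesian ((D.restr (slice b _)).obj X) := by
  simp only [hD.isCartesian_iff]
  exact (hD.exp B).isCartesian_iff.trans (hD.rightExtended_prod_iff cospanIncl)

end IsDerivator

namespace IsStable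

variable (hD : D.IsStable)
include hD

theorem exp (B : Cat.{w, w}) : (Prederivator.exp B D).IsStable where
  isDerivator := hD.isDerivator.exp B
  pointed := hD.hasZeroObject (prod B pt)
  cocartesian_iff _ := (hD.isDerivator.isCocartesian_exp_iff (B := B)).trans
    ((forall_congr' fun _ => hD.cocartesian_iff _).trans
      (hD.isDerivator.isCartesian_exp_iff (B := B)).symm)

theorem isBicartesian_exp_iff {X : D.dia (prod B (shape Sq))} :
    (Prederivator.exp B D).IsBicartesian X ↔
      ∀ b : B, D.IsBicartesian ((D.restr (slice b _)).obj X) :=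
  (and_congr (hD.isDerivator.isCocartesian_exp_iff (B := B))
    (hD.isDerivator.isCartesian_exp_iff (B := B))).trans forall_and.symm

theorem isZero_iff {X : D.dia A} :
    Limits.IsZero X ↔ ∀ a : A, Limits.IsZero ((D.restr (point a)).obj X) :=
  ⟨fun h _ => hD.isDerivator.restr_isZero _ h, hD.isZero_of_points⟩

/-- The two ways to express exactness of a diagram on the mesh category with parameters. -/
theorem isMeshExact_iff {n : ℕ} {X : D.dia (prod (mesh n) B)} :
    D.IsMeshExact n (op B) X ↔ (Prederivator.exp B D).IsExactMesh n
      ((D.restr (CategoryTheory.Prod.swap B (mesh n)).toCatHom).obj X) := by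
  have key (m : Mesh n) : (∀ b : B, Limits.IsZero
      ((D.restr (point (A := prod (mesh n) B) (⟨m⟩, b))).obj X)) ↔
      Limits.IsZero ((D.restr (prodMap (𝟙 B) (point (A := mesh n) ⟨m⟩))).obj
        ((D.restr (CategoryTheory.Prod.swap B (mesh n)).toCatHom).obj X)) := by
    rw [hD.isZero_iff]
    constructor
    · rintro h ⟨b, ⟨⟨⟩⟩⟩
      exact (isZero_point_restr_iff _ _).2 ((isZero_point_restr_iff _ _).2 (h b))
    · intro h b
      exact (isZero_point_restr_iff _ _).1 ((isZero_point_restr_iff _ _).1 (h (b, ⟨⟨⟩⟩)))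
  have key' (k : ℤ) (l : Fin n) : (∀ b : B, D.IsBicartesian ((D.restr (meshSquare k l b)).obj X)) ↔
      (Prederivator.exp B D).IsBicartesian ((D.restr (prodMap (𝟙 B)
        (shapeMap (Mesh.square k l) (Mesh.monotone_square k l)))).obj
          ((D.restr (CategoryTheory.Prod.swap B (mesh n)).toCatHom).obj X)) := by
    refine Iff.trans (forall_congr' fun b => ?_) hD.isBicartesian_exp_iff.symm
    have e : (slice b (shape Sq) ≫ prodMap (𝟙 B) (shapeMap (Mesh.square k l)
        (Mesh.monotone_square k l))) ≫ (CategoryTheory.Prod.swap B (mesh n)).toCatHom ≅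
          meshSquare k l b :=
      Cat.Hom.isoMk (NatIso.ofComponents (fun s => Iso.refl
        ((⟨Mesh.square k l s.val⟩, b) : mesh n × B)) fun f => Prod.ext (shape_hom_eq _ _)
          (by simp : 𝟙 b ≫ 𝟙 b = 𝟙 b ≫ 𝟙 b))
    have i := (D.restrComp (slice b (shape Sq)) (prodMap (𝟙 B) (shapeMap (Mesh.square k l)
      (Mesh.monotone_square k l)))).symm.app
        ((D.restr (CategoryTheory.Prod.swap B (mesh n)).toCatHom).obj X) ≪≫
        ((D.restrComp _ _).symm ≪≫ D.cellIso e).app X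
    exact ⟨fun h => h.of_iso i.symm, fun h => h.of_iso i⟩
  constructor
  · rintro ⟨h₁, h₂, h₃⟩
    exact ⟨fun k => (key _).1 fun b => h₁ b k, fun k => (key _).1 fun b => h₂ b k,
      fun k l => (key' k l).1 fun b => h₃ b k l⟩
  · rintro ⟨h₁, h₂, h₃⟩
    exact ⟨fun b k => (key _).2 (h₁ k) b, fun b k => (key _).2 (h₂ k) b,
      fun b k l => (key' k l).2 (h₃ k l) b⟩

end IsStable

end
end Prederivator

/-! ### Restriction of exact diagrams to `A_n` -/

namespace Prederivator

open Functor

/-- A functor which is an equivalence, as an equivalence in `Cat`. -/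
theorem exists_equivalence_of_isEquivalence {C C' : Cat.{v, u}} (F : C ⟶ C')
    [F.toFunctor.IsEquivalence] : ∃ e : Bicategory.Equivalence C C', e.hom = F :=
  ⟨Bicategory.Equivalence.mkOfAdjointifyCounit (f := F) (g := F.toFunctor.inv.toCatHom)
    (Cat.Hom.isoMk F.toFunctor.asEquivalence.unitIso)
    (Cat.Hom.isoMk F.toFunctor.asEquivalence.counitIso), rfl⟩

/-- A morphism of prederivators whose components are equivalences is an equivalence. -/
theorem exists_equivalence_of_level {P Q : Prederivator.{w, v, u}} (F : P ⟶ Q)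
    (h : ∀ A, (level F A).IsEquivalence) : ∃ e : Bicategory.Equivalence P Q, e.hom = F :=
  Pseudofunctor.StrongTrans.exists_equivalence F fun A =>
    have := h A.unop
    exists_equivalence_of_isEquivalence (F.app A)

variable {D : Prederivator.{w, v, u}}

/-- Interchanging the factors in the restriction along `i × B`. -/
def swapRestr {A J : Cat.{w, w}} (u : A ⟶ J) (B : Cat.{w, w}) :
    D.restr (prodMap u (𝟙 B)) ⋙ D.restr (CategoryTheory.Prod.swap B A).toCatHom ≅
      D.restr (CategoryTheory.Prod.swap B J).toCatHom ⋙ D.restr (prodMap (𝟙 B) u) :=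
  have e : CategoryTheory.Prod.swap B A ⋙ (prodMap u (𝟙 B)).toFunctor ≅
      (prodMap (𝟙 B) u).toFunctor ⋙ CategoryTheory.Prod.swap B J :=
    NatIso.ofComponents (fun x => Iso.refl ((u.toFunctor.obj x.2, x.1) : J × B))
      fun f => Prod.ext (by simp : u.toFunctor.map f.2 ≫ 𝟙 _ = 𝟙 _ ≫ u.toFunctor.map f.2)
        (by simp : f.1 ≫ 𝟙 _ = 𝟙 _ ≫ f.1)
  (D.restrComp (CategoryTheory.Prod.swap B A).toCatHom _).symm ≪≫
    D.cellIso (Cat.Hom.isoMk e) ≪≫ D.restrComp _ (CategoryTheory.Prod.swap B J).toCatHom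

instance (A B : Cat.{w, w}) : (D.restr (CategoryTheory.Prod.swap A B).toCatHom).IsEquivalence :=
  have : (CategoryTheory.Prod.swap A B).toCatHom.toFunctor.IsEquivalence :=
    inferInstanceAs (CategoryTheory.Prod.swap A B).IsEquivalence
  D.isEquivalence_restr _

theorem IsExactMesh.of_iso {n : ℕ} {X Y : D.dia (mesh n)} (h : D.IsExactMesh n X) (e : X ≅ Y) :
    D.IsExactMesh n Y :=
  ⟨fun k => (h.lower k).of_iso ((D.restr _).mapIso e.symm),
    fun k => (h.upper k).of_iso ((D.restr _).mapIso e.symm),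
    fun k l => (h.square k l).of_iso ((D.restr _).mapIso e)⟩

namespace IsStable

variable (hD : D.IsStable) (n : ℕ)
include hD

/-- The components of the restriction from exact diagrams on the mesh category are equivalences,
by the case without parameters applied to `D^B`. -/
theorem isEquivalence_level_meshRestr (B : Cat.{w, w}) :
    (level (meshRestr D n) B).IsEquivalence := by
  let P : ObjectProperty (D.dia (prod (mesh n) B)) := D.IsMeshExact n (op B)
  let R := D.restr (prodMap (linearToMesh n) (𝟙 B))
  let S := D.restr (CategoryTheory.Prod.swap B (mesh n)).toCatHom
  let T := D.restr (CategoryTheory.Prod.swap B (linear n)).toCatHom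
  let R' : D.dia (prod B (mesh n)) ⥤ D.dia (prod B (linear n)) :=
    D.restr (prodMap (𝟙 B) (linearToMesh n))
  have hP (X : P.FullSubcategory) : (Prederivator.exp B D).IsExactMesh n (S.obj X.obj) :=
    hD.isMeshExact_iff.1 X.property
  have hK (X Y : P.FullSubcategory) :
      Function.Bijective fun g : X ⟶ Y => (P.ι ⋙ S ⋙ R').map g :=
    (IsExactMesh.bijective_restr_map (hD.exp B) (hP X) (hP Y)).comp
      ((FullyFaithful.ofFullyFaithful S).homEquiv.bijective.comp
        P.fullyFaithfulι.homEquiv.bijective)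
  have : (P.ι ⋙ S ⋙ R').IsEquivalence :=
    { faithful := ⟨fun {X Y} _ _ h => (hK X Y).1 h⟩
      full := ⟨fun {X Y} => (hK X Y).2⟩
      essSurj := ⟨fun W => by
        obtain ⟨X, hX, ⟨e⟩⟩ := exists_isExactMesh (D := Prederivator.exp B D) (hD.exp B) W
        let X' : D.dia (prod (mesh n) B) := S.objPreimage X
        have i : S.obj X' ≅ X := S.objObjPreimageIso X
        have hX' : D.IsMeshExact n (op B) X' := hD.isMeshExact_iff.2 (hX.of_iso i.symm)
        exact ⟨⟨X', hX'⟩, ⟨R'.mapIso i ≪≫ e.symm⟩⟩⟩ }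
  have h1 : ((P.ι ⋙ R) ⋙ T).IsEquivalence :=
    isEquivalence_of_iso (isoWhiskerLeft P.ι (swapRestr (linearToMesh n) B).symm)
  exact isEquivalence_of_comp_right (P.ι ⋙ R) T

theorem exists_equivalence_meshRestr : ∃ e : Bicategory.Equivalence (meshEx D n)
    (Prederivator.exp (linear n) D), e.hom = meshRestr D n :=
  exists_equivalence_of_level _ (hD.isEquivalence_level_meshRestr n)

theorem isDerivator_meshEx : (meshEx D n).IsDerivator :=
  have := hD.isEquivalence_level_meshRestr n
  IsDerivator.of_isEquivalence (meshRestr D n) (hD.isDerivator.exp (linear n))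

end IsStable
end Prederivator

/-! ### Kan extensions of exact diagrams on the mesh category -/

namespace CategoryTheory.Functor

section

variable {C₁ : Type u₁} {C₂ : Type u₂} {D₁ : Type u₁} {D₂ : Type u₂} [Category.{v₁} C₁]
  [Category.{v₂} C₂] [Category.{v₁} D₁] [Category.{v₂} D₂]

/-- If `β` and its mate are invertible, the left adjoint of `R₁` carries objects which are left
extended for `G` to objects which are left extended for `H`. -/
theorem PreservesUniversal.leftExtended {R₁ : D₁ ⥤ C₁} {H : D₁ ⥤ D₂} {G : C₁ ⥤ C₂} {R₂ : D₂ ⥤ C₂}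
    {β : R₁ ⋙ G ⟶ H ⋙ R₂} [IsIso β] (hβ : PreservesUniversal β) {X : C₁} {U : D₁}
    {η : X ⟶ R₁.obj U} (hη : R₁.IsUniversal η) (hX : G.LeftExtended X) :
    H.LeftExtended U := fun Z => by
  rw [← Function.Bijective.of_comp_iff' (hβ η hη (H.obj Z))]
  have h : Function.Bijective fun g : U ⟶ Z => G.map (η ≫ R₁.map g) ≫ β.app Z :=
    ((asIso (β.app Z)).homToEquiv.bijective.comp (hX (R₁.obj Z))).comp (hη Z)
  rwa [funext fun g : U ⟶ Z => map_comp_comp_app β η g] at h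

theorem PreservesCouniversal.rightExtended {G : C₁ ⥤ C₂} {L₁ : C₁ ⥤ D₁} {L₂ : C₂ ⥤ D₂}
    {H : D₁ ⥤ D₂} {γ : G ⋙ L₂ ⟶ L₁ ⋙ H} [IsIso γ] (hγ : PreservesCouniversal γ) {X : D₁} {U : C₁}
    {ξ : L₁.obj U ⟶ X} (hξ : L₁.IsCouniversal ξ) (hX : H.RightExtended X) :
    G.RightExtended U := fun Z => by
  rw [← Function.Bijective.of_comp_iff' (hγ ξ hξ (G.obj Z))]
  have h : Function.Bijective fun g : Z ⟶ U => γ.app Z ≫ H.map (L₁.map g ≫ ξ) :=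
    ((asIso (γ.app Z)).homFromEquiv.symm.bijective.comp (hX (L₁.obj Z))).comp (hξ Z)
  rwa [funext fun g : Z ⟶ U => app_comp_map_comp γ ξ g] at h

theorem leftExtended_of_isZero {R : D₁ ⥤ C₁} {U : D₁} (h : Limits.IsZero U)
    (h' : Limits.IsZero (R.obj U)) : R.LeftExtended U := fun Z =>
  ⟨fun _ _ _ => h.eq_of_src _ _, fun _ => ⟨h.to_ Z, h'.eq_of_src _ _⟩⟩

theorem isInitial_of_isUniversal {R : D₁ ⥤ C₁} {X : C₁} {U : D₁} {η : X ⟶ R.obj U}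
    (h : R.IsUniversal η) (hX : Limits.IsZero X) : Nonempty (Limits.IsInitial U) :=
  ⟨Limits.IsInitial.ofUniqueHom (fun Z => ((h Z).2 (hX.to_ _)).choose)
    fun Z _ => (h Z).1 (hX.eq_of_src _ _)⟩

theorem isTerminal_of_isCouniversal {R : D₁ ⥤ C₁} {X : C₁} {U : D₁} {ξ : R.obj U ⟶ X}
    (h : R.IsCouniversal ξ) (hX : Limits.IsZero X) : Nonempty (Limits.IsTerminal U) :=
  ⟨Limits.IsTerminal.ofUniqueHom (fun Z => ((h Z).2 (hX.from_ _)).choose)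
    fun Z _ => (h Z).1 (hX.eq_of_tgt _ _)⟩

end

end CategoryTheory.Functor

namespace Prederivator

open Functor

section

variable {A B C J : Cat.{w, w}}

/-- The functor `(a, c) ↦ (f c, a)`. -/
def flip (f : C ⟶ J) (A : Cat.{w, w}) : prod A C ⟶ prod J A :=
  ((CategoryTheory.Prod.snd A C ⋙ f.toFunctor).prod' (CategoryTheory.Prod.fst A C)).toCatHom

/-- The functors `flip f` are natural. -/
def flipComp (f : C ⟶ J) (t : A ⟶ B) :
    flip f A ≫ prodMap (𝟙 J) t ≅ prodMap t (𝟙 C) ≫ flip f B :=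
  Cat.Hom.isoMk (NatIso.ofComponents
    (fun x => Iso.refl ((f.toFunctor.obj x.2, t.toFunctor.obj x.1) : J × B))
    fun g => Prod.ext (by simp : f.toFunctor.map g.2 ≫ 𝟙 _ = 𝟙 _ ≫ f.toFunctor.map g.2)
      (by simp : t.toFunctor.map g.1 ≫ 𝟙 _ = 𝟙 _ ≫ t.toFunctor.map g.1))

/-- The two ways to compose `t × C` and `A × s`. -/
def interchange (s : C ⟶ J) (t : A ⟶ B) :
    prodMap (𝟙 A) s ≫ prodMap t (𝟙 J) ≅ prodMap t (𝟙 C) ≫ prodMap (𝟙 B) s :=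
  Cat.Hom.isoMk (NatIso.ofComponents
    (fun x => Iso.refl ((t.toFunctor.obj x.1, s.toFunctor.obj x.2) : B × J))
    fun g => Prod.ext (by simp : t.toFunctor.map g.1 ≫ 𝟙 _ = 𝟙 _ ≫ t.toFunctor.map g.1)
      (by simp : s.toFunctor.map g.2 ≫ 𝟙 _ = 𝟙 _ ≫ s.toFunctor.map g.2))

variable {α β : Type} [PartialOrder α] [PartialOrder β]

/-- If the vertices below the image of `f` have reflections in the sense of `h`, left Kan extension
in the parameter commutes with restriction along `f`. -/
theorem initialFactorization_flipComp {f : α → β} (hf : Monotone f) (t : A ⟶ B)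
    (h : ∀ y s, y ≤ f s → ∃ s₀, y ≤ f s₀ ∧ s₀ ≤ s ∧ ∀ s', y ≤ f s' → s₀ ≤ s') :
    InitialFactorization (flipComp (shapeMap.{w} f hf) t).hom := by
  rintro ⟨(y : shape β), (a : A)⟩ ⟨(b : B), (s : shape α)⟩
    ⟨(g₁ : y ⟶ (shapeMap f hf).toFunctor.obj s), (g₂ : t.toFunctor.obj a ⟶ b)⟩
  obtain ⟨s₀, h₁, h₂, h₃⟩ := h y.val s.val (le_of_shape_hom g₁)
  refine ⟨(a, ⟨s₀⟩), (shapeHom h₁, 𝟙 a), (g₂, shapeHom h₂), Prod.ext (shape_hom_eq _ _)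
    (by simp : t.toFunctor.map (𝟙 a) ≫ 𝟙 _ ≫ g₂ = g₂), ?_⟩
  rintro ⟨(a' : A), (s' : shape α)⟩ ⟨(m₁ : y ⟶ (shapeMap f hf).toFunctor.obj s'), (m₂ : a ⟶ a')⟩
    ⟨(k₁ : t.toFunctor.obj a' ⟶ b), (k₂ : s' ⟶ s)⟩ e
  have e₂ : t.toFunctor.map m₂ ≫ 𝟙 _ ≫ k₁ = g₂ := congrArg (fun t => t.2) e
  refine ⟨(m₂, shapeHom (h₃ s'.val (le_of_shape_hom m₁))), ⟨Prod.ext (shape_hom_eq _ _)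
    (Category.id_comp m₂), Prod.ext (by simpa using e₂ : t.toFunctor.map m₂ ≫ k₁ = g₂)
      (shape_hom_eq _ _)⟩, fun r hr => Prod.ext ?_ (shape_hom_eq _ _)⟩
  exact (Category.id_comp r.1).symm.trans (congrArg (fun t => t.2) hr.1)

/-- If the vertices above the image of `f` have coreflections in the sense of `h`, right Kan
extension in the parameter commutes with restriction along `f`. -/
theorem terminalFactorization_flipComp {f : α → β} (hf : Monotone f) (t : A ⟶ B)
    (h : ∀ y s, f s ≤ y → ∃ s₀, f s₀ ≤ y ∧ s ≤ s₀ ∧ ∀ s', f s' ≤ y → s' ≤ s₀) :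
    TerminalFactorization (flipComp (shapeMap.{w} f hf) t).inv := by
  rintro ⟨(b : B), (s : shape α)⟩ ⟨(y : shape β), (a : A)⟩
    ⟨(g₁ : (shapeMap f hf).toFunctor.obj s ⟶ y), (g₂ : b ⟶ t.toFunctor.obj a)⟩
  obtain ⟨s₀, h₁, h₂, h₃⟩ := h y.val s.val (le_of_shape_hom g₁)
  refine ⟨(a, ⟨s₀⟩), (g₂, shapeHom h₂), (shapeHom h₁, 𝟙 a), Prod.ext (shape_hom_eq _ _)
    (by simp : g₂ ≫ 𝟙 _ ≫ t.toFunctor.map (𝟙 a) = g₂), ?_⟩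
  rintro ⟨(a' : A), (s' : shape α)⟩ ⟨(k₁ : b ⟶ t.toFunctor.obj a'), (k₂ : s ⟶ s')⟩
    ⟨(m₁ : (shapeMap f hf).toFunctor.obj s' ⟶ y), (m₂ : a' ⟶ a)⟩ e
  have e₂ : k₁ ≫ 𝟙 _ ≫ t.toFunctor.map m₂ = g₂ := congrArg (fun t => t.2) e
  refine ⟨(m₂, shapeHom (h₃ s'.val (le_of_shape_hom m₁))), ⟨Prod.ext
    (by simpa using e₂ : k₁ ≫ t.toFunctor.map m₂ = g₂) (shape_hom_eq _ _),
      Prod.ext (shape_hom_eq _ _) (Category.comp_id m₂)⟩,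
        fun r hr => Prod.ext ?_ (shape_hom_eq _ _)⟩
  exact (Category.comp_id r.1).symm.trans (congrArg (fun t => t.2) hr.2)

/-- Left Kan extension in one variable commutes with restriction to a subset which is closed
downwards in the other one. -/
theorem initialFactorization_interchange {f : α → β} (hf : Monotone f) (t : A ⟶ B)
    (h : ∀ x s, x ≤ f s → ∃ s₀, f s₀ = x) (h' : ∀ s s', f s ≤ f s' → s ≤ s') :
    InitialFactorization (interchange (shapeMap.{w} f hf) t).hom := by
  rintro ⟨(a : A), (y : shape β)⟩ ⟨(b : B), (s : shape α)⟩
    ⟨(g₂ : t.toFunctor.obj a ⟶ b), (g₁ : y ⟶ (shapeMap f hf).toFunctor.obj s)⟩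
  obtain ⟨s₀, h₀⟩ := h y.val s.val (le_of_shape_hom g₁)
  have hs : f s₀ ≤ f s.val := h₀ ▸ le_of_shape_hom g₁
  refine ⟨(a, ⟨s₀⟩), (𝟙 a, shapeHom h₀.ge), (g₂, shapeHom (h' _ _ hs)), Prod.ext
    (by simp : t.toFunctor.map (𝟙 a) ≫ 𝟙 _ ≫ g₂ = g₂) (shape_hom_eq _ _), ?_⟩
  rintro ⟨(a' : A), (s' : shape α)⟩ ⟨(m₂ : a ⟶ a'), (m₁ : y ⟶ (shapeMap f hf).toFunctor.obj s')⟩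
    ⟨(k₁ : t.toFunctor.obj a' ⟶ b), (k₂ : s' ⟶ s)⟩ e
  have e₂ : t.toFunctor.map m₂ ≫ 𝟙 _ ≫ k₁ = g₂ := congrArg (fun t => t.1) e
  have hs' : f s₀ ≤ f s'.val := h₀ ▸ le_of_shape_hom m₁
  refine ⟨(m₂, shapeHom (h' _ _ hs')), ⟨Prod.ext (Category.id_comp m₂) (shape_hom_eq _ _),
    Prod.ext (by simpa using e₂ : t.toFunctor.map m₂ ≫ k₁ = g₂)
      (shape_hom_eq _ _)⟩, fun r hr => Prod.ext ?_ (shape_hom_eq _ _)⟩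
  exact (Category.id_comp r.1).symm.trans (congrArg (fun t => t.1) hr.1)

/-- Right Kan extension in one variable commutes with restriction to a subset which is closed
upwards in the other one. -/
theorem terminalFactorization_interchange {f : α → β} (hf : Monotone f) (t : A ⟶ B)
    (h : ∀ x s, f s ≤ x → ∃ s₀, f s₀ = x) (h' : ∀ s s', f s ≤ f s' → s ≤ s') :
    TerminalFactorization (interchange (shapeMap.{w} f hf) t).inv := by
  rintro ⟨(b : B), (s : shape α)⟩ ⟨(a : A), (y : shape β)⟩
    ⟨(g₂ : b ⟶ t.toFunctor.obj a), (g₁ : (shapeMap f hf).toFunctor.obj s ⟶ y)⟩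
  obtain ⟨s₀, h₀⟩ := h y.val s.val (le_of_shape_hom g₁)
  have hs : f s.val ≤ f s₀ := h₀ ▸ le_of_shape_hom g₁
  refine ⟨(a, ⟨s₀⟩), (g₂, shapeHom (h' _ _ hs)), (𝟙 a, shapeHom h₀.le), Prod.ext
    (by simp : g₂ ≫ 𝟙 _ ≫ t.toFunctor.map (𝟙 a) = g₂) (shape_hom_eq _ _), ?_⟩
  rintro ⟨(a' : A), (s' : shape α)⟩ ⟨(k₁ : b ⟶ t.toFunctor.obj a'), (k₂ : s ⟶ s')⟩
    ⟨(m₂ : a' ⟶ a), (m₁ : (shapeMap f hf).toFunctor.obj s' ⟶ y)⟩ e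
  have e₂ : k₁ ≫ 𝟙 _ ≫ t.toFunctor.map m₂ = g₂ := congrArg (fun t => t.1) e
  have hs' : f s'.val ≤ f s₀ := h₀ ▸ le_of_shape_hom m₁
  refine ⟨(m₂, shapeHom (h' _ _ hs')), ⟨Prod.ext
    (by simpa using e₂ : k₁ ≫ t.toFunctor.map m₂ = g₂) (shape_hom_eq _ _),
      Prod.ext (Category.comp_id m₂) (shape_hom_eq _ _)⟩,
        fun r hr => Prod.ext ?_ (shape_hom_eq _ _)⟩
  exact (Category.comp_id r.1).symm.trans (congrArg (fun t => t.1) hr.2)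

/-- A mesh square at `b`, as a slice of a family of mesh squares. -/
def sliceFlip {n : ℕ} (k : ℤ) (l : Fin n) (b : B) :
    (slice b (shape Sq)).toFunctor ⋙ (flip (shapeMap (Mesh.square k l)
      (Mesh.monotone_square k l)) B).toFunctor ≅ (meshSquare k l b).toFunctor :=
  NatIso.ofComponents (fun s => Iso.refl ((⟨Mesh.square k l s.val⟩, b) : mesh n × B))
    fun f => Prod.ext (shape_hom_eq _ _) (by simp : 𝟙 b ≫ 𝟙 b = 𝟙 b ≫ 𝟙 b)

end

namespace IsStable

variable {D : Prederivator.{w, v, u}} (hD : D.IsStable) {n : ℕ} {A B : Cat.{w, w}}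
include hD

/-- By stability, a family of mesh squares is bicartesian if it is a left Kan extension from the
span. -/
theorem isBicartesian_meshSquare_iff {X : D.dia (prod (mesh n) B)} (k : ℤ) (l : Fin n) :
    (∀ b : B, D.IsBicartesian ((D.restr (meshSquare k l b)).obj X)) ↔
      (D.restr (prodMap (𝟙 B) spanIncl)).LeftExtended ((D.restr (flip (shapeMap
        (Mesh.square k l) (Mesh.monotone_square k l)) B)).obj X) := by
  refine Iff.trans (forall_congr' fun b => ?_)
    (hD.isDerivator.leftExtended_prod_iff spanIncl).symm
  let i := (D.restrIso (sliceFlip k l b)).app X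
  refine Iff.trans ⟨fun h => (h.of_iso i.symm).1, fun h =>
    (hD.isBicartesian_of_isCocartesian h).of_iso i⟩ hD.isDerivator.isCocartesian_iff

/-- By stability, a family of mesh squares is bicartesian if it is a right Kan extension from the
cospan. -/
theorem isBicartesian_meshSquare_iff' {X : D.dia (prod (mesh n) B)} (k : ℤ) (l : Fin n) :
    (∀ b : B, D.IsBicartesian ((D.restr (meshSquare k l b)).obj X)) ↔
      (D.restr (prodMap (𝟙 B) cospanIncl)).RightExtended ((D.restr (flip (shapeMap
        (Mesh.square k l) (Mesh.monotone_square k l)) B)).obj X) := by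
  refine Iff.trans (forall_congr' fun b => ?_)
    (hD.isDerivator.rightExtended_prod_iff cospanIncl).symm
  let i := (D.restrIso (sliceFlip k l b)).app X
  refine Iff.trans ⟨fun h => (h.of_iso i.symm).2, fun h =>
    (hD.isBicartesian_of_isCartesian h).of_iso i⟩ hD.isDerivator.isCartesian_iff

theorem isZero_slice_iff {X : D.dia (prod (mesh n) B)} (m : mesh n) :
    Limits.IsZero ((D.restr (slice m B)).obj X) ↔
      ∀ b : B, Limits.IsZero ((D.restr (point (A := prod (mesh n) B) (m, b))).obj X) :=
  hD.isZero_iff.trans (forall_congr' fun b => isZero_point_restr_iff (slice m B) b)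

/-- Left Kan extensions of exact diagrams on the mesh category, in the direction of the parameters,
are exact. By base change the extension is computed vertexwise and squarewise, and zero objects as
well as families of cocartesian squares are preserved by left Kan extension. -/
theorem isMeshExact_of_isUniversal (t : A ⟶ B) {X : D.dia (prod (mesh n) A)}
    {U : D.dia (prod (mesh n) B)} {η : X ⟶ (D.restr (prodMap (𝟙 (mesh n)) t)).obj U}
    (hη : (D.restr (prodMap (𝟙 (mesh n)) t)).IsUniversal η) (hX : D.IsMeshExact n (op A) X) :
    D.IsMeshExact n (op B) U := by
  have := hD.hasZeroObject B
  have hz (m : mesh n) (h : Limits.IsZero ((D.restr (slice m A)).obj X)) :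
      Limits.IsZero ((D.restr (slice m B)).obj U) :=
    isZero_of_isInitial (isInitial_of_isUniversal (hD.isDerivator.preservesUniversal_square
      (initialFactorization_sliceComp m t) η hη) h).some
  refine ⟨fun b k => (hD.isZero_slice_iff _).1 (hz _ ((hD.isZero_slice_iff _).2
    fun a => hX.lower a k)) b, fun b k => (hD.isZero_slice_iff _).1 (hz _
      ((hD.isZero_slice_iff _).2 fun a => hX.upper a k)) b, fun b k l => ?_⟩
  refine (hD.isBicartesian_meshSquare_iff k l).2 ?_ b
  have h1 := hD.isDerivator.preservesUniversal_square (initialFactorization_flipComp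
    (Mesh.monotone_square k l) t fun y s h => ?_) η hη
  · exact (hD.isDerivator.preservesUniversal_square (initialFactorization_interchange
      (f := (Subtype.val : Span → Sq)) (fun _ _ h => h) t
      (fun x s h => ⟨⟨x, fun hx => s.prop (top_le_iff.1 (hx.ge.trans h))⟩, rfl⟩)
        fun _ _ h => h)).leftExtended h1
          ((hD.isBicartesian_meshSquare_iff k l).1 fun a => hX.square a k l)
  · by_cases hy : y = Mesh.square k l (1, 1)
    · subst hy
      exact ⟨(1, 1), le_rfl, (Mesh.square_le_square_iff k l).1 h,
        fun _ => (Mesh.square_le_square_iff k l).1⟩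
    · obtain ⟨s₀, -, h⟩ := Mesh.exists_least_square k l y s h hy
      exact ⟨s₀, h⟩

/-- Right Kan extensions of exact diagrams on the mesh category, in the direction of the parameters,
are exact. -/
theorem isMeshExact_of_isCouniversal (t : A ⟶ B) {X : D.dia (prod (mesh n) A)}
    {U : D.dia (prod (mesh n) B)} {ξ : (D.restr (prodMap (𝟙 (mesh n)) t)).obj U ⟶ X}
    (hξ : (D.restr (prodMap (𝟙 (mesh n)) t)).IsCouniversal ξ) (hX : D.IsMeshExact n (op A) X) :
    D.IsMeshExact n (op B) U := by
  have := hD.hasZeroObject B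
  have hz (m : mesh n) (h : Limits.IsZero ((D.restr (slice m A)).obj X)) :
      Limits.IsZero ((D.restr (slice m B)).obj U) :=
    isZero_of_isTerminal (isTerminal_of_isCouniversal (hD.isDerivator.preservesCouniversal_square
      (terminalFactorization_sliceComp m t) ξ hξ) h).some
  refine ⟨fun b k => (hD.isZero_slice_iff _).1 (hz _ ((hD.isZero_slice_iff _).2
    fun a => hX.lower a k)) b, fun b k => (hD.isZero_slice_iff _).1 (hz _
      ((hD.isZero_slice_iff _).2 fun a => hX.upper a k)) b, fun b k l => ?_⟩
  refine (hD.isBicartesian_meshSquare_iff' k l).2 ?_ b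
  have h1 := hD.isDerivator.preservesCouniversal_square (terminalFactorization_flipComp
    (Mesh.monotone_square k l) t fun y s h => ?_) ξ hξ
  · exact (hD.isDerivator.preservesCouniversal_square (terminalFactorization_interchange
      (f := (Subtype.val : Cospan → Sq)) (fun _ _ h => h) t
      (fun x s h => ⟨⟨x, fun hx => s.prop (le_bot_iff.1 (h.trans hx.le))⟩, rfl⟩)
        fun _ _ h => h)).rightExtended h1
          ((hD.isBicartesian_meshSquare_iff' k l).1 fun a => hX.square a k l)
  · by_cases hy : y = Mesh.square k l (0, 0)
    · subst hy
      exact ⟨(0, 0), le_rfl, (Mesh.square_le_square_iff k l).1 h,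
        fun _ => (Mesh.square_le_square_iff k l).1⟩
    · obtain ⟨s₀, -, h⟩ := Mesh.exists_greatest_square k l y s h hy
      exact ⟨s₀, h⟩

end IsStable

section

variable {D : Prederivator.{w, v, u}} {P : ∀ B : Cat.{w, w}ᵒᵖ, ObjectProperty (D.obj B)}
  (hP : Restricts D P) {A B : Cat.{w, w}}

/-- Universal arrows in a full subprederivator. -/
theorem isUniversal_sub (u : A ⟶ B) {X : (D.sub hP).dia A} {U : (D.sub hP).dia B}
    {η : X ⟶ ((D.sub hP).restr u).obj U} (h : (D.restr u).IsUniversal (U := U.obj) η.hom) :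
    ((D.sub hP).restr u).IsUniversal η := fun Z =>
  (Function.Bijective.of_comp_iff' ((P (op A)).fullyFaithfulι.homEquiv).bijective _).1
    ((h Z.obj).comp ((P (op B)).fullyFaithfulι.homEquiv).bijective)

theorem isCouniversal_sub (u : A ⟶ B) {X : (D.sub hP).dia A} {U : (D.sub hP).dia B}
    {ξ : ((D.sub hP).restr u).obj U ⟶ X} (h : (D.restr u).IsCouniversal (U := U.obj) ξ.hom) :
    ((D.sub hP).restr u).IsCouniversal ξ := fun Z =>
  (Function.Bijective.of_comp_iff' ((P (op A)).fullyFaithfulι.homEquiv).bijective _).1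
    ((h Z.obj).comp ((P (op B)).fullyFaithfulι.homEquiv).bijective)

/-- The inclusion of a full subprederivator which is closed under left Kan extension along `u`
preserves left Kan extensions along `u`. -/
theorem preservesUniversal_subIncl (u : A ⟶ B) [(D.restr u).IsRightAdjoint]
    (h : ∀ (X : D.dia A) (U : D.dia B) (η : X ⟶ (D.restr u).obj U), (D.restr u).IsUniversal η →
      P (op A) X → P (op B) U) :
    PreservesUniversal (commRestr (subIncl D hP) u).hom :=
  preservesUniversal_of_exists fun X => by
    obtain ⟨U, η, hη⟩ := exists_isUniversal (R := D.restr u) X.obj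
    exact ⟨⟨U, h _ _ η hη X.property⟩, ObjectProperty.homMk η, isUniversal_sub hP u hη,
      hη.congr (Category.comp_id _)⟩

/-- The inclusion of a full subprederivator which is closed under right Kan extension along `u`
preserves right Kan extensions along `u`. -/
theorem preservesCouniversal_subIncl (u : A ⟶ B) [(D.restr u).IsLeftAdjoint]
    (h : ∀ (X : D.dia A) (U : D.dia B) (ξ : (D.restr u).obj U ⟶ X), (D.restr u).IsCouniversal ξ →
      P (op A) X → P (op B) U) :
    PreservesCouniversal (commRestr (subIncl D hP) u).inv :=
  preservesCouniversal_of_exists fun X => by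
    obtain ⟨U, ξ, hξ⟩ := exists_isCouniversal (R := D.restr u) X.obj
    exact ⟨⟨U, h _ _ ξ hξ X.property⟩, ObjectProperty.homMk ξ, isCouniversal_sub hP u hξ,
      hξ.congr (Category.id_comp _)⟩

end

namespace IsStable

variable {D : Prederivator.{w, v, u}} (hD : D.IsStable) {n : ℕ} {B : Cat.{w, w}}
include hD

theorem isMeshExact_of_isZero {X : D.dia (prod (mesh n) B)} (hX : Limits.IsZero X) :
    D.IsMeshExact n (op B) X :=
  have h {A : Cat.{w, w}} (u : A ⟶ prod (mesh n) B) := hD.isDerivator.restr_isZero u hX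
  ⟨fun _ _ => h _, fun _ _ => h _, fun _ _ _ => hD.isBicartesian_of_isCocartesian
    (hD.isDerivator.isCocartesian_iff.2 (leftExtended_of_isZero (h _)
      (hD.isDerivator.restr_isZero _ (h _))))⟩

/-- Initial and terminal exact diagrams are zero objects, and pushouts and pullbacks of exact
diagrams are exact. -/
theorem isExact_meshIncl (n : ℕ) : IsExact (meshIncl D n) := by
  have hE := hD.isDerivator.exp (mesh n)
  obtain ⟨Z, hZ⟩ := (hD.hasZeroObject (prod (mesh n) pt)).zero
  let Z' : (meshEx D n).dia pt := ⟨Z, hD.isMeshExact_of_isZero hZ⟩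
  let ι : (meshEx D n).dia pt ⥤ D.dia (prod (mesh n) pt) := level (meshIncl D n) pt
  have hι : ι.FullyFaithful := ObjectProperty.fullyFaithfulι _
  have hi : Limits.IsInitial Z' := Limits.IsInitial.ofUniqueHom
    (fun Y => hι.preimage (hZ.to_ (ι.obj Y)))
    fun Y f => hι.map_injective (hZ.eq_of_src (X := Z) (Y := ι.obj Y) _ _)
  have ht : Limits.IsTerminal Z' := Limits.IsTerminal.ofUniqueHom
    (fun Y => hι.preimage (hZ.from_ (ι.obj Y)))
    fun Y f => hι.map_injective (hZ.eq_of_tgt _ _)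
  refine ⟨⟨fun X ⟨hX⟩ => ⟨?_⟩, fun adj₁ _ adj₂ => ?_⟩, ⟨fun X ⟨hX⟩ => ⟨?_⟩, fun adj₁ _ adj₂ => ?_⟩⟩
  · exact hZ.isInitial.ofIso (ι.mapIso (hi.uniqueUpToIso hX))
  · have := hE.der3_left (toPt (shape.{w} Span))
    exact (isIso_mateEquiv_symm_iff adj₁ adj₂ _).2 (preservesUniversal_subIncl _ _
      fun _ _ _ h => hD.isMeshExact_of_isUniversal (toPt _) h)
  · exact hZ.isTerminal.ofIso (ι.mapIso (ht.uniqueUpToIso hX))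
  · have := hE.der3_right (toPt (shape.{w} Cospan))
    exact (isIso_mateEquiv_iff adj₁ adj₂ _).2 (preservesCouniversal_subIncl _ _
      fun _ _ _ h => hD.isMeshExact_of_isCouniversal (toPt _) h)

end IsStable

end Prederivator

/-! ### Exact morphisms preserve exact diagrams -/

namespace Prederivator

open Functor

/-- The cell which exhibits the final vertex of a square as a cocone under its span. -/
def spanCell : 𝟙 (shape.{w} Span) ≫ spanIncl ⟶ toPt (shape Span) ≫ point (A := shape Sq) ⟨(1, 1)⟩ :=
  NatTrans.toCatHom₂
    { app s := shapeHom (le_top : s.val.val ≤ ((1, 1) : Sq))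
      naturality _ _ _ := shape_hom_eq _ _ }

theorem initialFactorization_spanCell : InitialFactorization spanCell.{w} := fun x _ _ =>
  ⟨x, 𝟙 x, 𝟙 _, shape_hom_eq _ _, fun _ m' _ _ => ⟨m', ⟨Category.id_comp m', rfl⟩,
    fun _ ht => (Category.id_comp _).symm.trans ht.1⟩⟩

/-- A square is cocartesian if and only if its final vertex is a colimit of its span. -/
theorem IsDerivator.isCocartesian_iff_isUniversal {D : Prederivator.{w, v, u}} (hD : D.IsDerivator)
    {X : D.dia (shape Sq)} : D.IsCocartesian X ↔
      (D.restr (toPt (shape Span))).IsUniversal ((D.square spanCell).app X) := by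
  have key {V : D.dia (shape Sq)} (hV : (D.restr spanIncl).LeftExtended V) :
      (D.restr (toPt (shape Span))).IsUniversal ((D.square spanCell).app V) := by
    have := hD.preservesUniversal_square initialFactorization_spanCell _ (hV.isUniversal (𝟙 _))
    rwa [CategoryTheory.Functor.map_id, Category.id_comp] at this
  refine ⟨fun h => key (hD.isCocartesian_iff.1 h), fun h => hD.isCocartesian_iff.2
    (hD.leftExtended_of_comparison _ fun V c hV hc => ?_)⟩
  have h1 : IsIso ((D.restr (point (A := shape Sq) ⟨(1, 1)⟩)).map c) := by
    have : IsIso ((D.restr spanIncl ⋙ D.restr (𝟙 _)).map c) :=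
      inferInstanceAs (IsIso ((D.restr (𝟙 _)).map ((D.restr spanIncl).map c)))
    exact ((key hV).isIso_iff _ ((D.square spanCell).naturality c).symm).2 (h.precomp _)
  intro s
  by_cases hs : s.val = (1, 1)
  · obtain ⟨s⟩ := s
    obtain rfl : s = (1, 1) := hs
    exact h1
  · exact (isIso_point_restr_iff spanIncl (⟨⟨s.val, hs⟩⟩ : Shape Span) c).1 inferInstance

variable {D E : Prederivator.{w, v, u}}

theorem preservesUniversal_of_preservesColim (hD : D.IsDerivator) (hE : E.IsDerivator)
    {F : D ⟶ E} {A : Cat.{w, w}} (h : PreservesColim F A) :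
    PreservesUniversal (commRestr F (toPt A)).hom := by
  have := hD.der3_left (toPt A)
  have := hE.der3_left (toPt A)
  exact (isIso_mateEquiv_symm_iff (Adjunction.ofIsRightAdjoint (D.restr (toPt A)))
    (Adjunction.ofIsRightAdjoint (E.restr (toPt A))) _).1 (h _ _)

/-- An exact morphism carries colimit cocones of spans to colimit cocones. -/
theorem IsExact.isCocartesian (hD : D.IsDerivator) (hE : E.IsDerivator) {F : D ⟶ E}
    (hF : IsExact F) {X : D.dia (shape Sq)} (hX : D.IsCocartesian X) :
    E.IsCocartesian ((level F _).obj X) := by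
  rw [hE.isCocartesian_iff_isUniversal]
  have h1 := preservesUniversal_of_preservesColim hD hE hF.right.pushouts _
    (hD.isCocartesian_iff_isUniversal.1 hX)
  have h2 := square_commRestr F spanCell X
  let e := (commRestr F (𝟙 _)).hom.app ((D.restr spanIncl).obj X) ≫
    (E.restr (𝟙 _)).map ((commRestr F spanIncl).hom.app X)
  have h3 := (h1.postcomp
    ((commRestr F (point (A := shape Sq) ⟨(1, 1)⟩)).hom.app X)).precomp (inv e)
  refine h3.congr ?_
  rw [Category.assoc, h2]
  simp [e]

theorem IsExact.isZero (hE : E.IsStable) {F : D ⟶ E} (hF : IsExact F)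
    {X : D.dia pt} (hX : Limits.IsZero X) : Limits.IsZero ((level F pt).obj X) :=
  have := hE.pointed
  isZero_of_isInitial (hF.right.initial X ⟨hX.isInitial⟩).some

theorem IsExact.isMeshExact (hD : D.IsStable) (hE : E.IsStable) {F : D ⟶ E} (hF : IsExact F)
    {n : ℕ} {B : Cat.{w, w}} {X : D.dia (prod (mesh n) B)} (hX : D.IsMeshExact n (op B) X) :
    E.IsMeshExact n (op B) ((level F _).obj X) :=
  ⟨fun b k => (hF.isZero hE (hX.lower b k)).of_iso ((commRestr F _).symm.app X),
    fun b k => (hF.isZero hE (hX.upper b k)).of_iso ((commRestr F _).symm.app X),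
    fun b k l => (hE.isBicartesian_of_isCocartesian (hF.isCocartesian hD.isDerivator
      hE.isDerivator (hX.square b k l).1)).of_iso ((commRestr F _).app X)⟩

end Prederivator

namespace StableDerivator

open Prederivator

theorem preservesMeshExact (n : ℕ) : PreservesMeshExact.{w, v, u} n := fun D E F _ _ hX =>
  F.exact.isMeshExact D.isStable E.isStable hX

theorem exists_equivalence_meshRestrTrans {n : ℕ} (h : PreservesMeshExact.{w, v, u} n) :
    ∃ e : Bicategory.Equivalence (meshExFunctor h) (expFunctor (linear n)),
      e.hom = meshRestrTrans h :=
  Pseudofunctor.StrongTrans.exists_equivalence _ fun D =>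
    D.isStable.exists_equivalence_meshRestr n

end StableDerivator

end

theorem mainTheorem2 (n : ℕ) :
    (∀ D : StableDerivator.{w, v, u},
      (Prederivator.exp (Prederivator.mesh n) D.pre).IsDerivator ∧
      (Prederivator.exp (Prederivator.linear n) D.pre).IsDerivator ∧
      (Prederivator.meshEx D.pre n).IsDerivator ∧
      (∃ e : Bicategory.Equivalence (Prederivator.meshEx D.pre n)
          (Prederivator.exp (Prederivator.linear n) D.pre),
        e.hom = Prederivator.meshRestr D.pre n) ∧
      Prederivator.IsExact (Prederivator.meshIncl D.pre n)) ∧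
    ∃ (h : StableDerivator.PreservesMeshExact.{w, v, u} n)
      (e : Bicategory.Equivalence (StableDerivator.meshExFunctor h)
        (StableDerivator.expFunctor (Prederivator.linear n))),
      e.hom = StableDerivator.meshRestrTrans h := by
  exact ⟨fun D => ⟨D.isStable.isDerivator.exp _, D.isStable.isDerivator.exp _,
    D.isStable.isDerivator_meshEx n, D.isStable.exists_equivalence_meshRestr n,
    D.isStable.isExact_meshIncl n⟩, StableDerivator.preservesMeshExact n,
    StableDerivator.exists_equivalence_meshRestrTrans _⟩
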